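/- Let $n,k\ge 1$ be integers, write $\mathbb{R}^{n+k+1}=\mathbb{R}^{n+1}\times\mathbb{R}^k\ni(x,y)$, let $\mathbb{S}^{n+k}$ be its unit sphere with the round metric $g$, and let $\mathbb{S}^n=\{(x,0):|x|=1\}\subset\mathbb{S}^{n+k}$ be the equatorial sphere. A function $u:\mathbb{S}^{n+k}\to\mathbb{R}$ is called a singular Yamabe function for $\mathbb{S}^n$ if it is continuous, vanishes on $\mathbb{S}^n$, is smooth and positive on $\mathbb{S}^{n+k}\setminus\mathbb{S}^n$, and the metric $u^{-2}g$ is complete on $\mathbb{S}^{n+k}\setminus\mathbb{S}^n$ with constant scalar curvature $(k-n-2)(n+k-1)$. Let $t$ denote the $g$-distance to $\mathbb{S}^n$. Set $u_0(x,y)=|y|$ on $\mathbb{S}^{n+k}$ and $g^+=u_0^{-2}g$. (1) $u_0$ is a singular Yamabe function for $\mathbb{S}^n$; if $k<n+2$, it is the only one. (2) $(\mathbb{S}^{n+k}\setminus\mathbb{S}^n,g^+)$ is isometric to the Riemannian product $\mathbb{H}^{n+1}\times\mathbb{S}^{k-1}$ of hyperbolic space (curvature $-1$) and the round unit sphere.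 In particular, $\mathbb{S}^{n+k}\setminus\mathbb{S}^n$ with the round metric is conformal to $\mathbb{H}^{n+1}\times\mathbb{S}^{k-1}$. (3) For every $\varepsilon>0$ the volume $\mathrm{vol}_{g^+}(\{t>\varepsilon\})$ is finite, and there are real constants $c_0,\dots,c_{n-1}$, $\mathcal{E}_{n,k}$, $V_{n,k}$ (necessarily unique) such that, as $\varepsilon\to0^+$, $$\mathrm{vol}_{g^+}(\{t>\varepsilon\})=c_0\varepsilon^{-n}+c_1\varepsilon^{1-n}+\cdots+c_{n-1}\varepsilon^{-1}+\mathcal{E}_{n,k}\log(1/\varepsilon)+V_{n,k}+o(1).$$ If $n$ is even, then $$\mathcal{E}_{n,k}=(-1)^{n/2}\,\frac{4\pi^{(n+k)/2}}{(n/2)!\,\Gamma(k/2)}.$$ If $n$ is odd, then $$V_{n,k}=(-1)^{(n+1)/2}\,\frac{2\pi^{1+(n+k)/2}}{\Gamma\left(\frac{n+2}{2}\right)\Gamma\left(\frac k2\right)}.$$ In particular $\mathcal{E}_{2,2}=-4\pi^2$, and the equatorial unknot $\mathbb{S}^1\subset\mathbb{S}^3$ has $V_{1,2}=-4\pi^2$.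 -/

import Mathlib

open scoped Manifold ContDiff ENNReal Topology

noncomputable section

namespace EquatorialYamabe

/-! ### The round sphere and its equator -/

/-- Euclidean space `ℝ^{n+k+1} = ℝ^{n+1} × ℝ^k`, with its Euclidean norm. -/
abbrev Ambient (n k : ℕ) : Type := EuclideanSpace ℝ (Fin (n + 1) ⊕ Fin k)

instance finrank_ambient (n k : ℕ) :
    Fact (Module.finrank ℝ (Ambient n k) = (n + k) + 1) :=
  ⟨by simp only [finrank_euclideanSpace, Fintype.card_sum, Fintype.card_fin]; omega⟩

/-- The unit sphere `S^{n+k}`, with Mathlib's smooth structure. -/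
abbrev RoundSphere (n k : ℕ) : Type := Metric.sphere (0 : Ambient n k) 1

/-- The component in `ℝ^{n+1}` of a point of `ℝ^{n+1} × ℝ^k`. -/
def xPart {n k : ℕ} (q : Ambient n k) : EuclideanSpace ℝ (Fin (n + 1)) :=
  WithLp.toLp 2 (fun i => q (Sum.inl i))

/-- The component in `ℝ^k` of a point of `ℝ^{n+1} × ℝ^k`. -/
def yPart {n k : ℕ} (q : Ambient n k) : EuclideanSpace ℝ (Fin k) :=
  WithLp.toLp 2 (fun j => q (Sum.inr j))

/-- The equatorial sphere `S^n = {(x, 0) : |x| = 1}` in `S^{n+k}`. -/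
def equator (n k : ℕ) : Set (RoundSphere n k) := {p | yPart (p : Ambient n k) = 0}

/-! ### Scalar curvature of a metric given by its coefficients in a coordinate chart -/

section Coordinates

variable {N : ℕ}

/-- The `i`-th partial derivative. -/
def pderiv (i : Fin N) (f : EuclideanSpace ℝ (Fin N) → ℝ) (x : EuclideanSpace ℝ (Fin N)) : ℝ :=
  fderiv ℝ f x (EuclideanSpace.single i 1)

/-- The Christoffel symbol
`Γ^l_{ij} = ½ ∑_m G^{lm} (∂_i G_{jm} + ∂_j G_{im} - ∂_m G_{ij})`. -/
def christoffel (G : EuclideanSpace ℝ (Fin N) → Matrix (Fin N) (Fin N) ℝ) (l i j : Fin N)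
    (x : EuclideanSpace ℝ (Fin N)) : ℝ :=
  (1 / 2) * ∑ m, (G x)⁻¹ l m *
    (pderiv i (fun z => G z j m) x + pderiv j (fun z => G z i m) x
      - pderiv m (fun z => G z i j) x)

/-- The Ricci tensor
`R_{ij} = ∂_l Γ^l_{ij} - ∂_j Γ^l_{il} + Γ^l_{lm} Γ^m_{ij} - Γ^l_{jm} Γ^m_{il}`
(summed over repeated indices; positive on round spheres). -/
def ricci (G : EuclideanSpace ℝ (Fin N) → Matrix (Fin N) (Fin N) ℝ) (i j : Fin N)
    (x : EuclideanSpace ℝ (Fin N)) : ℝ :=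
  ∑ l, (pderiv l (christoffel G l i j) x - pderiv j (christoffel G l i l) x
    + ∑ m, (christoffel G l l m x * christoffel G m i j x
      - christoffel G l j m x * christoffel G m i l x))

/-- The scalar curvature `R = G^{ij} R_{ij}`. -/
def scalarCurvature (G : EuclideanSpace ℝ (Fin N) → Matrix (Fin N) (Fin N) ℝ)
    (x : EuclideanSpace ℝ (Fin N)) : ℝ :=
  ∑ i, ∑ j, (G x)⁻¹ i j * ricci G i j x

end Coordinates

/-! ### The conformal metrics `u⁻² g`, where `g` is the round metric -/

section Conformal

variable {n k : ℕ}

/-- The coefficients `u⁻² ⟨∂_i ψ, ∂_j ψ⟩` of the metric `u⁻² g` in the preferred chart at `p`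
(stereographic projection from `-p`), where `ψ` is the inverse of that chart, viewed as a map to
the ambient Euclidean space. -/
def conformalCoeff (u : RoundSphere n k → ℝ) (p : RoundSphere n k)
    (x : EuclideanSpace ℝ (Fin (n + k))) : Matrix (Fin (n + k)) (Fin (n + k)) ℝ :=
  fun i j =>
    (u ((chartAt (EuclideanSpace ℝ (Fin (n + k))) p).symm x))⁻¹ ^ 2 *
      inner ℝ
        (fderiv ℝ (fun z => (((chartAt (EuclideanSpace ℝ (Fin (n + k))) p).symm z :
          RoundSphere n k) : Ambient n k)) x (EuclideanSpace.single i 1))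
        (fderiv ℝ (fun z => (((chartAt (EuclideanSpace ℝ (Fin (n + k))) p).symm z :
          RoundSphere n k) : Ambient n k)) x (EuclideanSpace.single j 1))

/-- The scalar curvature of `u⁻² g` at `p`. -/
def conformalScalarCurvature (u : RoundSphere n k → ℝ) (p : RoundSphere n k) : ℝ :=
  scalarCurvature (conformalCoeff u p) (chartAt (EuclideanSpace ℝ (Fin (n + k))) p p)

/-- The length with respect to `u⁻² g` of a curve `γ : [0, 1] → S^{n+k}`. -/
def conformalLength (u : RoundSphere n k → ℝ) (γ : ℝ → RoundSphere n k) : ℝ≥0∞ :=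
  ∫⁻ s in Set.Icc (0 : ℝ) 1,
    ENNReal.ofReal
      (‖derivWithin (fun τ => (γ τ : Ambient n k)) (Set.Icc 0 1) s‖ / u (γ s))

/-- The Riemannian distance of the metric `u⁻² g` on the open set `A`: the infimum of the lengths
of `C¹` curves in `A` from `p` to `q` (infinite if there are none). -/
def conformalDist (u : RoundSphere n k → ℝ) (A : Set (RoundSphere n k))
    (p q : RoundSphere n k) : ℝ≥0∞ :=
  ⨅ γ ∈ {γ : ℝ → RoundSphere n k |
      ContDiffOn ℝ 1 (fun τ => (γ τ : Ambient n k)) (Set.Icc 0 1) ∧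
        γ 0 = p ∧ γ 1 = q ∧ ∀ s ∈ Set.Icc (0 : ℝ) 1, γ s ∈ A},
    conformalLength u γ

/-- Completeness of the metric `u⁻² g` on the open set `A`: Cauchy sequences for its Riemannian
distance converge in `A`. -/
def ConformalComplete (u : RoundSphere n k → ℝ) (A : Set (RoundSphere n k)) : Prop :=
  ∀ a : ℕ → RoundSphere n k, (∀ i, a i ∈ A) →
    (∀ ε : ℝ≥0∞, 0 < ε → ∃ m₀ : ℕ, ∀ i ≥ m₀, ∀ j ≥ m₀, conformalDist u A (a i) (a j) < ε) →
    ∃ p ∈ A, Filter.Tendsto (fun i => conformalDist u A (a i) p) Filter.atTop (𝓝 0)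

/-- `u` solves the singular Yamabe problem for `(S^{n+k}, g)` with singular set the equator `S^n`:
`u` is continuous, vanishes exactly on the equator, is positive and smooth off it, and `u⁻² g` is
a complete metric on `S^{n+k} ∖ S^n` of constant scalar curvature `(k - n - 2)(n + k - 1)`. -/
structure IsSingularYamabe (u : RoundSphere n k → ℝ) : Prop where
  continuous : Continuous u
  eq_zero : ∀ p ∈ equator n k, u p = 0
  pos : ∀ p ∉ equator n k, 0 < u p
  smooth : ContMDiffOn (𝓡 (n + k)) 𝓘(ℝ, ℝ) ∞ u (equator n k)ᶜ
  complete : ConformalComplete u (equator n k)ᶜ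
  scalar : ∀ p ∉ equator n k,
    conformalScalarCurvature u p = ((k : ℝ) - n - 2) * ((n : ℝ) + k - 1)

/-- `(S^{n+k} ∖ S^n, u⁻² g)` is isometric to `H^{n+1} × S^{k-1}`, where `H^{n+1}` is the unit ball
with the metric `4 |dz|² / (1 - |z|²)²` and `S^{k-1}` is the round unit sphere in `ℝ^k`.
The two components of the isometry are given as smooth maps on the open set `{y ≠ 0}` of the
ambient space; only their restrictions to the sphere matter. -/
def IsometricToHyperbolicTimesSphere (u : RoundSphere n k → ℝ) : Prop :=
  ∃ (Φ : Ambient n k → EuclideanSpace ℝ (Fin (n + 1)))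
    (Θ : Ambient n k → EuclideanSpace ℝ (Fin k)),
    ContDiffOn ℝ ∞ Φ {q | yPart q ≠ 0} ∧
    ContDiffOn ℝ ∞ Θ {q | yPart q ≠ 0} ∧
    Set.BijOn (fun p : RoundSphere n k => (Φ (p : Ambient n k), Θ (p : Ambient n k)))
      (equator n k)ᶜ (Metric.ball 0 1 ×ˢ Metric.sphere 0 1) ∧
    ∀ p : RoundSphere n k, p ∉ equator n k →
      ∀ v : Ambient n k, inner ℝ (p : Ambient n k) v = 0 →
        4 / (1 - ‖Φ (p : Ambient n k)‖ ^ 2) ^ 2 * ‖fderiv ℝ Φ (p : Ambient n k) v‖ ^ 2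
            + ‖fderiv ℝ Θ (p : Ambient n k) v‖ ^ 2
          = (u p)⁻¹ ^ 2 * ‖v‖ ^ 2

/-! ### The renormalized volume expansion -/

/-- The distance `t` to the equator with respect to the round metric `g`. -/
def distToEquator (p : RoundSphere n k) : ℝ≥0∞ :=
  ⨅ q ∈ equator n k, conformalDist (fun _ => 1) Set.univ p q

/-- The volume of `{t > ε}` with respect to `u⁻² g`, that is, the integral of `u^{-(n+k)}` over
`{t > ε}` with respect to the surface measure of the unit sphere. -/
def volumeBeyond (u : RoundSphere n k → ℝ) (ε : ℝ) : ℝ≥0∞ :=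
  ∫⁻ p in {p : RoundSphere n k | ENNReal.ofReal ε < distToEquator p},
    ENNReal.ofReal ((u p)⁻¹ ^ (n + k))
      ∂((MeasureTheory.volume : MeasureTheory.Measure (Ambient n k)).toSphere)

/-- The volume of `{t > ε}` with respect to `u⁻² g` is finite for `ε > 0`, and equals
`c₀ ε^{-n} + c₁ ε^{1-n} + ⋯ + c_{n-1} ε^{-1} + E log (1/ε) + V + o(1)` as `ε → 0⁺`. -/
def HasVolumeExpansion (u : RoundSphere n k → ℝ) (c : ℕ → ℝ) (E V : ℝ) : Prop :=
  (∀ ε : ℝ, 0 < ε → volumeBeyond u ε ≠ ⊤) ∧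
  Filter.Tendsto
    (fun ε : ℝ => (volumeBeyond u ε).toReal -
      ((∑ j ∈ Finset.range n, c j * ε ^ ((j : ℤ) - (n : ℤ))) + E * Real.log (1 / ε) + V))
    (𝓝[>] 0) (𝓝 0)

end Conformal

/-- The function `u(x, y) = |y|` on `S^{n+k}`. -/
def equatorialFactor (n k : ℕ) (p : RoundSphere n k) : ℝ := ‖yPart (p : Ambient n k)‖

end EquatorialYamabe

end

/-!
# The equatorial singular Yamabe problem on the sphere

Throughout, `ρ(x, y) = |y|` on `ℝ^{n+1} × ℝ^k`, and a function `u` on the sphere is replaced by its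
`1`-homogeneous extension `U`, so that `ρ` itself extends `u₀ = |y|`. In a stereographic chart
`u⁻² g` is conformally flat, and its scalar curvature becomes
`(N - 1) (2 U ΔU - N |∇U|²)` with `N = n + k` and ambient derivatives
(`conformalScalarCurvature_eq`). The singular Yamabe equation therefore reads
`2 U ΔU - N |∇U|² = -(n + 2 - k)`, which `ρ` satisfies since `Δρ = (k - 1) / ρ` and `|∇ρ| = 1`.
Completeness of `|y|⁻² g` holds because `log |y|` is `1`-Lipschitz for it. The isometry with
`ℍ^{n+1} × 𝕊^{k-1}` is `(x, y) ↦ (x / (1 + |y|), y / |y|)`.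

**Uniqueness for `k < n + 2`.** The maximum principle, applied to the quotient of `u` and a
logarithmic barrier that is positive only away from the equator, gives `|y| ≤ u`
(`IsSingularYamabe.equatorialFactor_le`). If `k = 1`, comparison with `|y| + a |(x, y)|` as
`a → 0` gives the reverse inequality (`IsSingularYamabe.le_equatorialFactor_of_codim_one`).

If `k ≥ 2`, the function `φ = (|y| / u)^{1/4} ≤ 1` satisfies
`-L φ ≥ φ (1 - φ⁸) / 8 + |∇φ|²`, where `L` and the gradient are those of `|y|⁻² g`
(`le_neg_hypLap_rootRatio`). Averaging over `O(n+1) × O(k)` turns this into the inequality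
`F'' + n coth(s) F' ≤ -H ≤ 0` for a function `F` of the distance `s` to a point of `ℍ^{n+1}`,
with values in `[0, 1]` (`orbitAverage_equation`). Hence `F` decreases, and `H` is integrable at
infinity (`radial_supersolution`). By Fubini's theorem `φ (1 - φ⁸) + |∇φ|²` is integrable along
almost every ray of the hyperbolic factor, and a one-variable argument shows that along such a ray
either `φ → 1`, or `φ` is integrable (`tendsto_one_or_integrable`). In the latter case the ray has
finite length for `u⁻² g`, against completeness (`not_integrableOn_rootRatio`). So `φ → 1` along
almost every ray, `F → 1`, and the decreasing function `F ≤ 1` is identically `1`. This forces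
`φ = 1`.

**Volume.** The distance to the equator is `arcsin |y|` (`distToEquator_eq`). The integral of
`|y|^{-(n+k)}` over `{|y| > sin ε}` is computed by writing the volume of a weighted cone in polar
coordinates in two ways: on `ℝ^{n+k+1}`, and on each factor of `ℝ^{n+1} × ℝ^k`. The result is
`vol(𝕊^n) vol(𝕊^{k-1}) I_n(cot ε)` with `I_n(T) = ∫₀ᵀ sⁿ / √(1 + s²) ds` (`volumeBeyond_eq`).
Integration by parts expresses `I_{n+2}(cot ε)` through `I_n(cot ε)` and `cos^{n+1} ε / sin^{n+2} ε`.
The latter is `ε^{-n-2}` times an even analytic function, so that it contributes no logarithm and,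
for odd `n`, no constant. The logarithmic coefficient (`n` even) and the constant (`n` odd) are thus
given by a two-step recursion starting at `I_0 = arsinh` and `I_1 = √(1 + T²) - 1`
(`exists_hasExpansion_coneIntegral`).
-/

noncomputable section

namespace EquatorialYamabe

/-! ### First and second partial derivatives on Euclidean space -/

section Calculus

set_option linter.unusedSectionVars false

variable {ι : Type*} [Fintype ι] [DecidableEq ι]

/-- The `i`-th partial derivative, for an arbitrary finite index type. -/
def pd (i : ι) (f : EuclideanSpace ℝ ι → ℝ) (x : EuclideanSpace ℝ ι) : ℝ :=
  fderiv ℝ f x (EuclideanSpace.single i 1)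

/-- The Euclidean Laplacian `∑ ∂ᵢ∂ᵢ f`. -/
def lap (f : EuclideanSpace ℝ ι → ℝ) (x : EuclideanSpace ℝ ι) : ℝ :=
  ∑ i, pd i (pd i f) x

/-- The Euclidean inner product `⟨∇f, ∇h⟩` of two gradients. -/
def gdot (f h : EuclideanSpace ℝ ι → ℝ) (x : EuclideanSpace ℝ ι) : ℝ :=
  ∑ i, pd i f x * pd i h x

variable {f h : EuclideanSpace ℝ ι → ℝ} {x : EuclideanSpace ℝ ι}

lemma eventually_differentiableAt (hf : ContDiffAt ℝ 2 f x) :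
    ∀ᶠ z in 𝓝 x, DifferentiableAt ℝ f z := by
  filter_upwards [hf.eventually (by simp)] with z hz
  exact hz.differentiableAt (by simp)

lemma differentiableAt_fderiv_apply (hf : ContDiffAt ℝ 2 f x) (v : EuclideanSpace ℝ ι) :
    DifferentiableAt ℝ (fun z => fderiv ℝ f z v) x := by
  have h1 : ContDiffAt ℝ 1 (fderiv ℝ f) x := hf.fderiv_right (by norm_num)
  exact (h1.differentiableAt (by simp)).clm_apply (differentiableAt_const _)

lemma differentiableAt_pd (hf : ContDiffAt ℝ 2 f x) (i : ι) : DifferentiableAt ℝ (pd i f) x :=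
  differentiableAt_fderiv_apply hf _

lemma pd_congr (hfh : f =ᶠ[𝓝 x] h) (i : ι) : pd i f x = pd i h x := by
  unfold pd; rw [hfh.fderiv_eq]

lemma pd_eventuallyEq (hfh : f =ᶠ[𝓝 x] h) (i : ι) : pd i f =ᶠ[𝓝 x] pd i h := by
  filter_upwards [hfh.fderiv (𝕜 := ℝ)] with z hz
  unfold pd; rw [hz]

lemma lap_congr (hfh : f =ᶠ[𝓝 x] h) : lap f x = lap h x :=
  Finset.sum_congr rfl fun i _ => pd_congr (pd_eventuallyEq hfh i) i

lemma gdot_congr {f' h' : EuclideanSpace ℝ ι → ℝ} (hf : f =ᶠ[𝓝 x] f') (hh : h =ᶠ[𝓝 x] h') :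
    gdot f h x = gdot f' h' x :=
  Finset.sum_congr rfl fun _ _ => by rw [pd_congr hf, pd_congr hh]

lemma gdot_comm : gdot f h x = gdot h f x :=
  Finset.sum_congr rfl fun _ _ => mul_comm _ _

lemma gdot_self_nonneg : 0 ≤ gdot f f x := Finset.sum_nonneg fun _ _ => mul_self_nonneg _

lemma pd_const (c : ℝ) (i : ι) : pd i (fun _ => c) x = 0 := by simp [pd]

lemma pd_add (hf : DifferentiableAt ℝ f x) (hh : DifferentiableAt ℝ h x) (i : ι) :
    pd i (fun z => f z + h z) x = pd i f x + pd i h x := by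
  unfold pd; rw [fderiv_fun_add hf hh]; rfl

lemma pd_sub (hf : DifferentiableAt ℝ f x) (hh : DifferentiableAt ℝ h x) (i : ι) :
    pd i (fun z => f z - h z) x = pd i f x - pd i h x := by
  unfold pd; rw [fderiv_fun_sub hf hh]; rfl

lemma pd_const_mul (hf : DifferentiableAt ℝ f x) (c : ℝ) (i : ι) :
    pd i (fun z => c * f z) x = c * pd i f x := by
  unfold pd; rw [fderiv_const_mul hf]; rfl

lemma pd_mul (hf : DifferentiableAt ℝ f x) (hh : DifferentiableAt ℝ h x) (i : ι) :
    pd i (fun z => f z * h z) x = f x * pd i h x + h x * pd i f x := by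
  unfold pd; rw [fderiv_fun_mul hf hh]; rfl

lemma pd_comp {φ : ℝ → ℝ} {φ' : ℝ} (hφ : HasDerivAt φ φ' (f x)) (hf : DifferentiableAt ℝ f x)
    (i : ι) : pd i (fun z => φ (f z)) x = φ' * pd i f x := by
  have h1 : HasFDerivAt (fun z => φ (f z)) (φ' • fderiv ℝ f x) x :=
    hφ.comp_hasFDerivAt x hf.hasFDerivAt
  unfold pd; rw [h1.fderiv]; rfl

lemma gdot_mul_left {e : EuclideanSpace ℝ ι → ℝ} (hf : DifferentiableAt ℝ f x)
    (hh : DifferentiableAt ℝ h x) :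
    gdot (fun z => f z * h z) e x = f x * gdot h e x + h x * gdot f e x := by
  unfold gdot
  simp only [pd_mul hf hh, Finset.mul_sum, ← Finset.sum_add_distrib]
  exact Finset.sum_congr rfl fun i _ => by ring

lemma gdot_comp_left {e : EuclideanSpace ℝ ι → ℝ} {φ : ℝ → ℝ} {φ' : ℝ}
    (hφ : HasDerivAt φ φ' (f x)) (hf : DifferentiableAt ℝ f x) :
    gdot (fun z => φ (f z)) e x = φ' * gdot f e x := by
  unfold gdot
  simp only [pd_comp hφ hf, Finset.mul_sum]
  exact Finset.sum_congr rfl fun i _ => by ring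

lemma gdot_add_left {e : EuclideanSpace ℝ ι → ℝ} (hf : DifferentiableAt ℝ f x)
    (hh : DifferentiableAt ℝ h x) :
    gdot (fun z => f z + h z) e x = gdot f e x + gdot h e x := by
  unfold gdot
  simp only [pd_add hf hh, ← Finset.sum_add_distrib]
  exact Finset.sum_congr rfl fun i _ => by ring

lemma gdot_sub_left {e : EuclideanSpace ℝ ι → ℝ} (hf : DifferentiableAt ℝ f x)
    (hh : DifferentiableAt ℝ h x) :
    gdot (fun z => f z - h z) e x = gdot f e x - gdot h e x := by
  unfold gdot
  simp only [pd_sub hf hh, ← Finset.sum_sub_distrib]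
  exact Finset.sum_congr rfl fun i _ => by ring

lemma gdot_const_mul_left {e : EuclideanSpace ℝ ι → ℝ} (hf : DifferentiableAt ℝ f x) (c : ℝ) :
    gdot (fun z => c * f z) e x = c * gdot f e x := by
  unfold gdot
  simp only [pd_const_mul hf, Finset.mul_sum]
  exact Finset.sum_congr rfl fun i _ => by ring

lemma gdot_const_left (c : ℝ) : gdot (fun _ => c) f x = 0 := by
  simp [gdot, pd_const]

lemma lap_const (c : ℝ) : lap (fun _ => c) x = 0 := by
  have : ∀ i : ι, pd i (fun _ : EuclideanSpace ℝ ι => c) = fun _ => 0 := fun i =>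
    funext fun z => pd_const c i
  simp [lap, this, pd_const]

lemma lap_add (hf : ContDiffAt ℝ 2 f x) (hh : ContDiffAt ℝ 2 h x) :
    lap (fun z => f z + h z) x = lap f x + lap h x := by
  unfold lap
  rw [← Finset.sum_add_distrib]
  refine Finset.sum_congr rfl fun i _ => ?_
  rw [← pd_add (differentiableAt_pd hf i) (differentiableAt_pd hh i)]
  refine pd_congr ?_ i
  filter_upwards [eventually_differentiableAt hf, eventually_differentiableAt hh] with z h1 h2
  exact pd_add h1 h2 i

lemma lap_sub (hf : ContDiffAt ℝ 2 f x) (hh : ContDiffAt ℝ 2 h x) :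
    lap (fun z => f z - h z) x = lap f x - lap h x := by
  unfold lap
  rw [← Finset.sum_sub_distrib]
  refine Finset.sum_congr rfl fun i _ => ?_
  rw [← pd_sub (differentiableAt_pd hf i) (differentiableAt_pd hh i)]
  refine pd_congr ?_ i
  filter_upwards [eventually_differentiableAt hf, eventually_differentiableAt hh] with z h1 h2
  exact pd_sub h1 h2 i

lemma lap_const_mul (hf : ContDiffAt ℝ 2 f x) (c : ℝ) :
    lap (fun z => c * f z) x = c * lap f x := by
  unfold lap
  rw [Finset.mul_sum]
  refine Finset.sum_congr rfl fun i _ => ?_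
  rw [← pd_const_mul (differentiableAt_pd hf i)]
  refine pd_congr ?_ i
  filter_upwards [eventually_differentiableAt hf] with z h1
  exact pd_const_mul h1 c i

lemma lap_mul (hf : ContDiffAt ℝ 2 f x) (hh : ContDiffAt ℝ 2 h x) :
    lap (fun z => f z * h z) x = f x * lap h x + h x * lap f x + 2 * gdot f h x := by
  unfold lap gdot
  rw [Finset.mul_sum, Finset.mul_sum, Finset.mul_sum, ← Finset.sum_add_distrib,
    ← Finset.sum_add_distrib]
  refine Finset.sum_congr rfl fun i _ => ?_
  have hf1 := hf.differentiableAt (by simp)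
  have hh1 := hh.differentiableAt (by simp)
  have hf2 := differentiableAt_pd hf i
  have hh2 := differentiableAt_pd hh i
  have : pd i (fun z => f z * h z) =ᶠ[𝓝 x] fun z => f z * pd i h z + h z * pd i f z := by
    filter_upwards [eventually_differentiableAt hf, eventually_differentiableAt hh] with z h1 h2
    exact pd_mul h1 h2 i
  rw [pd_congr this, pd_add (hf1.fun_mul hh2) (hh1.fun_mul hf2), pd_mul hf1 hh2, pd_mul hh1 hf2]
  ring

lemma lap_comp {φ φ' : ℝ → ℝ} {φ'' : ℝ} (hφ : ∀ᶠ s in 𝓝 (f x), HasDerivAt φ (φ' s) s)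
    (hφ' : HasDerivAt φ' φ'' (f x)) (hf : ContDiffAt ℝ 2 f x) :
    lap (fun z => φ (f z)) x = φ'' * gdot f f x + φ' (f x) * lap f x := by
  unfold lap gdot
  rw [Finset.mul_sum, Finset.mul_sum, ← Finset.sum_add_distrib]
  refine Finset.sum_congr rfl fun i _ => ?_
  have hf1 := hf.differentiableAt (by simp)
  have hf2 := differentiableAt_pd hf i
  have : pd i (fun z => φ (f z)) =ᶠ[𝓝 x] fun z => φ' (f z) * pd i f z := by
    filter_upwards [eventually_differentiableAt hf, hf1.continuousAt.eventually hφ] with z h1 h2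
    exact pd_comp h2 h1 i
  have hc : DifferentiableAt ℝ (fun z => φ' (f z)) x :=
    (hφ'.comp_hasFDerivAt x hf1.hasFDerivAt).differentiableAt
  rw [pd_congr this, pd_mul hc hf2, pd_comp hφ' hf1]
  ring

/-- The second derivative along a line is the second partial derivative. -/
lemma hasDerivAt_line {q : EuclideanSpace ℝ ι} {v : EuclideanSpace ℝ ι} {t : ℝ}
    (hf : DifferentiableAt ℝ f (q + t • v)) :
    HasDerivAt (fun s : ℝ => f (q + s • v)) (fderiv ℝ f (q + t • v) v) t := by
  have h1 : HasDerivAt (fun s : ℝ => q + s • v) v t := by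
    simpa using ((hasDerivAt_id t).smul_const v).const_add q
  exact hf.hasFDerivAt.comp_hasDerivAt t h1

/-- Second-order necessary condition at a local minimum on the line. -/
lemma deriv_eq_zero_and_deriv2_nonneg {e e' : ℝ → ℝ} {e'' : ℝ}
    (hmin : IsLocalMin e 0) (he : ∀ᶠ t in 𝓝 (0 : ℝ), HasDerivAt e (e' t) t)
    (he' : HasDerivAt e' e'' 0) : e' 0 = 0 ∧ 0 ≤ e'' := by
  have h0 : e' 0 = 0 := hmin.hasDerivAt_eq_zero he.self_of_nhds
  refine ⟨h0, ?_⟩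
  by_contra! hneg
  -- `e'` has the sign of `-t` near `0`, so `0` would be a strict local maximum as well
  have hev : e' =ᶠ[𝓝 0] deriv e := by
    filter_upwards [he] with t ht using ht.deriv.symm
  have hcont : ContinuousAt e 0 := he.self_of_nhds.continuousAt
  have hd0 : deriv e 0 = 0 := by rw [← hev.self_of_nhds, h0]
  have hmax : IsLocalMax e 0 := by
    refine isLocalMax_of_deriv_deriv_neg ?_ hd0 hcont
    rw [← hev.deriv_eq, he'.deriv]; exact hneg
  have hc : e =ᶠ[𝓝 0] fun _ => e 0 := by
    filter_upwards [hmin, hmax] with t h1 h2 using le_antisymm h2 h1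
  have : e' =ᶠ[𝓝 0] fun _ => 0 := by
    refine hev.trans ?_
    filter_upwards [hc.eventuallyEq_nhds] with t ht
    rw [ht.deriv_eq]; simp
  have h3 : e'' = 0 := by
    have := this.deriv_eq
    rw [he'.deriv] at this
    simpa using this
  exact hneg.ne h3

/-- If `f ≤ h` near `x` with equality at `x`, then `∇f = ∇h` and `Δf ≤ Δh` at `x`. -/
lemma touching (hf : ContDiffAt ℝ 2 f x) (hh : ContDiffAt ℝ 2 h x)
    (hle : ∀ᶠ z in 𝓝 x, f z ≤ h z) (heq : f x = h x) :
    (∀ i, pd i f x = pd i h x) ∧ lap f x ≤ lap h x := by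
  have key : ∀ i : ι, pd i f x = pd i h x ∧ pd i (pd i f) x ≤ pd i (pd i h) x := by
    intro i
    set v : EuclideanSpace ℝ ι := EuclideanSpace.single i 1
    have hd : ContDiffAt ℝ 2 (fun z => h z - f z) x := hh.sub hf
    have hct : Filter.Tendsto (fun t : ℝ => x + t • v) (𝓝 0) (𝓝 x) := by
      have : Continuous (fun t : ℝ => x + t • v) := by fun_prop
      simpa using this.tendsto 0
    have hmin : IsLocalMin (fun t : ℝ => h (x + t • v) - f (x + t • v)) 0 := by
      filter_upwards [hct.eventually hle] with t ht
      simp [heq]; linarith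
    have h1 : ∀ᶠ t in 𝓝 (0 : ℝ), HasDerivAt (fun t : ℝ => h (x + t • v) - f (x + t • v))
        (pd i (fun z => h z - f z) (x + t • v)) t := by
      filter_upwards [hct.eventually (eventually_differentiableAt hd)] with t ht
      exact hasDerivAt_line (f := fun z => h z - f z) ht
    have h2 : HasDerivAt (fun t : ℝ => pd i (fun z => h z - f z) (x + t • v))
        (pd i (pd i (fun z => h z - f z)) x) 0 := by
      have := hasDerivAt_line (f := pd i (fun z => h z - f z)) (q := x) (v := v) (t := 0)
        (by simpa using differentiableAt_pd hd i)
      simpa [pd] using this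
    obtain ⟨h3, h4⟩ := deriv_eq_zero_and_deriv2_nonneg hmin h1 h2
    have h5 : pd i (pd i (fun z => h z - f z)) x = pd i (pd i h) x - pd i (pd i f) x := by
      rw [← pd_sub (differentiableAt_pd hh i) (differentiableAt_pd hf i)]
      refine pd_congr ?_ i
      filter_upwards [eventually_differentiableAt hf, eventually_differentiableAt hh] with z h1 h2
      exact pd_sub h2 h1 i
    simp only [zero_smul, add_zero] at h3
    rw [pd_sub (hh.differentiableAt (by simp)) (hf.differentiableAt (by simp))] at h3
    exact ⟨by linarith, by linarith⟩
  exact ⟨fun i => (key i).1, Finset.sum_le_sum fun i _ => (key i).2⟩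

end Calculus

/-! ### Scalar curvature of a conformally flat metric -/

section ConformallyFlat

variable {N : ℕ} {G : EuclideanSpace ℝ (Fin N) → Matrix (Fin N) (Fin N) ℝ}
  {v : EuclideanSpace ℝ (Fin N) → ℝ} {x : EuclideanSpace ℝ (Fin N)}

lemma inv_conformallyFlat (hG : G x = ((v x)⁻¹ ^ 2) • (1 : Matrix (Fin N) (Fin N) ℝ))
    (hv : v x ≠ 0) : (G x)⁻¹ = (v x ^ 2) • (1 : Matrix (Fin N) (Fin N) ℝ) := by
  rw [hG]
  refine Matrix.inv_eq_right_inv ?_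
  rw [smul_mul_smul_comm, one_mul, ← mul_pow, inv_mul_cancel₀ hv, one_pow, one_smul]

/-- The Kronecker delta. -/
def kron (i j : Fin N) : ℝ := if i = j then 1 else 0

lemma christoffel_conformallyFlat
    (hG : ∀ᶠ z in 𝓝 x, G z = ((v z)⁻¹ ^ 2) • (1 : Matrix (Fin N) (Fin N) ℝ))
    (hv : v x ≠ 0) (hd : DifferentiableAt ℝ v x) (l i j : Fin N) :
    christoffel G l i j x =
      kron j l * -(pd i v x / v x) + kron i l * -(pd j v x / v x)
        - kron i j * -(pd l v x / v x) := by
  have hp : ∀ a b c : Fin N, pderiv a (fun z => G z b c) x =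
      kron b c * (2 * (v x)⁻¹ ^ 2 * -(pd a v x / v x)) := by
    intro a b c
    have h1 : (fun z => G z b c) =ᶠ[𝓝 x] fun z => (v z)⁻¹ ^ 2 * kron b c := by
      filter_upwards [hG] with z hz
      rw [hz, Matrix.smul_apply, Matrix.one_apply, smul_eq_mul, kron]
    have h2 : HasDerivAt (fun s : ℝ => s⁻¹ ^ 2 * kron b c)
        ((2 * (v x)⁻¹ ^ 2 * -(v x)⁻¹) * kron b c) (v x) := by
      refine (((hasDerivAt_inv hv).fun_pow 2).mul_const _).congr_deriv ?_
      congr 1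
      simp only [Nat.cast_ofNat, Nat.add_one_sub_one, pow_one]
      field_simp
    have h3 := pd_comp h2 hd a
    have h4 := pd_congr h1 a
    unfold pd at h3 h4
    unfold pderiv pd
    rw [h4, h3, div_eq_mul_inv]; ring
  have hvv : v x ^ 2 * (v x)⁻¹ ^ 2 = 1 := by rw [← mul_pow, mul_inv_cancel₀ hv, one_pow]
  unfold christoffel
  rw [inv_conformallyFlat hG.self_of_nhds hv]
  simp only [Matrix.smul_apply, Matrix.one_apply, smul_eq_mul, hp, mul_ite, mul_one, mul_zero,
    ite_mul, zero_mul]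
  rw [Finset.sum_ite_eq]
  simp only [Finset.mem_univ, if_true]
  linear_combination (kron j l * -(pd i v x / v x) + kron i l * -(pd j v x / v x)
        - kron i j * -(pd l v x / v x)) * hvv

lemma sum_kron (i : Fin N) (e : Fin N → ℝ) : ∑ j, kron i j * e j = e i := by
  simp [kron]

lemma kron_self (i : Fin N) : kron i i = 1 := by simp [kron]

lemma kron_comm (i j : Fin N) : kron i j = kron j i := by simp [kron, eq_comm]

lemma kron_mul_self (i j : Fin N) : kron i j * kron i j = kron i j := by simp [kron]

/-- The algebra behind the trace of the Ricci tensor: `a i` stands for `∂ᵢ log (1 / v)` and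
`b i j` for `∂ⱼ aᵢ`. -/
lemma trace_ricci_algebra (a : Fin N → ℝ) (b : Fin N → Fin N → ℝ) :
    ∑ i, ∑ l, ((kron i l * b i l + kron i l * b i l - kron i i * b l l)
        - (kron l l * b i i + kron i l * b l i - kron i l * b l i)
        + ∑ m, ((kron m l * a l + kron l l * a m - kron l m * a l)
              * (kron i m * a i + kron i m * a i - kron i i * a m)
            - (kron m l * a i + kron i l * a m - kron i m * a l)
              * (kron l m * a i + kron i m * a l - kron i l * a m)))
      = ((N : ℝ) - 1) * (-2 * ∑ i, b i i + (2 - (N : ℝ)) * ∑ i, a i * a i) := by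
  have h1 : ∀ i l m : Fin N,
      ((kron m l * a l + kron l l * a m - kron l m * a l)
              * (kron i m * a i + kron i m * a i - kron i i * a m)
            - (kron m l * a i + kron i l * a m - kron i m * a l)
              * (kron l m * a i + kron i m * a l - kron i l * a m))
      = 2 * (kron i m * (a m * a i)) - a m * a m - kron l m * (a i * a i)
        + kron i l * (a m * a m) + kron i m * (a l * a l)
        - 2 * (kron i m * (kron i l * (a m * a l))) := by
    intro i l m
    rw [kron_self, kron_self, kron_comm m l]
    linear_combination (-a i * a i) * kron_mul_self l m + (a m * a m) * kron_mul_self i l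
      + (a l * a l) * kron_mul_self i m
  simp only [h1]
  simp only [kron_self, Finset.sum_add_distrib, Finset.sum_sub_distrib, ← Finset.mul_sum,
    sum_kron, one_mul, Finset.sum_const, Finset.card_univ, Fintype.card_fin, nsmul_eq_mul]
  ring_nf
  rw [← Finset.mul_sum]
  ring

/-- The scalar curvature of `v⁻² |dx|²` in dimension `N` is
`(N - 1) (2 v Δv - N |∇v|²)`. -/
theorem scalarCurvature_conformallyFlat
    (hG : ∀ᶠ z in 𝓝 x, G z = ((v z)⁻¹ ^ 2) • (1 : Matrix (Fin N) (Fin N) ℝ))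
    (hv : v x ≠ 0) (hd : ContDiffAt ℝ 2 v x) :
    scalarCurvature G x = ((N : ℝ) - 1) * (2 * v x * lap v x - N * gdot v v x) := by
  set a : Fin N → EuclideanSpace ℝ (Fin N) → ℝ := fun i z => -(pd i v z / v z) with ha
  have hd1 := hd.differentiableAt (by simp)
  have hΓ : ∀ l i j : Fin N, christoffel G l i j =ᶠ[𝓝 x] fun z =>
      kron j l * a i z + kron i l * a j z - kron i j * a l z := by
    intro l i j
    filter_upwards [hG.eventually_nhds, hd1.continuousAt.eventually_ne hv,
      eventually_differentiableAt hd] with z h1 h2 h3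
    exact christoffel_conformallyFlat h1 h2 h3 l i j
  have hFa : ∀ i, HasFDerivAt (a i) (-(pd i v x • (-(v x ^ 2)⁻¹ • fderiv ℝ v x)
      + (v x)⁻¹ • fderiv ℝ (pd i v) x)) x := fun i => by
    have h3 := ((differentiableAt_pd hd i).hasFDerivAt.fun_mul
      ((hasDerivAt_inv hv).comp_hasFDerivAt x hd1.hasFDerivAt)).fun_neg
    simpa only [ha, div_eq_mul_inv, Function.comp] using h3
  have hda : ∀ i, DifferentiableAt ℝ (a i) x := fun i => (hFa i).differentiableAt
  have hb : ∀ i j, pd j (a i) x = -(v x * pd j (pd i v) x - pd i v x * pd j v x) / v x ^ 2 := by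
    intro i j
    rw [pd, (hFa i).fderiv]
    simp only [neg_apply, add_apply,
      smul_apply, smul_eq_mul]
    change -(pd i v x * (-(v x ^ 2)⁻¹ * pd j v x) + (v x)⁻¹ * pd j (pd i v) x) = _
    field_simp
    ring
  have hpΓ : ∀ s l i j : Fin N, pderiv s (christoffel G l i j) x =
      kron j l * pd s (a i) x + kron i l * pd s (a j) x - kron i j * pd s (a l) x := by
    intro s l i j
    change pd s (christoffel G l i j) x = _
    rw [pd_congr (hΓ l i j),
      pd_sub (((hda i).const_mul _).fun_add ((hda j).const_mul _)) ((hda l).const_mul _),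
      pd_add ((hda i).const_mul _) ((hda j).const_mul _), pd_const_mul (hda i),
      pd_const_mul (hda j), pd_const_mul (hda l)]
  unfold scalarCurvature
  rw [inv_conformallyFlat hG.self_of_nhds hv]
  simp only [Matrix.smul_apply, Matrix.one_apply, smul_eq_mul, mul_ite, mul_one, mul_zero,
    ite_mul, zero_mul, Finset.sum_ite_eq, Finset.mem_univ, if_true, ← Finset.mul_sum]
  have hr : ∑ i, ricci G i i x =
      ((N : ℝ) - 1) * (-2 * ∑ i, pd i (a i) x + (2 - (N : ℝ)) * ∑ i, a i x * a i x) := by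
    rw [← trace_ricci_algebra (fun i => a i x) (fun i j => pd j (a i) x)]
    refine Finset.sum_congr rfl fun i _ => Finset.sum_congr rfl fun l _ => ?_
    simp only [hpΓ, (hΓ _ _ _).self_of_nhds]
  rw [hr]
  have h1 : ∑ i, a i x * a i x = gdot v v x / v x ^ 2 := by
    unfold gdot
    rw [Finset.sum_div]
    refine Finset.sum_congr rfl fun i _ => ?_
    simp only [ha]; field_simp
  have h2 : ∑ i, pd i (a i) x = -(v x * lap v x - gdot v v x) / v x ^ 2 := by
    unfold gdot lap
    rw [Finset.mul_sum, ← Finset.sum_sub_distrib, ← Finset.sum_neg_distrib, Finset.sum_div]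
    refine Finset.sum_congr rfl fun i _ => ?_
    rw [hb]
  rw [h1, h2]
  field_simp
  ring

end ConformallyFlat

/-! ### Independence of the orthonormal basis -/

section Basis

set_option linter.unusedSectionVars false

variable {ι κ : Type*} [Fintype ι] [DecidableEq ι] [Fintype κ]
  {f h : EuclideanSpace ℝ ι → ℝ} {x : EuclideanSpace ℝ ι}

lemma fderiv_fderiv_apply (hf : ContDiffAt ℝ 2 f x) (v w : EuclideanSpace ℝ ι) :
    fderiv ℝ (fun z => fderiv ℝ f z v) x w = fderiv ℝ (fderiv ℝ f) x w v := by
  have h1 : ContDiffAt ℝ 1 (fderiv ℝ f) x := hf.fderiv_right (by norm_num)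
  have h2 := (h1.differentiableAt (by simp)).hasFDerivAt.clm_apply (hasFDerivAt_const v x)
  rw [h2.fderiv]
  simp

lemma lap_eq_laplacian (hf : ContDiffAt ℝ 2 f x) : lap f x = Laplacian.laplacian f x := by
  rw [InnerProductSpace.laplacian_eq_iteratedFDeriv_orthonormalBasis f
    (EuclideanSpace.basisFun ι ℝ)]
  refine Finset.sum_congr rfl fun i _ => ?_
  rw [iteratedFDeriv_two_apply]
  simp only [EuclideanSpace.basisFun_apply, Matrix.cons_val_zero, Matrix.cons_val_one]
  exact fderiv_fderiv_apply hf _ _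

lemma lap_eq_sum_orthonormalBasis (hf : ContDiffAt ℝ 2 f x)
    (b : OrthonormalBasis κ ℝ (EuclideanSpace ℝ ι)) :
    lap f x = ∑ a, fderiv ℝ (fun z => fderiv ℝ f z (b a)) x (b a) := by
  rw [lap_eq_laplacian hf, InnerProductSpace.laplacian_eq_iteratedFDeriv_orthonormalBasis f b]
  refine Finset.sum_congr rfl fun i _ => ?_
  rw [iteratedFDeriv_two_apply]
  simp only [Matrix.cons_val_zero, Matrix.cons_val_one]
  exact (fderiv_fderiv_apply hf _ _).symm

lemma sum_sq_fderiv_orthonormalBasis (b : OrthonormalBasis κ ℝ (EuclideanSpace ℝ ι)) :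
    ∑ a, fderiv ℝ f x (b a) ^ 2 =
      ‖(InnerProductSpace.toDual ℝ (EuclideanSpace ℝ ι)).symm (fderiv ℝ f x)‖ ^ 2 := by
  rw [← b.sum_sq_norm_inner_left]
  simp only [InnerProductSpace.toDual_symm_apply, Real.norm_eq_abs, sq_abs]

lemma gdot_self_eq_sum_orthonormalBasis (b : OrthonormalBasis κ ℝ (EuclideanSpace ℝ ι)) :
    gdot f f x = ∑ a, fderiv ℝ f x (b a) ^ 2 := by
  have h3 : gdot f f x = ∑ i, fderiv ℝ f x (EuclideanSpace.basisFun ι ℝ i) ^ 2 := by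
    simp [gdot, pd, sq]
  rw [h3, sum_sq_fderiv_orthonormalBasis, sum_sq_fderiv_orthonormalBasis]

/-- `⟨∇f, ∇f⟩` dominates the square of the derivative along a unit vector. -/
lemma sq_fderiv_le_gdot (v : EuclideanSpace ℝ ι) :
    fderiv ℝ f x v ^ 2 ≤ ‖v‖ ^ 2 * gdot f f x := by
  have h1 : fderiv ℝ f x v = ∑ i, v i * pd i f x := by
    conv_lhs => rw [← (EuclideanSpace.basisFun ι ℝ).sum_repr v]
    simp [map_sum, pd]
  rw [h1, EuclideanSpace.norm_sq_eq]
  refine (Finset.sum_mul_sq_le_sq_mul_sq _ _ _).trans (le_of_eq ?_)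
  simp [gdot, sq]

end Basis

/-! ### Stereographic charts and homogeneous extension -/

section Chart

variable {n k : ℕ}

/-- The linear isometry underlying the stereographic chart at `p`. -/
def chartIsometry (p : RoundSphere n k) :
    EuclideanSpace ℝ (Fin (n + k)) →ₗᵢ[ℝ] Ambient n k :=
  (Submodule.subtypeₗᵢ _).comp
    (OrthonormalBasis.fromOrthogonalSpanSingleton (n + k)
      (ne_zero_of_mem_unit_sphere (-p))).repr.symm.toLinearIsometry

lemma inner_chartIsometry (p : RoundSphere n k) (x : EuclideanSpace ℝ (Fin (n + k))) :
    inner ℝ (p : Ambient n k) (chartIsometry p x) = 0 := by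
  have h := ((OrthonormalBasis.fromOrthogonalSpanSingleton (n + k)
      (ne_zero_of_mem_unit_sphere (-p))).repr.symm x).2
  rw [Submodule.mem_orthogonal_singleton_iff_inner_right] at h
  have h3 : inner ℝ (-(p : Ambient n k)) (chartIsometry p x) = 0 := h
  rwa [inner_neg_left, neg_eq_zero] at h3

lemma chartAt_symm_apply (p : RoundSphere n k) (x : EuclideanSpace ℝ (Fin (n + k))) :
    (((chartAt (EuclideanSpace ℝ (Fin (n + k))) p).symm x : RoundSphere n k) : Ambient n k) =
      (‖x‖ ^ 2 + 4)⁻¹ • ((4 : ℝ) • chartIsometry p x + (4 - ‖x‖ ^ 2) • (p : Ambient n k)) := by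
  have h := stereographic'_symm_apply (n := n + k) (-p) x
  change (((stereographic' (n + k) (-p)).symm x : RoundSphere n k) : Ambient n k) = _
  rw [h]
  have h2 : ‖chartIsometry p x‖ = ‖x‖ := (chartIsometry p).norm_map x
  change (‖chartIsometry p x‖ ^ 2 + 4)⁻¹ • (4 : ℝ) • chartIsometry p x +
    (‖chartIsometry p x‖ ^ 2 + 4)⁻¹ • (‖chartIsometry p x‖ ^ 2 - 4) • (-p : RoundSphere n k).val = _
  rw [h2, smul_add]
  congr 1
  have : ((-p : RoundSphere n k) : Ambient n k) = -(p : Ambient n k) := rfl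
  rw [this]
  module

lemma chartAt_self (p : RoundSphere n k) :
    chartAt (EuclideanSpace ℝ (Fin (n + k))) p p = 0 := by
  have h1 : (chartAt (EuclideanSpace ℝ (Fin (n + k))) p).symm 0 = p := by
    apply Subtype.ext
    rw [chartAt_symm_apply]
    simp
  have h2 : (0 : EuclideanSpace ℝ (Fin (n + k))) ∈ (chartAt _ p).target := by
    change _ ∈ (stereographic' (n + k) (-p)).target
    simp
  conv_lhs => rw [← h1]
  rw [h1]
  conv_lhs => rw [← h1]
  rw [h1, ← (chartAt (EuclideanSpace ℝ (Fin (n + k))) p).right_inv h2, h1]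

/-- The `1`-homogeneous extension `q ↦ |q| u(q / |q|)` of a function on the sphere.
`Function.extend` supplies a value off the sphere, which matters only at `q = 0`, where the factor
`|q|` makes the extension vanish. -/
def homExt (u : RoundSphere n k → ℝ) (q : Ambient n k) : ℝ :=
  ‖q‖ * Function.extend Subtype.val u 0 (‖q‖⁻¹ • q)

lemma homExt_coe (u : RoundSphere n k → ℝ) (p : RoundSphere n k) :
    homExt u (p : Ambient n k) = u p := by
  unfold homExt
  have : ‖(p : Ambient n k)‖ = 1 := norm_eq_of_mem_sphere p
  rw [this, inv_one, one_smul, one_mul, Subtype.val_injective.extend_apply]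

lemma homExt_smul (u : RoundSphere n k → ℝ) {t : ℝ} (ht : 0 < t) (q : Ambient n k) :
    homExt u (t • q) = t * homExt u q := by
  unfold homExt
  rw [norm_smul, Real.norm_of_nonneg ht.le, smul_smul, mul_inv, mul_assoc]
  have : t⁻¹ * ‖q‖⁻¹ * t = ‖q‖⁻¹ := by field_simp
  rw [this]

/-- The radial projection of a nonzero vector to the sphere. -/
def sphereProj (q : Ambient n k) (hq : q ≠ 0) : RoundSphere n k :=
  ⟨‖q‖⁻¹ • q, by simp [norm_smul, norm_ne_zero_iff.mpr hq]⟩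

lemma homExt_eq (u : RoundSphere n k → ℝ) {q : Ambient n k} (hq : q ≠ 0) :
    homExt u q = ‖q‖ * u (sphereProj q hq) := by
  unfold homExt
  congr 1
  exact Subtype.val_injective.extend_apply u 0 (sphereProj q hq)

lemma contDiffAt_homExt {u : RoundSphere n k → ℝ} {q : Ambient n k} (hq : q ≠ 0)
    (hu : ContMDiffAt (𝓡 (n + k)) 𝓘(ℝ, ℝ) ∞ u (sphereProj q hq)) :
    ContDiffAt ℝ ∞ (homExt u) q := by
  set p := sphereProj q hq with hp
  have hg : ContDiffAt ℝ ∞ (fun x => u ((chartAt (EuclideanSpace ℝ (Fin (n + k))) p).symm x))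
      (chartAt (EuclideanSpace ℝ (Fin (n + k))) p p) := by
    have := (contMDiffAt_iff.mp hu).2
    simpa [Function.comp_def, contDiffWithinAt_univ, chartAt_self_eq] using this
  set g := fun x => u ((chartAt (EuclideanSpace ℝ (Fin (n + k))) p).symm x)
  set C : Ambient n k → EuclideanSpace ℝ (Fin (n + k)) := fun w =>
    (OrthonormalBasis.fromOrthogonalSpanSingleton (n + k)
      (ne_zero_of_mem_unit_sphere (-p))).repr (stereoToFun ((-p : RoundSphere n k) : Ambient n k) w)
  have hnorm : ‖(p : Ambient n k)‖ = 1 := norm_eq_of_mem_sphere p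
  have hCp : ∀ w : RoundSphere n k, C w = chartAt (EuclideanSpace ℝ (Fin (n + k))) p w := by
    intro w
    rfl
  have hw : ContDiffAt ℝ ∞ (fun z : Ambient n k => ‖z‖⁻¹ • z) q :=
    ((contDiffAt_norm ℝ hq).inv (norm_ne_zero_iff.mpr hq)).smul contDiffAt_id
  have hC : ContDiffAt ℝ ∞ C (p : Ambient n k) := by
    refine (LinearIsometryEquiv.contDiff _).contDiffAt.comp _ ?_
    refine contDiffOn_stereoToFun.contDiffAt (IsOpen.mem_nhds ?_ ?_)
    · exact isOpen_ne_fun (by fun_prop) (by fun_prop)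
    · change inner ℝ (-(p : Ambient n k)) (p : Ambient n k) ≠ 1
      rw [inner_neg_left, real_inner_self_eq_norm_sq, hnorm]; norm_num
  have hgC : ContDiffAt ℝ ∞ (fun z : Ambient n k => ‖z‖ * g (C (‖z‖⁻¹ • z))) q := by
    refine (contDiffAt_norm ℝ hq).mul ?_
    refine ContDiffAt.comp q (f := fun z : Ambient n k => C (‖z‖⁻¹ • z)) (g := g) ?_ ?_
    · have : C (‖q‖⁻¹ • q) = chartAt (EuclideanSpace ℝ (Fin (n + k))) p p := hCp p
      rw [this]; exact hg
    · exact ContDiffAt.comp q (f := fun z : Ambient n k => (‖z‖⁻¹ • z)) (g := C) hC hw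
  refine hgC.congr_of_eventuallyEq ?_
  have h1 : ∀ᶠ z : Ambient n k in 𝓝 q, ‖z‖⁻¹ • z ≠ -(p : Ambient n k) := by
    refine hw.continuousAt.eventually_ne ?_
    intro h
    have : (p : Ambient n k) = -(p : Ambient n k) := h
    have h0 : (p : Ambient n k) = 0 := by
      have := eq_neg_iff_add_eq_zero.mp this
      rw [← two_smul ℝ] at this
      exact (smul_eq_zero.mp this).resolve_left two_ne_zero
    rw [h0] at hnorm
    simp at hnorm
  filter_upwards [h1, isOpen_ne.mem_nhds hq] with z hz hz0
  rw [homExt_eq u hz0]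
  congr 1
  have h2 : C (‖z‖⁻¹ • z) = chartAt (EuclideanSpace ℝ (Fin (n + k))) p (sphereProj z hz0) :=
    hCp (sphereProj z hz0)
  rw [h2]
  simp only [g]
  rw [OpenPartialHomeomorph.left_inv]
  change _ ∈ (stereographic' (n + k) (-p)).source
  rw [stereographic'_source]
  intro h
  exact hz (congrArg Subtype.val h)

end Chart

/-! ### The scalar curvature of `u⁻² g` in ambient terms -/

section Scalar

variable {n k : ℕ}

lemma fderiv_chartAt_symm (p : RoundSphere n k) (x h : EuclideanSpace ℝ (Fin (n + k))) :
    fderiv ℝ (fun z => (((chartAt (EuclideanSpace ℝ (Fin (n + k))) p).symm z :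
          RoundSphere n k) : Ambient n k)) x h =
      (4 * (‖x‖ ^ 2 + 4)⁻¹) • chartIsometry p h
        - (8 * inner ℝ x h * (‖x‖ ^ 2 + 4)⁻¹ ^ 2) • chartIsometry p x
        - (16 * inner ℝ x h * (‖x‖ ^ 2 + 4)⁻¹ ^ 2) • (p : Ambient n k) := by
  have h0 : ‖x‖ ^ 2 + 4 ≠ 0 := by positivity
  have h1 : HasFDerivAt (fun z : EuclideanSpace ℝ (Fin (n + k)) => ‖z‖ ^ 2)
      (2 • innerSL ℝ x) x := (hasStrictFDerivAt_norm_sq x).hasFDerivAt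
  have h2 : HasFDerivAt (fun z : EuclideanSpace ℝ (Fin (n + k)) => (‖z‖ ^ 2 + 4)⁻¹)
      (-((‖x‖ ^ 2 + 4) ^ 2)⁻¹ • (2 • innerSL ℝ x)) x :=
    (hasDerivAt_inv h0).comp_hasFDerivAt x (h1.add_const 4)
  have h3 : HasFDerivAt (fun z => (4 : ℝ) • chartIsometry p z + (4 - ‖z‖ ^ 2) • (p : Ambient n k))
      ((4 : ℝ) • (chartIsometry p).toContinuousLinearMap
        + (-(2 • innerSL ℝ x)).smulRight (p : Ambient n k)) x :=
    ((chartIsometry p).toContinuousLinearMap.hasFDerivAt.const_smul (4 : ℝ)).add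
      ((h1.const_sub 4).smul_const _)
  have h4 := h2.fun_smul h3
  have h5 : (fun z => (((chartAt (EuclideanSpace ℝ (Fin (n + k))) p).symm z :
          RoundSphere n k) : Ambient n k)) = fun z => (‖z‖ ^ 2 + 4)⁻¹ •
            ((4 : ℝ) • chartIsometry p z + (4 - ‖z‖ ^ 2) • (p : Ambient n k)) :=
    funext fun z => chartAt_symm_apply p z
  rw [h5, h4.fderiv]
  simp only [add_apply, smul_apply, neg_apply, ContinuousLinearMap.smulRight_apply,
    innerSL_apply_apply, LinearIsometry.coe_toContinuousLinearMap, nsmul_eq_mul, smul_eq_mul,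
    Nat.cast_ofNat]
  match_scalars <;> field_simp <;> ring

/-- In the stereographic chart at `p` the metric `u⁻² g` is conformally flat, with conformal factor
the homogeneous extension of `u` evaluated on the paraboloid
`x ↦ chartIsometry p x + (1 - |x|² / 4) p`, a rescaling of the inverse chart. -/
lemma conformalCoeff_eq (u : RoundSphere n k → ℝ) (p : RoundSphere n k)
    (x : EuclideanSpace ℝ (Fin (n + k))) :
    conformalCoeff u p x =
      ((homExt u (chartIsometry p x + (1 - ‖x‖ ^ 2 / 4) • (p : Ambient n k)))⁻¹ ^ 2) •
        (1 : Matrix (Fin (n + k)) (Fin (n + k)) ℝ) := by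
  have h0 : 0 < ‖x‖ ^ 2 + 4 := by positivity
  ext i j
  have hU : homExt u (chartIsometry p x + (1 - ‖x‖ ^ 2 / 4) • (p : Ambient n k)) =
      (‖x‖ ^ 2 + 4) / 4 * u ((chartAt (EuclideanSpace ℝ (Fin (n + k))) p).symm x) := by
    rw [← homExt_coe u ((chartAt (EuclideanSpace ℝ (Fin (n + k))) p).symm x), chartAt_symm_apply,
      ← homExt_smul u (by positivity), smul_smul, smul_add, smul_smul, smul_smul]
    congr 2
    · rw [show (‖x‖ ^ 2 + 4) / 4 * (‖x‖ ^ 2 + 4)⁻¹ * 4 = 1 by field_simp, one_smul]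
    · congr 1; field_simp
  have hin : inner ℝ (chartIsometry p (EuclideanSpace.single i (1 : ℝ)))
      (chartIsometry p (EuclideanSpace.single j (1 : ℝ))) = (if i = j then (1 : ℝ) else 0) := by
    rw [LinearIsometry.inner_map_map]
    simp [EuclideanSpace.inner_single_left]
  have hp : inner ℝ (p : Ambient n k) (p : Ambient n k) = (1 : ℝ) := by
    rw [real_inner_self_eq_norm_sq, norm_eq_of_mem_sphere p]; norm_num
  have hxx : inner ℝ (chartIsometry p x) (chartIsometry p x) = ‖x‖ ^ 2 := by
    rw [LinearIsometry.inner_map_map, real_inner_self_eq_norm_sq]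
  have hpx : ∀ z, inner ℝ (chartIsometry p z) (p : Ambient n k) = 0 := fun z => by
    rw [real_inner_comm]; exact inner_chartIsometry p z
  unfold conformalCoeff
  rw [fderiv_chartAt_symm, fderiv_chartAt_symm, hU, Matrix.smul_apply, Matrix.one_apply,
    smul_eq_mul]
  simp only [inner_sub_left, inner_sub_right, real_inner_smul_left, real_inner_smul_right, hin,
    hpx, inner_chartIsometry, hp, hxx, LinearIsometry.inner_map_map,
    real_inner_comm x (EuclideanSpace.single _ _)]
  rw [mul_inv, mul_pow, inv_div]
  by_cases hij : i = j
  · simp only [hij, if_true]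
    field_simp
    ring
  · simp only [hij, if_false]
    field_simp
    ring

/-- An orthonormal basis of the ambient space consisting of `p` and a basis of its tangent space. -/
lemma exists_orthonormalBasis_chart (p : RoundSphere n k) :
    ∃ b : OrthonormalBasis (Option (Fin (n + k))) ℝ (Ambient n k),
      b none = p ∧ ∀ i, b (some i) = chartIsometry p (EuclideanSpace.single i 1) := by
  set v : Option (Fin (n + k)) → Ambient n k := fun o =>
    o.elim (p : Ambient n k) fun i => chartIsometry p (EuclideanSpace.single i 1) with hv
  have ho : Orthonormal ℝ v := by
    rw [orthonormal_iff_ite]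
    have hp : inner ℝ (p : Ambient n k) (p : Ambient n k) = (1 : ℝ) := by
      rw [real_inner_self_eq_norm_sq, norm_eq_of_mem_sphere p]; norm_num
    rintro (_ | i) (_ | j)
    · simp [hv]
    · simp [hv, inner_chartIsometry]
    · simp only [hv, Option.elim]
      rw [real_inner_comm]
      simp [inner_chartIsometry]
    · simp [hv, LinearIsometry.inner_map_map, EuclideanSpace.inner_single_left]
  have hcard : Module.finrank ℝ (Ambient n k) = Fintype.card (Option (Fin (n + k))) := by
    rw [(finrank_ambient n k).out]; simp
  obtain ⟨b, hb⟩ := Orthonormal.exists_orthonormalBasis_extension_of_card_eq hcard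
    (s := Set.univ) (v := v) (ho.comp _ Subtype.val_injective)
  exact ⟨b, hb none trivial, fun i => hb (some i) trivial⟩

/-- For a `1`-homogeneous function `U`, Euler's relation. -/
lemma fderiv_self_of_homogeneous {U : Ambient n k → ℝ} {q : Ambient n k}
    (hU : DifferentiableAt ℝ U q) (hom : ∀ t : ℝ, 0 < t → U (t • q) = t * U q) :
    fderiv ℝ U q q = U q := by
  have h1 : HasDerivAt (fun s : ℝ => U (q + s • q)) (fderiv ℝ U q q) 0 := by
    have := hasDerivAt_line (f := U) (q := q) (v := q) (t := 0) (by simpa using hU)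
    simpa using this
  have h2 : HasDerivAt (fun s : ℝ => U (q + s • q)) (U q) 0 := by
    have h3 : HasDerivAt (fun s : ℝ => (1 + s) * U q) (U q) 0 := by
      simpa using ((hasDerivAt_id (0 : ℝ)).const_add 1).mul_const (U q)
    refine h3.congr_of_eventuallyEq ?_
    filter_upwards [eventually_gt_nhds (show (-1 : ℝ) < 0 by norm_num)] with s hs
    rw [← hom _ (by linarith), add_smul, one_smul]
  exact h1.unique h2

lemma fderiv_fderiv_self_of_homogeneous {U : Ambient n k → ℝ} {q : Ambient n k}
    (hU : ContDiffAt ℝ 2 U q) (hom : ∀ t : ℝ, 0 < t → U (t • q) = t * U q) :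
    fderiv ℝ (fun z => fderiv ℝ U z q) q q = 0 := by
  have hct : Filter.Tendsto (fun t : ℝ => q + t • q) (𝓝 0) (𝓝 q) := by
    have : Continuous (fun t : ℝ => q + t • q) := by fun_prop
    simpa using this.tendsto 0
  have h1 : HasDerivAt (fun s : ℝ => fderiv ℝ U (q + s • q) q)
      (fderiv ℝ (fun z => fderiv ℝ U z q) q q) 0 := by
    have := hasDerivAt_line (f := fun z => fderiv ℝ U z q) (q := q) (v := q) (t := 0)
      (by simpa using differentiableAt_fderiv_apply hU q)
    simpa using this
  have h2 : HasDerivAt (fun s : ℝ => fderiv ℝ U (q + s • q) q) 0 0 := by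
    refine (hasDerivAt_const 0 (U q)).congr_of_eventuallyEq ?_
    filter_upwards [eventually_gt_nhds (show (-1 : ℝ) < 0 by norm_num),
      hct.eventually (eventually_differentiableAt hU)] with s hs hd
    have h3 := hasDerivAt_line (f := U) (q := q) (v := q) (t := s) hd
    have h4 : HasDerivAt (fun s : ℝ => U (q + s • q)) (U q) s := by
      have h3 : HasDerivAt (fun s : ℝ => (1 + s) * U q) (U q) s := by
        simpa using ((hasDerivAt_id s).const_add 1).mul_const (U q)
      refine h3.congr_of_eventuallyEq ?_
      filter_upwards [eventually_gt_nhds hs] with s hs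
      rw [← hom _ (by linarith), add_smul, one_smul]
    exact h3.unique h4
  exact h1.unique h2

/-- The scalar curvature of `u⁻² g` at `p` in terms of the `1`-homogeneous extension `U` of `u`:
it is `(N - 1) (2 U ΔU - N |∇U|²)` with `N = n + k`. -/
theorem conformalScalarCurvature_eq {u : RoundSphere n k → ℝ} {p : RoundSphere n k}
    (hU : ContDiffAt ℝ 2 (homExt u) (p : Ambient n k)) (hpos : 0 < u p) :
    conformalScalarCurvature u p = ((n : ℝ) + k - 1) *
      (2 * homExt u p * lap (homExt u) (p : Ambient n k)
        - ((n : ℝ) + k) * gdot (homExt u) (homExt u) (p : Ambient n k)) := by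
  set U := homExt u with hUdef
  set Q : EuclideanSpace ℝ (Fin (n + k)) → Ambient n k := fun x =>
    chartIsometry p x + (1 - ‖x‖ ^ 2 / 4) • (p : Ambient n k) with hQ
  have hQ0 : Q 0 = p := by simp [hQ]
  have hQs : ContDiff ℝ 2 Q := by
    refine (chartIsometry p).toContinuousLinearMap.contDiff.add ?_
    exact ((contDiff_const.sub ((contDiff_norm_sq ℝ).div_const 4)).smul contDiff_const)
  have hQd : ∀ x h, HasDerivAt (fun t : ℝ => Q (x + t • h))
      (chartIsometry p h - (inner ℝ x h / 2) • (p : Ambient n k)) 0 := by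
    intro x h
    have h1 : HasDerivAt (fun t : ℝ => ‖x + t • h‖ ^ 2) (2 * inner ℝ x h) 0 := by
      have h2 : HasDerivAt (fun t : ℝ => x + t • h) h 0 := by
        simpa using ((hasDerivAt_id (0 : ℝ)).smul_const h).const_add x
      simpa using h2.norm_sq
    have h3 : HasDerivAt (fun t : ℝ => chartIsometry p (x + t • h)) (chartIsometry p h) 0 := by
      have h2 : HasDerivAt (fun t : ℝ => x + t • h) h 0 := by
        simpa using ((hasDerivAt_id (0 : ℝ)).smul_const h).const_add x
      exact (chartIsometry p).toContinuousLinearMap.hasFDerivAt.comp_hasDerivAt 0 h2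
    refine (h3.add (((h1.div_const 4).const_sub 1).smul_const (p : Ambient n k))).congr_deriv ?_
    module
  have hQf : ∀ x h, fderiv ℝ Q x h = chartIsometry p h - (inner ℝ x h / 2) • (p : Ambient n k) := by
    intro x h
    have h1 := (hQs.differentiable (by simp) x).hasFDerivAt
    have h2 : HasDerivAt (fun t : ℝ => x + t • h) h 0 := by
      simpa using ((hasDerivAt_id (0 : ℝ)).smul_const h).const_add x
    have h3 : HasDerivAt (fun t : ℝ => Q (x + t • h)) (fderiv ℝ Q x h) 0 :=
      HasFDerivAt.comp_hasDerivAt (l := Q) (f := fun t : ℝ => x + t • h) 0 (by simpa using h1) h2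
    exact h3.unique (hQd x h)
  have hv : ContDiffAt ℝ 2 (fun x => U (Q x)) 0 := by
    refine ContDiffAt.comp (0 : EuclideanSpace ℝ (Fin (n + k))) (g := U) (f := Q) ?_ hQs.contDiffAt
    rw [hQ0]; exact hU
  have hv0 : U (Q 0) = u p := by rw [hQ0]; exact homExt_coe u p
  have hG : ∀ᶠ z in 𝓝 (0 : EuclideanSpace ℝ (Fin (n + k))), conformalCoeff u p z =
      ((U (Q z))⁻¹ ^ 2) • (1 : Matrix (Fin (n + k)) (Fin (n + k)) ℝ) :=
    Filter.Eventually.of_forall fun z => conformalCoeff_eq u p z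
  unfold conformalScalarCurvature
  rw [chartAt_self, scalarCurvature_conformallyFlat (v := fun x => U (Q x)) hG
    (by rw [hv0]; exact hpos.ne') hv]
  obtain ⟨b, hb0, hb⟩ := exists_orthonormalBasis_chart p
  have hom : ∀ t : ℝ, 0 < t → U (t • (p : Ambient n k)) = t * U p := fun t ht =>
    homExt_smul u ht _
  have hE1 := fderiv_self_of_homogeneous (hU.differentiableAt (by simp)) hom
  have hE2 := fderiv_fderiv_self_of_homogeneous hU hom
  -- first derivatives of `U ∘ Q` near the origin
  have hpd : ∀ i, pd i (fun x => U (Q x)) =ᶠ[𝓝 0] fun x =>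
      fderiv ℝ U (Q x) (b (some i)) - x i / 2 * fderiv ℝ U (Q x) p := by
    intro i
    have : Filter.Tendsto Q (𝓝 0) (𝓝 (p : Ambient n k)) := by
      rw [← hQ0]; exact hQs.continuous.tendsto 0
    filter_upwards [this.eventually (eventually_differentiableAt hU)] with x hx
    have h1 := hx.hasFDerivAt.comp x (hQs.differentiable (by simp) x).hasFDerivAt
    have h2 : pd i (fun x => U (Q x)) x = fderiv ℝ U (Q x) (fderiv ℝ Q x
        (EuclideanSpace.single i 1)) := by
      unfold pd
      rw [show (fun x => U (Q x)) = U ∘ Q from rfl, h1.fderiv]; rfl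
    rw [h2, hQf, map_sub, map_smul, hb]
    simp [EuclideanSpace.inner_single_right]
  have hpd0 : ∀ i, pd i (fun x => U (Q x)) 0 = fderiv ℝ U p (b (some i)) := by
    intro i
    rw [(hpd i).self_of_nhds]; simp [hQ0]
  have hpd2 : ∀ i, pd i (pd i (fun x => U (Q x))) 0 =
      fderiv ℝ (fun z => fderiv ℝ U z (b (some i))) p (b (some i)) - U p / 2 := by
    intro i
    have hQ0' := (hQs.differentiable (by simp) 0).hasFDerivAt
    have hdU : ∀ w, HasFDerivAt (fun x => fderiv ℝ U (Q x) w)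
        ((fderiv ℝ (fun z => fderiv ℝ U z w) p).comp (fderiv ℝ Q 0)) 0 := by
      intro w
      refine HasFDerivAt.comp (g := fun z => fderiv ℝ U z w) (0 : EuclideanSpace ℝ (Fin (n + k)))
        ?_ hQ0'
      rw [hQ0]; exact (differentiableAt_fderiv_apply hU w).hasFDerivAt
    have hx : HasFDerivAt (fun x : EuclideanSpace ℝ (Fin (n + k)) => x i / 2)
        ((1 / 2 : ℝ) • (EuclideanSpace.proj i : EuclideanSpace ℝ (Fin (n + k)) →L[ℝ] ℝ)) 0 := by
      have := (EuclideanSpace.proj i : EuclideanSpace ℝ (Fin (n + k)) →L[ℝ] ℝ).hasFDerivAt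
        (x := 0)
      refine (this.const_mul (1 / 2 : ℝ)).congr_of_eventuallyEq ?_
      filter_upwards with x
      simp; ring
    rw [pd_congr (hpd i), pd, ((hdU (b (some i))).fun_sub (hx.fun_mul (hdU p))).fderiv]
    simp [hQf, hQ0, hE1, ← hb]
    ring
  have hlap : lap (fun x => U (Q x)) 0 = lap U p - ((n : ℝ) + k) * U p / 2 := by
    rw [lap_eq_sum_orthonormalBasis hU b, Fintype.sum_option, hb0, hE2, zero_add]
    unfold lap
    simp only [hpd2, Finset.sum_sub_distrib, Finset.sum_const, Finset.card_univ, Fintype.card_fin,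
      nsmul_eq_mul, Nat.cast_add]
    ring
  have hgd : gdot (fun x => U (Q x)) (fun x => U (Q x)) 0 = gdot U U p - U p ^ 2 := by
    rw [gdot_self_eq_sum_orthonormalBasis b, Fintype.sum_option, hb0, hE1, add_sub_cancel_left]
    unfold gdot
    simp only [hpd0, sq]
  rw [hlap, hgd, hQ0]
  push_cast
  ring

end Scalar

/-! ### The two radial functions `|y|` and `|(x, y)|` -/

section Radial

variable {n k : ℕ}

/-- `xPart` as a continuous linear map. -/
def xPartL (n k : ℕ) : Ambient n k →L[ℝ] EuclideanSpace ℝ (Fin (n + 1)) :=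
  LinearMap.toContinuousLinearMap
    { toFun := xPart
      map_add' := fun _ _ => rfl
      map_smul' := fun _ _ => rfl }

/-- `yPart` as a continuous linear map. -/
def yPartL (n k : ℕ) : Ambient n k →L[ℝ] EuclideanSpace ℝ (Fin k) :=
  LinearMap.toContinuousLinearMap
    { toFun := yPart
      map_add' := fun _ _ => rfl
      map_smul' := fun _ _ => rfl }

lemma xPartL_apply (q : Ambient n k) : xPartL n k q = xPart q := rfl

lemma yPartL_apply (q : Ambient n k) : yPartL n k q = yPart q := rfl

lemma xPart_smul (t : ℝ) (q : Ambient n k) : xPart (t • q) = t • xPart q := rfl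

lemma yPart_smul (t : ℝ) (q : Ambient n k) : yPart (t • q) = t • yPart q := rfl

lemma xPart_add (q q' : Ambient n k) : xPart (q + q') = xPart q + xPart q' := rfl

lemma yPart_add (q q' : Ambient n k) : yPart (q + q') = yPart q + yPart q' := rfl

@[simp] lemma yPart_zero : yPart (0 : Ambient n k) = 0 := rfl

lemma continuous_xPart : Continuous (xPart : Ambient n k → _) := (xPartL n k).continuous

lemma continuous_yPart : Continuous (yPart : Ambient n k → _) := (yPartL n k).continuous

lemma norm_sq_eq_add (q : Ambient n k) : ‖q‖ ^ 2 = ‖xPart q‖ ^ 2 + ‖yPart q‖ ^ 2 := by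
  simp [EuclideanSpace.norm_sq_eq, Fintype.sum_sum_type, xPart, yPart]

lemma inner_eq_add (q q' : Ambient n k) :
    inner ℝ q q' = inner ℝ (xPart q) (xPart q') + inner ℝ (yPart q) (yPart q') := by
  simp [PiLp.inner_apply, Fintype.sum_sum_type, xPart, yPart]

lemma norm_yPart_le (q : Ambient n k) : ‖yPart q‖ ≤ ‖q‖ := by
  refine abs_le_of_sq_le_sq' ?_ (norm_nonneg _) |>.2
  rw [norm_sq_eq_add]; nlinarith [sq_nonneg ‖xPart q‖]

lemma ne_zero_of_yPart {q : Ambient n k} (hq : yPart q ≠ 0) : q ≠ 0 := by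
  rintro rfl; exact hq rfl

/-- The function `(x, y) ↦ |y|`. -/
def rho (q : Ambient n k) : ℝ := ‖yPart q‖

lemma rho_pos {q : Ambient n k} (hq : yPart q ≠ 0) : 0 < rho q := norm_pos_iff.mpr hq

lemma isOpen_yPart_ne : IsOpen {q : Ambient n k | yPart q ≠ 0} :=
  isOpen_ne_fun continuous_yPart continuous_const

lemma contDiffAt_rho {q : Ambient n k} (hq : yPart q ≠ 0) {m : ℕ∞ω} :
    ContDiffAt ℝ m (rho : Ambient n k → ℝ) q :=
  (contDiffAt_norm ℝ hq).comp q (yPartL n k).contDiff.contDiffAt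

lemma hasFDerivAt_coord (i : Fin (n + 1) ⊕ Fin k) (q : Ambient n k) :
    HasFDerivAt (fun z : Ambient n k => z i)
      (EuclideanSpace.proj i : Ambient n k →L[ℝ] ℝ) q :=
  (EuclideanSpace.proj i : Ambient n k →L[ℝ] ℝ).hasFDerivAt

lemma pd_coord (i j : Fin (n + 1) ⊕ Fin k) (q : Ambient n k) :
    pd i (fun z : Ambient n k => z j) q = if j = i then 1 else 0 := by
  rw [pd, (hasFDerivAt_coord j q).fderiv]
  simp

lemma pd_norm_sq (i : Fin (n + 1) ⊕ Fin k) (q : Ambient n k) :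
    pd i (fun z : Ambient n k => ‖z‖ * ‖z‖) q = 2 * q i := by
  have h1 : (fun z : Ambient n k => ‖z‖ * ‖z‖) = fun z => ‖z‖ ^ 2 := by
    funext z; ring
  have h2 := (hasStrictFDerivAt_norm_sq q).hasFDerivAt
  rw [h1, pd, h2.fderiv]
  simp [EuclideanSpace.inner_single_right]

lemma pd_inl_rho_sq (i : Fin (n + 1)) (q : Ambient n k) :
    pd (Sum.inl i) (fun z : Ambient n k => rho z * rho z) q = 0 := by
  have h1 : (fun z : Ambient n k => rho z * rho z) = fun z => ‖yPartL n k z‖ ^ 2 := by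
    funext z; simp only [rho, yPartL_apply]; ring
  have h2 : HasFDerivAt (fun z => ‖yPartL n k z‖ ^ 2) _ q :=
    (hasStrictFDerivAt_norm_sq (yPartL n k q)).hasFDerivAt.comp q (yPartL n k).hasFDerivAt
  rw [h1, pd, h2.fderiv]
  have : yPartL n k (EuclideanSpace.single (Sum.inl i) 1) = 0 := by
    ext j; simp [yPartL_apply, yPart]
  simp [this]

lemma pd_inr_rho_sq (j : Fin k) (q : Ambient n k) :
    pd (Sum.inr j) (fun z : Ambient n k => rho z * rho z) q = 2 * q (Sum.inr j) := by
  have h1 : (fun z : Ambient n k => rho z * rho z) = fun z => ‖yPartL n k z‖ ^ 2 := by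
    funext z; simp only [rho, yPartL_apply]; ring
  have h2 : HasFDerivAt (fun z => ‖yPartL n k z‖ ^ 2) _ q :=
    (hasStrictFDerivAt_norm_sq (yPartL n k q)).hasFDerivAt.comp q (yPartL n k).hasFDerivAt
  rw [h1, pd, h2.fderiv]
  have : yPartL n k (EuclideanSpace.single (Sum.inr j) 1) = EuclideanSpace.single j 1 := by
    ext l; simp [yPartL_apply, yPart]
  simp [this, EuclideanSpace.inner_single_right]
  simp [yPartL_apply, yPart]

lemma sum_sq_yPart (q : Ambient n k) : ∑ j, q (Sum.inr j) * q (Sum.inr j) = rho q ^ 2 := by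
  rw [rho, EuclideanSpace.norm_sq_eq]
  exact Finset.sum_congr rfl fun _ _ => by rw [Real.norm_eq_abs, sq_abs]; simp [yPart, sq]

lemma gdot_rho_rho {q : Ambient n k} (hq : yPart q ≠ 0) : gdot rho rho q = 1 := by
  have hd := (contDiffAt_rho (m := 1) hq).differentiableAt (by simp)
  have h1 : gdot (fun z : Ambient n k => rho z * rho z) (fun z => rho z * rho z) q
      = 4 * rho q ^ 2 * gdot rho rho q := by
    rw [gdot_mul_left hd hd, gdot_comm, gdot_mul_left hd hd]; ring
  have h2 : gdot (fun z : Ambient n k => rho z * rho z) (fun z => rho z * rho z) q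
      = 4 * rho q ^ 2 := by
    unfold gdot
    rw [Fintype.sum_sum_type]
    simp only [pd_inl_rho_sq, pd_inr_rho_sq, mul_zero, Finset.sum_const_zero, zero_add]
    rw [← sum_sq_yPart, Finset.mul_sum]
    exact Finset.sum_congr rfl fun _ _ => by ring
  have := rho_pos hq
  rw [h1] at h2
  exact mul_left_cancel₀ (by positivity : 4 * rho q ^ 2 ≠ 0) (by linarith)

lemma gdot_norm_norm {q : Ambient n k} (hq : q ≠ 0) :
    gdot (fun z : Ambient n k => ‖z‖) (fun z => ‖z‖) q = 1 := by
  have hd : DifferentiableAt ℝ (fun z : Ambient n k => ‖z‖) q :=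
    (contDiffAt_norm (n := 1) ℝ hq).differentiableAt (by simp)
  have h1 : gdot (fun z : Ambient n k => ‖z‖ * ‖z‖) (fun z => ‖z‖ * ‖z‖) q
      = 4 * ‖q‖ ^ 2 * gdot (fun z : Ambient n k => ‖z‖) (fun z => ‖z‖) q := by
    rw [gdot_mul_left hd hd, gdot_comm, gdot_mul_left hd hd]; ring
  have h2 : gdot (fun z : Ambient n k => ‖z‖ * ‖z‖) (fun z => ‖z‖ * ‖z‖) q
      = 4 * ‖q‖ ^ 2 := by
    unfold gdot
    simp only [pd_norm_sq]
    rw [EuclideanSpace.norm_sq_eq, Finset.mul_sum]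
    exact Finset.sum_congr rfl fun _ _ => by rw [Real.norm_eq_abs, sq_abs]; ring
  have := norm_pos_iff.mpr hq
  rw [h1] at h2
  exact mul_left_cancel₀ (by positivity : 4 * ‖q‖ ^ 2 ≠ 0) (by linarith)

lemma gdot_rho_norm {q : Ambient n k} (hq : yPart q ≠ 0) :
    gdot rho (fun z : Ambient n k => ‖z‖) q = rho q / ‖q‖ := by
  have hd := (contDiffAt_rho (m := 1) hq).differentiableAt (by simp)
  have hq0 := ne_zero_of_yPart hq
  have hd' : DifferentiableAt ℝ (fun z : Ambient n k => ‖z‖) q :=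
    (contDiffAt_norm (n := 1) ℝ hq0).differentiableAt (by simp)
  have h1 : gdot (fun z : Ambient n k => rho z * rho z) (fun z => ‖z‖ * ‖z‖) q
      = 4 * rho q * ‖q‖ * gdot rho (fun z : Ambient n k => ‖z‖) q := by
    rw [gdot_mul_left hd hd, gdot_comm, gdot_mul_left hd' hd', gdot_comm]; ring
  have h2 : gdot (fun z : Ambient n k => rho z * rho z) (fun z => ‖z‖ * ‖z‖) q
      = 4 * rho q ^ 2 := by
    unfold gdot
    rw [Fintype.sum_sum_type]
    simp only [pd_inl_rho_sq, pd_inr_rho_sq, pd_norm_sq, zero_mul, Finset.sum_const_zero, zero_add]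
    rw [← sum_sq_yPart, Finset.mul_sum]
    exact Finset.sum_congr rfl fun _ _ => by ring
  have := rho_pos hq
  have := norm_pos_iff.mpr hq0
  rw [h1] at h2
  field_simp
  exact mul_left_cancel₀ (by positivity : 4 * rho q ≠ 0) (by linarith)

lemma lap_rho {q : Ambient n k} (hq : yPart q ≠ 0) : lap rho q = ((k : ℝ) - 1) / rho q := by
  have hc := contDiffAt_rho (m := 2) hq
  have h1 := lap_mul hc hc
  have h2 : lap (fun z : Ambient n k => rho z * rho z) q = 2 * k := by
    unfold lap
    rw [Fintype.sum_sum_type]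
    have e1 : ∀ i, pd (Sum.inl i) (fun z : Ambient n k => rho z * rho z) = fun _ => 0 :=
      fun i => funext fun z => pd_inl_rho_sq i z
    have e2 : ∀ j, pd (Sum.inr j) (fun z : Ambient n k => rho z * rho z)
        = fun z => 2 * z (Sum.inr j) := fun i => funext fun z => pd_inr_rho_sq i z
    simp only [e1, e2, pd_const]
    have e3 : ∀ j : Fin k, pd (Sum.inr j) (fun z : Ambient n k => 2 * z (Sum.inr j)) q = 2 := by
      intro j
      rw [pd_const_mul (hasFDerivAt_coord _ q).differentiableAt, pd_coord]; simp
    simp only [e3]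
    simp [mul_comm]
  rw [h2, gdot_rho_rho hq] at h1
  have := rho_pos hq
  field_simp
  linarith

lemma lap_norm {q : Ambient n k} (hq : q ≠ 0) :
    lap (fun z : Ambient n k => ‖z‖) q = ((n : ℝ) + k) / ‖q‖ := by
  have hc : ContDiffAt ℝ 2 (fun z : Ambient n k => ‖z‖) q := contDiffAt_norm ℝ hq
  have h1 := lap_mul hc hc
  have h2 : lap (fun z : Ambient n k => ‖z‖ * ‖z‖) q = 2 * (n + 1 + k) := by
    unfold lap
    have e2 : ∀ j, pd j (fun z : Ambient n k => ‖z‖ * ‖z‖)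
        = fun z => 2 * z j := fun i => funext fun z => pd_norm_sq i z
    simp only [e2]
    have e3 : ∀ j, pd j (fun z : Ambient n k => 2 * z j) q = 2 := by
      intro j
      rw [pd_const_mul (hasFDerivAt_coord _ q).differentiableAt, pd_coord]; simp
    simp only [e3]
    simp [mul_comm]
  rw [h2, gdot_norm_norm hq] at h1
  have := norm_pos_iff.mpr hq
  field_simp
  linarith

lemma homExt_equatorialFactor : homExt (equatorialFactor n k) = rho := by
  funext q
  by_cases hq : q = 0
  · subst hq; simp [homExt, rho]
  · rw [homExt_eq _ hq]
    have := norm_pos_iff.mpr hq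
    simp only [equatorialFactor, sphereProj, yPart_smul, norm_smul, rho]
    rw [norm_inv, norm_norm]
    field_simp

/-- The scalar curvature of `|y|⁻² g`. -/
lemma conformalScalarCurvature_equatorialFactor {p : RoundSphere n k} (hp : p ∉ equator n k) :
    conformalScalarCurvature (equatorialFactor n k) p =
      ((k : ℝ) - n - 2) * ((n : ℝ) + k - 1) := by
  have hp' : yPart (p : Ambient n k) ≠ 0 := hp
  rw [conformalScalarCurvature_eq (by rw [homExt_equatorialFactor]; exact contDiffAt_rho hp')
    (show 0 < equatorialFactor n k p from norm_pos_iff.mpr hp'), homExt_equatorialFactor,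
      lap_rho hp', gdot_rho_rho hp']
  have := rho_pos hp'
  field_simp
  ring

/-! ### Homogeneity of derivatives -/

lemma pd_smul_of_homogeneous {U : Ambient n k → ℝ}
    (hom : ∀ t : ℝ, 0 < t → ∀ q, U (t • q) = t * U q) {t : ℝ} (ht : 0 < t)
    (i : Fin (n + 1) ⊕ Fin k) (q : Ambient n k) : pd i U (t • q) = pd i U q := by
  have h1 : (fun z => U (t • z)) = fun z => t • U z := funext fun z => hom t ht z
  have h2 := congrArg (fun f => fderiv ℝ f q (EuclideanSpace.single i 1)) h1
  have h3 : fderiv ℝ (fun z => t • U z) q = t • fderiv ℝ U q :=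
    congrFun (fderiv_const_smul_field (f := U) t) q
  simp only [fderiv_comp_smul, h3] at h2
  exact mul_left_cancel₀ ht.ne' h2

lemma lap_smul_of_homogeneous {U : Ambient n k → ℝ}
    (hom : ∀ t : ℝ, 0 < t → ∀ q, U (t • q) = t * U q) {t : ℝ} (ht : 0 < t)
    (q : Ambient n k) : t * lap U (t • q) = lap U q := by
  unfold lap
  rw [Finset.mul_sum]
  refine Finset.sum_congr rfl fun i _ => ?_
  have h1 : (fun z => pd i U (t • z)) = pd i U := funext fun z => pd_smul_of_homogeneous hom ht i z
  have h2 := congrArg (fun f => fderiv ℝ f q (EuclideanSpace.single i 1)) h1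
  simp only [fderiv_comp_smul] at h2
  exact h2

lemma gdot_smul_of_homogeneous {U : Ambient n k → ℝ}
    (hom : ∀ t : ℝ, 0 < t → ∀ q, U (t • q) = t * U q) {t : ℝ} (ht : 0 < t)
    (q : Ambient n k) : gdot U U (t • q) = gdot U U q :=
  Finset.sum_congr rfl fun i _ => by rw [pd_smul_of_homogeneous hom ht]

/-! ### The equation satisfied by a singular Yamabe function -/

lemma IsSingularYamabe.contDiffAt {u : RoundSphere n k → ℝ} (hu : IsSingularYamabe u)
    {q : Ambient n k} (hq : yPart q ≠ 0) : ContDiffAt ℝ ∞ (homExt u) q := by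
  have hq0 := ne_zero_of_yPart hq
  refine contDiffAt_homExt hq0 ?_
  refine hu.smooth.contMDiffAt (IsOpen.mem_nhds ?_ ?_)
  · exact isOpen_yPart_ne.preimage continuous_subtype_val
  · change yPart (‖q‖⁻¹ • q) ≠ 0
    rw [yPart_smul]
    exact smul_ne_zero (inv_ne_zero (norm_ne_zero_iff.mpr hq0)) hq

lemma IsSingularYamabe.homExt_pos {u : RoundSphere n k → ℝ} (hu : IsSingularYamabe u)
    {q : Ambient n k} (hq : yPart q ≠ 0) : 0 < homExt u q := by
  have hq0 := ne_zero_of_yPart hq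
  rw [homExt_eq u hq0]
  refine mul_pos (norm_pos_iff.mpr hq0) (hu.pos _ ?_)
  change yPart (‖q‖⁻¹ • q) ≠ 0
  rw [yPart_smul]
  exact smul_ne_zero (inv_ne_zero (norm_ne_zero_iff.mpr hq0)) hq

/-- The singular Yamabe equation for the homogeneous extension. -/
lemma IsSingularYamabe.equation (hn : 1 ≤ n) (hk : 1 ≤ k) {u : RoundSphere n k → ℝ}
    (hu : IsSingularYamabe u) {q : Ambient n k} (hq : yPart q ≠ 0) :
    2 * homExt u q * lap (homExt u) q - ((n : ℝ) + k) * gdot (homExt u) (homExt u) q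
      = (k : ℝ) - n - 2 := by
  have hq0 := ne_zero_of_yPart hq
  have ht : 0 < ‖q‖⁻¹ := inv_pos.mpr (norm_pos_iff.mpr hq0)
  have hp : sphereProj q hq0 ∉ equator n k := by
    change yPart (‖q‖⁻¹ • q) ≠ 0
    rw [yPart_smul]; exact smul_ne_zero ht.ne' hq
  have hom : ∀ t : ℝ, 0 < t → ∀ q, homExt u (t • q) = t * homExt u q :=
    fun t ht q => homExt_smul u ht q
  have h1 := hu.scalar _ hp
  rw [conformalScalarCurvature_eq ((hu.contDiffAt hp).of_le (by norm_cast))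
    (hu.pos _ hp)] at h1
  have hN : (n : ℝ) + k - 1 ≠ 0 := by
    have h2 : (1 : ℝ) ≤ n := by exact_mod_cast hn
    have h3 : (1 : ℝ) ≤ k := by exact_mod_cast hk
    linarith
  have h2 : ((sphereProj q hq0 : RoundSphere n k) : Ambient n k) = ‖q‖⁻¹ • q := rfl
  rw [h2, homExt_smul u ht, gdot_smul_of_homogeneous hom ht] at h1
  have h3 := lap_smul_of_homogeneous hom ht q
  have h4 := mul_left_cancel₀ hN (h1.trans (mul_comm _ _))
  rw [← h3]
  linarith

end Radial

/-! ### Comparison by the maximum principle -/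

section Comparison

variable {n k : ℕ}

lemma gdot_mul_self {f h : Ambient n k → ℝ} {x : Ambient n k} (hf : DifferentiableAt ℝ f x)
    (hh : DifferentiableAt ℝ h x) :
    gdot (fun z => f z * h z) (fun z => f z * h z) x =
      f x ^ 2 * gdot h h x + 2 * (f x * h x * gdot f h x) + h x ^ 2 * gdot f f x := by
  rw [gdot_mul_left hf hh, gdot_comm (f := h), gdot_mul_left hf hh, gdot_comm (f := f)
    (h := fun z => f z * h z), gdot_mul_left hf hh, gdot_comm (f := h) (h := f)]
  ring

/-- The maximum principle for the operator `U ↦ 2 U ΔU - N |∇U|²`, which is homogeneous of degree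
two: it is monotone under touching from below. -/
lemma touching_operator {U V : Ambient n k → ℝ} {q : Ambient n k} {M N : ℝ}
    (hU : ContDiffAt ℝ 2 U q) (hV : ContDiffAt ℝ 2 V q) (hpos : 0 ≤ V q)
    (hle : ∀ᶠ z in 𝓝 q, V z ≤ M * U z) (heq : V q = M * U q) :
    2 * V q * lap V q - N * gdot V V q ≤ M ^ 2 * (2 * U q * lap U q - N * gdot U U q) := by
  obtain ⟨h1, h2⟩ := touching hV (contDiffAt_const.mul hU) hle heq
  rw [lap_const_mul hU] at h2
  have h3 : gdot V V q = M ^ 2 * gdot U U q := by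
    unfold gdot
    rw [Finset.mul_sum]
    refine Finset.sum_congr rfl fun i _ => ?_
    rw [h1 i, pd_const_mul (hU.differentiableAt (by simp))]; ring
  rw [h3]
  have h4 : 2 * V q * lap V q ≤ 2 * V q * (M * lap U q) :=
    mul_le_mul_of_nonneg_left h2 (by linarith)
  rw [heq] at h4 ⊢
  nlinarith

/-- An inequality between `1`-homogeneous functions that holds near `p` on the sphere holds near `p`
in the ambient space. -/
lemma eventually_le_of_homogeneous {U V : Ambient n k → ℝ} {M : ℝ} {p : RoundSphere n k}
    (hU : ∀ t : ℝ, 0 < t → ∀ q, U (t • q) = t * U q)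
    (hV : ∀ t : ℝ, 0 < t → ∀ q, V (t • q) = t * V q)
    (hle : ∀ᶠ p' : RoundSphere n k in 𝓝 p, V p' ≤ M * U p') :
    ∀ᶠ z : Ambient n k in 𝓝 (p : Ambient n k), V z ≤ M * U z := by
  have hp0 : (p : Ambient n k) ≠ 0 := ne_zero_of_mem_unit_sphere p
  rw [nhds_subtype_eq_comap, Filter.eventually_comap] at hle
  have h1 : Filter.Tendsto (fun z : Ambient n k => ‖z‖⁻¹ • z) (𝓝 (p : Ambient n k))
      (𝓝 (p : Ambient n k)) := by
    have h2 : ContinuousAt (fun z : Ambient n k => ‖z‖⁻¹ • z) (p : Ambient n k) :=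
      (continuousAt_id.norm.inv₀ (norm_ne_zero_iff.mpr hp0)).smul continuousAt_id
    have h3 : ‖(p : Ambient n k)‖⁻¹ • (p : Ambient n k) = p := by
      rw [norm_eq_of_mem_sphere p]; simp
    have h4 := h2.tendsto
    rwa [h3] at h4
  filter_upwards [h1.eventually hle, isOpen_ne.mem_nhds hp0] with z hz hz0
  have h2 := hz (sphereProj z hz0) rfl
  have h3 : ((sphereProj z hz0 : RoundSphere n k) : Ambient n k) = ‖z‖⁻¹ • z := rfl
  have h4 : 0 < ‖z‖⁻¹ := inv_pos.mpr (norm_pos_iff.mpr hz0)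
  rw [h3, hU _ h4, hV _ h4] at h2
  refine le_of_mul_le_mul_left (h2.trans (le_of_eq ?_)) h4
  ring

lemma rho_smul {t : ℝ} (ht : 0 < t) (q : Ambient n k) : rho (t • q) = t * rho q := by
  rw [rho, yPart_smul, norm_smul, Real.norm_of_nonneg ht.le, rho]

lemma norm_smul_of_pos {t : ℝ} (ht : 0 < t) (q : Ambient n k) : ‖t • q‖ = t * ‖q‖ := by
  rw [norm_smul, Real.norm_of_nonneg ht.le]

/-- The logarithmic barrier `|y| (1 - ε log (|(x, y)| / |y|))`. On the sphere it lies below `|y|`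
and is positive only where `|y| > exp (-1/ε)`, away from the equator. -/
def logBarrier (ε : ℝ) (q : Ambient n k) : ℝ :=
  rho q * (1 - ε * (Real.log ‖q‖ - Real.log (rho q)))

lemma logBarrier_smul (ε : ℝ) {t : ℝ} (ht : 0 < t) (q : Ambient n k) :
    logBarrier ε (t • q) = t * logBarrier ε q := by
  unfold logBarrier
  rw [rho_smul ht, norm_smul_of_pos ht]
  by_cases h : rho q = 0
  · simp [h]
  · have h0 : ‖q‖ ≠ 0 := by
      intro h0
      exact h (le_antisymm ((norm_yPart_le q).trans h0.le) (norm_nonneg _))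
    rw [Real.log_mul ht.ne' h, Real.log_mul ht.ne' h0]
    ring

lemma contDiffAt_log_norm {q : Ambient n k} (hq : q ≠ 0) {m : ℕ∞ω} :
    ContDiffAt ℝ m (fun z : Ambient n k => Real.log ‖z‖) q :=
  (contDiffAt_norm ℝ hq).log (norm_ne_zero_iff.mpr hq)

lemma contDiffAt_log_rho {q : Ambient n k} (hq : yPart q ≠ 0) {m : ℕ∞ω} :
    ContDiffAt ℝ m (fun z : Ambient n k => Real.log (rho z)) q :=
  (contDiffAt_rho hq).log (rho_pos hq).ne'

lemma lap_log_norm {q : Ambient n k} (hq : q ≠ 0) :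
    lap (fun z : Ambient n k => Real.log ‖z‖) q = ((n : ℝ) + k - 1) / ‖q‖ ^ 2 := by
  have h0 := norm_pos_iff.mpr hq
  rw [lap_comp (φ := Real.log) (φ' := fun s => s⁻¹) (φ'' := -(‖q‖ ^ 2)⁻¹) (f := fun z => ‖z‖) ?_
    (hasDerivAt_inv h0.ne') (contDiffAt_norm ℝ hq), lap_norm hq, gdot_norm_norm hq]
  · field_simp
    ring
  · filter_upwards [eventually_ne_nhds h0.ne'] with s hs using Real.hasDerivAt_log hs

lemma lap_log_rho {q : Ambient n k} (hq : yPart q ≠ 0) :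
    lap (fun z : Ambient n k => Real.log (rho z)) q = ((k : ℝ) - 2) / rho q ^ 2 := by
  have h0 := rho_pos hq
  rw [lap_comp (φ := Real.log) (φ' := fun s => s⁻¹) (φ'' := -(rho q ^ 2)⁻¹) (f := rho) ?_
    (hasDerivAt_inv h0.ne') (contDiffAt_rho hq), lap_rho hq, gdot_rho_rho hq]
  · field_simp
    ring
  · filter_upwards [eventually_ne_nhds h0.ne'] with s hs using Real.hasDerivAt_log hs

lemma gdot_log_norm_left {e : Ambient n k → ℝ} {q : Ambient n k} (hq : q ≠ 0) :
    gdot (fun z : Ambient n k => Real.log ‖z‖) e q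
      = ‖q‖⁻¹ * gdot (fun z : Ambient n k => ‖z‖) e q :=
  gdot_comp_left (φ := Real.log) (f := fun z => ‖z‖)
    (Real.hasDerivAt_log (norm_ne_zero_iff.mpr hq))
    ((contDiffAt_norm (n := 1) ℝ hq).differentiableAt (by simp))

lemma gdot_log_rho_left {e : Ambient n k → ℝ} {q : Ambient n k} (hq : yPart q ≠ 0) :
    gdot (fun z : Ambient n k => Real.log (rho z)) e q = (rho q)⁻¹ * gdot rho e q :=
  gdot_comp_left (φ := Real.log) (f := rho)
    (Real.hasDerivAt_log (rho_pos hq).ne')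
    ((contDiffAt_rho (m := 1) hq).differentiableAt (by simp))

lemma contDiffAt_logBarrier (ε : ℝ) {q : Ambient n k} (hq : yPart q ≠ 0) :
    ContDiffAt ℝ 2 (logBarrier ε : Ambient n k → ℝ) q :=
  (contDiffAt_rho hq).mul (contDiffAt_const.sub (contDiffAt_const.mul
    ((contDiffAt_log_norm (ne_zero_of_yPart hq)).sub (contDiffAt_log_rho hq))))

/-- The operator of the singular Yamabe equation applied to the barrier. At `ε = 0` it is the constant
`-(n + 2 - k)` of that equation; on the part of the sphere where the barrier is nonnegative it is
lower than this constant by `O(ε)` at most. -/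
lemma logBarrier_operator (ε : ℝ) {q : Ambient n k} (hq : yPart q ≠ 0) :
    2 * logBarrier ε q * lap (logBarrier ε) q
        - ((n : ℝ) + k) * gdot (logBarrier ε) (logBarrier ε) q =
      -((n : ℝ) + 2 - k) * (1 - ε * (Real.log ‖q‖ - Real.log (rho q))) ^ 2
        - 2 * (1 - ε * (Real.log ‖q‖ - Real.log (rho q))) * ε * (rho q ^ 2 / ‖q‖ ^ 2 + n)
        - ((n : ℝ) + k) * ε ^ 2 * (1 - rho q ^ 2 / ‖q‖ ^ 2) := by
  have hq0 := ne_zero_of_yPart hq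
  have hr := norm_pos_iff.mpr hq0
  have hρ := rho_pos hq
  have c1 : ContDiffAt ℝ 2 (rho : Ambient n k → ℝ) q := contDiffAt_rho hq
  have c2 : ContDiffAt ℝ 2 (fun z : Ambient n k => Real.log ‖z‖) q := contDiffAt_log_norm hq0
  have c3 : ContDiffAt ℝ 2 (fun z : Ambient n k => Real.log (rho z)) q := contDiffAt_log_rho hq
  have c4 : ContDiffAt ℝ 2 (fun z : Ambient n k => Real.log ‖z‖ - Real.log (rho z)) q := c2.sub c3
  have c5 : ContDiffAt ℝ 2 (fun z : Ambient n k => ε * (Real.log ‖z‖ - Real.log (rho z))) q :=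
    contDiffAt_const.mul c4
  have c6 : ContDiffAt ℝ 2 (fun z : Ambient n k => 1 - ε * (Real.log ‖z‖ - Real.log (rho z))) q :=
    contDiffAt_const.sub c5
  have d {f : Ambient n k → ℝ} (h : ContDiffAt ℝ 2 f q) : DifferentiableAt ℝ f q :=
    h.differentiableAt (by simp)
  have l1 : lap (fun z : Ambient n k => 1 - ε * (Real.log ‖z‖ - Real.log (rho z))) q =
      -(ε * (((n : ℝ) + k - 1) / ‖q‖ ^ 2 - ((k : ℝ) - 2) / rho q ^ 2)) := by
    rw [lap_sub contDiffAt_const c5, lap_const, lap_const_mul c4, lap_sub c2 c3, lap_log_norm hq0,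
      lap_log_rho hq]
    ring
  have g0 : ∀ e : Ambient n k → ℝ,
      gdot (fun z : Ambient n k => 1 - ε * (Real.log ‖z‖ - Real.log (rho z))) e q =
        -(ε * (‖q‖⁻¹ * gdot (fun z : Ambient n k => ‖z‖) e q - (rho q)⁻¹ * gdot rho e q)) := by
    intro e
    rw [gdot_sub_left (d contDiffAt_const) (d c5), gdot_const_left, gdot_const_mul_left (d c4),
      gdot_sub_left (d c2) (d c3), gdot_log_norm_left hq0, gdot_log_rho_left hq]
    ring
  have g1 : gdot (fun z : Ambient n k => 1 - ε * (Real.log ‖z‖ - Real.log (rho z))) rho q =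
      -(ε * (‖q‖⁻¹ * (rho q / ‖q‖) - (rho q)⁻¹)) := by
    rw [g0, gdot_comm, gdot_rho_norm hq, gdot_rho_rho hq, mul_one]
  have g2 : gdot (fun z : Ambient n k => 1 - ε * (Real.log ‖z‖ - Real.log (rho z)))
      (fun z => ‖z‖) q = -(ε * (‖q‖⁻¹ - (rho q)⁻¹ * (rho q / ‖q‖))) := by
    rw [g0, gdot_norm_norm hq0, gdot_rho_norm hq, mul_one]
  have g3 : gdot (fun z : Ambient n k => 1 - ε * (Real.log ‖z‖ - Real.log (rho z)))
      (fun z : Ambient n k => 1 - ε * (Real.log ‖z‖ - Real.log (rho z))) q =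
        ε ^ 2 * (1 / rho q ^ 2 - 1 / ‖q‖ ^ 2) := by
    rw [g0, gdot_comm, g2, gdot_comm, g1]
    field_simp
    ring
  have hV : (logBarrier ε : Ambient n k → ℝ) =
      fun z => rho z * (1 - ε * (Real.log ‖z‖ - Real.log (rho z))) := rfl
  have g4 : gdot rho (fun z : Ambient n k => 1 - ε * (Real.log ‖z‖ - Real.log (rho z))) q =
      -(ε * (‖q‖⁻¹ * (rho q / ‖q‖) - (rho q)⁻¹)) := gdot_comm.trans g1
  rw [hV, lap_mul c1 c6, gdot_mul_self (d c1) (d c6), g3, g4, gdot_rho_rho hq, l1, lap_rho hq]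
  simp only
  generalize (1 - ε * (Real.log ‖q‖ - Real.log (rho q))) = v
  field_simp
  ring

/-- The point `(0, e)` of the sphere. -/
def northPole (hk : 1 ≤ k) : RoundSphere n k :=
  ⟨EuclideanSpace.single (Sum.inr ⟨0, hk⟩) 1, by simp⟩

lemma yPart_northPole (hk : 1 ≤ k) :
    yPart ((northPole hk : RoundSphere n k) : Ambient n k) = EuclideanSpace.single ⟨0, hk⟩ 1 := by
  ext l; simp [northPole, yPart]

lemma rho_northPole (hk : 1 ≤ k) : rho ((northPole hk : RoundSphere n k) : Ambient n k) = 1 := by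
  rw [rho, yPart_northPole]; simp

lemma continuous_rho : Continuous (rho : Ambient n k → ℝ) := continuous_yPart.norm

lemma rho_coe_le_one (p : RoundSphere n k) : rho (p : Ambient n k) ≤ 1 :=
  (norm_yPart_le _).trans (norm_eq_of_mem_sphere p).le

lemma northPole_notMem (hk : 1 ≤ k) : (northPole hk : RoundSphere n k) ∉ equator n k := by
  intro h
  have h1 := rho_northPole (n := n) hk
  have h2 : yPart ((northPole hk : RoundSphere n k) : Ambient n k) = 0 := h
  rw [rho, h2] at h1
  simp at h1

/-- Comparison with the barrier on the compact region where it is nonnegative. -/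
lemma IsSingularYamabe.logBarrier_sq_le (hn : 1 ≤ n) (hk : 1 ≤ k) (hkn : k < n + 2)
    {u : RoundSphere n k → ℝ} (hu : IsSingularYamabe u) {ε : ℝ} (hε : 0 < ε)
    {p : RoundSphere n k} (hp : Real.exp (-ε⁻¹) ≤ rho (p : Ambient n k)) :
    ((n : ℝ) + 2 - k) * (logBarrier ε (p : Ambient n k) / u p) ^ 2 ≤
      ((n : ℝ) + 2 - k) + 2 * ε * (1 + n) + ((n : ℝ) + k) * ε ^ 2 := by
  set K : Set (RoundSphere n k) := {p | Real.exp (-ε⁻¹) ≤ rho (p : Ambient n k)} with hK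
  have hKc : IsCompact K :=
    (isClosed_le continuous_const (continuous_rho.comp continuous_subtype_val)).isCompact
  have hKpos : ∀ p ∈ K, 0 < rho (p : Ambient n k) := fun p hp => (Real.exp_pos _).trans_le hp
  have hKy : ∀ p ∈ K, yPart (p : Ambient n k) ≠ 0 := fun p hp => norm_pos_iff.mp (hKpos p hp)
  have hcont :
      ContinuousOn (fun p : RoundSphere n k => logBarrier ε (p : Ambient n k) / u p) K := by
    refine ContinuousOn.div ?_ hu.continuous.continuousOn fun p hp => (hu.pos p (hKy p hp)).ne'
    intro p hp
    exact ((contDiffAt_logBarrier ε (hKy p hp)).continuousAt.comp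
      continuous_subtype_val.continuousAt).continuousWithinAt
  have hval : ∀ p : RoundSphere n k, logBarrier ε (p : Ambient n k) =
      rho (p : Ambient n k) * (1 + ε * Real.log (rho (p : Ambient n k))) := by
    intro p
    rw [logBarrier, norm_eq_of_mem_sphere p, Real.log_one]; ring
  have hnp : (northPole hk : RoundSphere n k) ∈ K := by
    change Real.exp (-ε⁻¹) ≤ rho _
    rw [rho_northPole]
    exact Real.exp_le_one_iff.mpr (by simpa using hε.le)
  -- the barrier touches a multiple of `u` from below at an interior maximum of the quotient
  obtain ⟨p₀, hp₀, hmax⟩ := hKc.exists_isMaxOn ⟨_, hnp⟩ hcont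
  set M := logBarrier ε (p₀ : Ambient n k) / u p₀ with hM
  have hu₀ := hu.pos p₀ (hKy p₀ hp₀)
  have hMpos : 0 < M := by
    refine lt_of_lt_of_le ?_ (hmax hnp)
    simp only
    rw [hval, rho_northPole]
    simpa using hu.pos _ (northPole_notMem hk)
  have hVpos : 0 < logBarrier ε (p₀ : Ambient n k) := by
    have : logBarrier ε (p₀ : Ambient n k) = M * u p₀ := by rw [hM]; field_simp
    rw [this]; positivity
  have hv : 0 < 1 + ε * Real.log (rho (p₀ : Ambient n k)) := by
    rw [hval] at hVpos
    exact pos_of_mul_pos_right hVpos (hKpos p₀ hp₀).le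
  have hint : Real.exp (-ε⁻¹) < rho (p₀ : Ambient n k) := by
    rw [← Real.lt_log_iff_exp_lt (hKpos p₀ hp₀)]
    have : ε * (-ε⁻¹) < ε * Real.log (rho (p₀ : Ambient n k)) := by
      rw [mul_neg, mul_inv_cancel₀ hε.ne']; linarith
    exact lt_of_mul_lt_mul_left this hε.le
  have hev : ∀ᶠ p' : RoundSphere n k in 𝓝 p₀,
      logBarrier ε (p' : Ambient n k) ≤ M * homExt u (p' : Ambient n k) := by
    filter_upwards [(continuous_rho.comp continuous_subtype_val).continuousAt.eventually
      (lt_mem_nhds hint)] with p' hp'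
    have hp'K : p' ∈ K := le_of_lt hp'
    have h1 : logBarrier ε (p' : Ambient n k) / u p' ≤ M := hmax hp'K
    rw [div_le_iff₀ (hu.pos p' (hKy p' hp'K))] at h1
    rwa [homExt_coe]
  have hev' := eventually_le_of_homogeneous (fun t ht q => homExt_smul u ht q)
    (fun t ht q => logBarrier_smul ε ht q) hev
  have hop := touching_operator (N := (n : ℝ) + k)
    ((hu.contDiffAt (hKy p₀ hp₀)).of_le (by norm_cast))
    (contDiffAt_logBarrier ε (hKy p₀ hp₀)) hVpos.le hev' (by rw [homExt_coe, hM]; field_simp)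
  rw [logBarrier_operator ε (hKy p₀ hp₀), hu.equation hn hk (hKy p₀ hp₀),
    norm_eq_of_mem_sphere p₀, Real.log_one] at hop
  have hm : (0 : ℝ) < (n : ℝ) + 2 - k := by
    have : (k : ℝ) < n + 2 := by exact_mod_cast hkn
    linarith
  have hρ1 := rho_coe_le_one p₀
  have hρ0 := hKpos p₀ hp₀
  have hlog : Real.log (rho (p₀ : Ambient n k)) ≤ 0 := Real.log_nonpos hρ0.le hρ1
  have hle : logBarrier ε (p : Ambient n k) / u p ≤ M := hmax hp
  have hge : 0 ≤ logBarrier ε (p : Ambient n k) / u p := by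
    refine div_nonneg ?_ (hu.pos p (hKy p hp)).le
    rw [hval]
    refine mul_nonneg (hKpos p hp).le ?_
    have := (Real.le_log_iff_exp_le (hKpos p hp)).mpr hp
    have h2 := mul_le_mul_of_nonneg_left this hε.le
    rw [mul_neg, mul_inv_cancel₀ hε.ne'] at h2
    linarith
  have hsq : (logBarrier ε (p : Ambient n k) / u p) ^ 2 ≤ M ^ 2 := by gcongr
  have h3 := mul_le_mul_of_nonneg_left hsq hm.le
  have hk0 : (0 : ℝ) ≤ k := Nat.cast_nonneg k
  have hn0 : (0 : ℝ) ≤ n := Nat.cast_nonneg n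
  have hsub : 1 - ε * (0 - Real.log (rho (p₀ : Ambient n k)))
      = 1 + ε * Real.log (rho (p₀ : Ambient n k)) := by ring
  rw [hsub, one_pow, div_one] at hop
  set v := 1 + ε * Real.log (rho (p₀ : Ambient n k)) with hvdef
  have hv1 : v ≤ 1 := by
    have := mul_nonpos_of_nonneg_of_nonpos hε.le hlog
    linarith
  set τ := rho (p₀ : Ambient n k) ^ 2 with hτ
  have hτ0 : 0 ≤ τ := by positivity
  have hτ1 : τ ≤ 1 := pow_le_one₀ hρ0.le hρ1
  have e1 : ((n : ℝ) + 2 - k) * v ^ 2 ≤ ((n : ℝ) + 2 - k) :=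
    mul_le_of_le_one_right hm.le (pow_le_one₀ hv.le hv1)
  have e2 : 2 * v * ε * (τ + n) ≤ 2 * ε * (1 + n) := by
    have : v * (τ + n) ≤ 1 * (1 + n) := by gcongr
    nlinarith
  have e3 : ((n : ℝ) + k) * ε ^ 2 * (1 - τ) ≤ ((n : ℝ) + k) * ε ^ 2 :=
    mul_le_of_le_one_right (by positivity) (by linarith)
  nlinarith

/-- The Schwarz-type bound: every singular Yamabe metric is dominated by `|y|⁻² g`. -/
theorem IsSingularYamabe.equatorialFactor_le (hn : 1 ≤ n) (hk : 1 ≤ k) (hkn : k < n + 2)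
    {u : RoundSphere n k → ℝ} (hu : IsSingularYamabe u) {p : RoundSphere n k}
    (hp : p ∉ equator n k) : rho (p : Ambient n k) ≤ u p := by
  have hρ : 0 < rho (p : Ambient n k) := norm_pos_iff.mpr hp
  have hup := hu.pos p hp
  have hm : (0 : ℝ) < (n : ℝ) + 2 - k := by
    have : (k : ℝ) < n + 2 := by exact_mod_cast hkn
    linarith
  set A : ℝ → ℝ := fun ε => ((n : ℝ) + 2 - k) *
    (rho (p : Ambient n k) * (1 + ε * Real.log (rho (p : Ambient n k))) / u p) ^ 2 with hA
  set B : ℝ → ℝ := fun ε => ((n : ℝ) + 2 - k) + 2 * ε * (1 + n) + ((n : ℝ) + k) * ε ^ 2 with hB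
  have hAc : Filter.Tendsto A (𝓝[>] 0) (𝓝 (A 0)) := by
    have : Continuous A := by fun_prop
    exact this.continuousWithinAt
  have hBc : Filter.Tendsto B (𝓝[>] 0) (𝓝 (B 0)) := by
    have : Continuous B := by fun_prop
    exact this.continuousWithinAt
  have hev : ∀ᶠ ε in 𝓝[>] (0 : ℝ), A ε ≤ B ε := by
    have h1 : ∀ᶠ ε in 𝓝 (0 : ℝ), 0 < 1 + ε * Real.log (rho (p : Ambient n k)) := by
      have : Continuous fun ε : ℝ => 1 + ε * Real.log (rho (p : Ambient n k)) := by fun_prop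
      exact this.continuousAt.eventually (lt_mem_nhds (by simp))
    filter_upwards [nhdsWithin_le_nhds h1, self_mem_nhdsWithin] with ε h2 hε
    have hε : 0 < ε := hε
    have h3 : Real.exp (-ε⁻¹) ≤ rho (p : Ambient n k) := by
      rw [← Real.le_log_iff_exp_le hρ]
      refine le_of_mul_le_mul_left ?_ hε
      rw [mul_neg, mul_inv_cancel₀ hε.ne']; linarith
    have h4 := hu.logBarrier_sq_le hn hk hkn hε h3
    have h5 : logBarrier ε (p : Ambient n k) =
        rho (p : Ambient n k) * (1 + ε * Real.log (rho (p : Ambient n k))) := by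
      rw [logBarrier, norm_eq_of_mem_sphere p, Real.log_one]; ring
    rwa [h5] at h4
  have h := le_of_tendsto_of_tendsto hAc hBc hev
  simp only [hA, hB, zero_mul, add_zero, mul_one, mul_zero, ne_eq, OfNat.ofNat_ne_zero,
    not_false_eq_true, zero_pow] at h
  have h1 : (rho (p : Ambient n k) / u p) ^ 2 ≤ 1 := by
    by_contra! h2
    nlinarith
  have h2 : rho (p : Ambient n k) / u p ≤ 1 := by
    rwa [sq_le_one_iff₀ (by positivity)] at h1
  rwa [div_le_one hup] at h2

/-- In codimension one the reverse bound follows from the boundary values alone, by comparison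
with the spherical caps `|y| + a |(x, y)|`. -/
theorem IsSingularYamabe.le_equatorialFactor_of_codim_one (hn : 1 ≤ n)
    {u : RoundSphere n 1 → ℝ} (hu : IsSingularYamabe u) (p : RoundSphere n 1) :
    u p ≤ rho (p : Ambient n 1) := by
  have hunn : ∀ p, 0 ≤ u p := fun p => by
    by_cases hp : p ∈ equator n 1
    · exact (hu.eq_zero p hp).ge
    · exact (hu.pos p hp).le
  have hmain : ∀ a : ℝ, 0 < a → u p ^ 2 * (1 - a ^ 2) ≤ (rho (p : Ambient n 1) + a) ^ 2 := by
    intro a ha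
    set V : Ambient n 1 → ℝ := fun q => rho q + a * ‖q‖ with hV
    have hVp : ∀ p : RoundSphere n 1, V p = rho (p : Ambient n 1) + a := fun p => by
      simp [hV]
    have hVpos : ∀ p : RoundSphere n 1, 0 < V p := fun p => by
      rw [hVp]
      have : 0 ≤ rho (p : Ambient n 1) := norm_nonneg _
      positivity
    have hVs : ∀ t : ℝ, 0 < t → ∀ q, V (t • q) = t * V q := fun t ht q => by
      simp only [hV]; rw [rho_smul ht, norm_smul_of_pos ht]; ring
    have hcont : Continuous fun p : RoundSphere n 1 => u p / V p := by
      refine hu.continuous.div ?_ fun p => (hVpos p).ne'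
      exact (continuous_rho.comp continuous_subtype_val).add
        (continuous_const.mul continuous_subtype_val.norm)
    -- the maximum of `u / V` is not on the equator, where `u = 0 < V`
    obtain ⟨p₀, -, hmax⟩ := isCompact_univ.exists_isMaxOn ⟨p, Set.mem_univ p⟩ hcont.continuousOn
    set M := u p₀ / V p₀ with hM
    have hle : ∀ p', u p' ≤ M * V p' := fun p' => by
      have h1 : u p' / V p' ≤ M := hmax (Set.mem_univ p')
      rwa [div_le_iff₀ (hVpos p')] at h1
    have hMpos : 0 < M := by
      have h1 := hle (northPole le_rfl)
      have h2 := hu.pos _ (northPole_notMem (n := n) le_rfl)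
      exact pos_of_mul_pos_left (h2.trans_le h1) (hVpos _).le
    have hMu : u p₀ = M * V p₀ := by have := hVpos p₀; rw [hM]; field_simp
    have hp₀ : p₀ ∉ equator n 1 := by
      intro h
      have h1 := hu.eq_zero p₀ h
      rw [hMu] at h1
      exact (mul_pos hMpos (hVpos p₀)).ne' h1
    have hy : yPart (p₀ : Ambient n 1) ≠ 0 := hp₀
    have hy0 := ne_zero_of_yPart hy
    have c1 : ContDiffAt ℝ 2 (rho : Ambient n 1 → ℝ) p₀ := contDiffAt_rho hy
    have c2 : ContDiffAt ℝ 2 (fun q : Ambient n 1 => ‖q‖) p₀ := contDiffAt_norm ℝ hy0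
    have c3 : ContDiffAt ℝ 2 (fun q : Ambient n 1 => a * ‖q‖) p₀ := contDiffAt_const.mul c2
    have hev := eventually_le_of_homogeneous (M := M) (p := p₀) hVs
      (fun t ht q => homExt_smul u ht q)
      (Filter.Eventually.of_forall fun p' => by rw [homExt_coe]; exact hle p')
    have hop := touching_operator (U := V) (N := (n : ℝ) + (1 : ℕ)) (c1.add c3)
      ((hu.contDiffAt hy).of_le (by norm_cast))
      (by rw [homExt_coe]; exact hunn p₀) hev (by rw [homExt_coe, hMu])
    have d {f : Ambient n 1 → ℝ} (h : ContDiffAt ℝ 2 f p₀) : DifferentiableAt ℝ f p₀ :=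
      h.differentiableAt (by simp)
    have hl : lap V p₀ = a * (((n : ℝ) + (1 : ℕ)) / ‖(p₀ : Ambient n 1)‖) := by
      rw [hV, lap_add c1 c3, lap_rho hy, lap_const_mul c2, lap_norm hy0]; simp
    have hg : gdot V V p₀ =
        1 + 2 * a * (rho (p₀ : Ambient n 1) / ‖(p₀ : Ambient n 1)‖) + a ^ 2 := by
      rw [hV, gdot_add_left (d c1) (d c3), gdot_const_mul_left (d c2), gdot_comm,
        gdot_add_left (d c1) (d c3), gdot_const_mul_left (d c2),
        gdot_comm (h := fun z => rho z + a * ‖z‖),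
        gdot_add_left (d c1) (d c3), gdot_const_mul_left (d c2), gdot_rho_rho hy,
        gdot_norm_norm hy0, gdot_rho_norm hy, gdot_comm, gdot_rho_norm hy]
      ring
    rw [hu.equation hn le_rfl hy, hl, hg, hVp, norm_eq_of_mem_sphere p₀] at hop
    have hN : (0 : ℝ) < (n : ℝ) + 1 := by positivity
    have h1 : M ^ 2 * (1 - a ^ 2) ≤ 1 := by
      push_cast at hop
      have h2 : ((n : ℝ) + 1) * (M ^ 2 * (1 - a ^ 2)) ≤ ((n : ℝ) + 1) * 1 := by nlinarith
      exact le_of_mul_le_mul_left h2 hN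
    have h2 := hle p
    rw [hVp] at h2
    have hρ : 0 ≤ rho (p : Ambient n 1) := norm_nonneg _
    by_cases ha1 : 1 - a ^ 2 ≤ 0
    · nlinarith [sq_nonneg (u p), sq_nonneg (rho (p : Ambient n 1) + a)]
    · have h3 : u p ^ 2 ≤ (M * (rho (p : Ambient n 1) + a)) ^ 2 :=
        pow_le_pow_left₀ (hunn p) h2 2
      calc u p ^ 2 * (1 - a ^ 2) ≤ (M * (rho (p : Ambient n 1) + a)) ^ 2 * (1 - a ^ 2) := by
            gcongr
            exact (not_le.mp ha1).le
        _ = (M ^ 2 * (1 - a ^ 2)) * (rho (p : Ambient n 1) + a) ^ 2 := by ring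
        _ ≤ 1 * (rho (p : Ambient n 1) + a) ^ 2 := by gcongr
        _ = _ := one_mul _
  have hA : Filter.Tendsto (fun a : ℝ => u p ^ 2 * (1 - a ^ 2)) (𝓝[>] 0)
      (𝓝 (u p ^ 2 * (1 - 0 ^ 2))) := by
    have : Continuous fun a : ℝ => u p ^ 2 * (1 - a ^ 2) := by fun_prop
    exact (this.tendsto 0).mono_left nhdsWithin_le_nhds
  have hB : Filter.Tendsto (fun a : ℝ => (rho (p : Ambient n 1) + a) ^ 2) (𝓝[>] 0)
      (𝓝 ((rho (p : Ambient n 1) + 0) ^ 2)) := by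
    have : Continuous fun a : ℝ => (rho (p : Ambient n 1) + a) ^ 2 := by fun_prop
    exact (this.tendsto 0).mono_left nhdsWithin_le_nhds
  have h := le_of_tendsto_of_tendsto hA hB (by
    filter_upwards [self_mem_nhdsWithin] with a ha using hmain a ha)
  simp only [ne_eq, OfNat.ofNat_ne_zero, not_false_eq_true, zero_pow, sub_zero, mul_one,
    add_zero] at h
  exact (le_abs_self _).trans (abs_le_of_sq_le_sq h (norm_nonneg _))

end Comparison

/-! ### The isometry with hyperbolic space times a sphere -/

section Isometry

variable {n k : ℕ}

/-- The point `(x, y)` of `ℝ^{n+1} × ℝ^k`. -/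
def ambientMk (x : EuclideanSpace ℝ (Fin (n + 1))) (y : EuclideanSpace ℝ (Fin k)) : Ambient n k :=
  WithLp.toLp 2 (Sum.elim x y)

@[simp] lemma xPart_ambientMk (x : EuclideanSpace ℝ (Fin (n + 1))) (y : EuclideanSpace ℝ (Fin k)) :
    xPart (ambientMk x y) = x := rfl

@[simp] lemma yPart_ambientMk (x : EuclideanSpace ℝ (Fin (n + 1))) (y : EuclideanSpace ℝ (Fin k)) :
    yPart (ambientMk x y) = y := rfl

lemma ambient_ext {q q' : Ambient n k} (hx : xPart q = xPart q') (hy : yPart q = yPart q') :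
    q = q' := by
  ext (i | j)
  · exact congrArg (fun z : EuclideanSpace ℝ (Fin (n + 1)) => z i) hx
  · exact congrArg (fun z : EuclideanSpace ℝ (Fin k) => z j) hy

lemma hasFDerivAt_rho {q : Ambient n k} (hq : yPart q ≠ 0) :
    HasFDerivAt rho ((rho q)⁻¹ • (innerSL ℝ (yPart q)).comp (yPartL n k)) q := by
  have hd := (contDiffAt_rho (m := 1) hq).differentiableAt (by simp)
  have hρ := rho_pos hq
  have h1 : HasFDerivAt (fun z => rho z * rho z) _ q := hd.hasFDerivAt.fun_mul hd.hasFDerivAt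
  have h2 : HasFDerivAt (fun z => ‖yPartL n k z‖ ^ 2) _ q :=
    (hasStrictFDerivAt_norm_sq (yPartL n k q)).hasFDerivAt.comp q (yPartL n k).hasFDerivAt
  have h3 : (fun z : Ambient n k => rho z * rho z) = fun z => ‖yPartL n k z‖ ^ 2 := by
    funext z; simp only [rho, yPartL_apply]; ring
  rw [h3] at h1
  have h4 := h1.unique h2
  have h5 : fderiv ℝ rho q = (rho q)⁻¹ • (innerSL ℝ (yPart q)).comp (yPartL n k) := by
    ext v
    have h6 := congrArg (fun L => L v) h4
    simp only [add_apply, smul_apply, smul_eq_mul, ContinuousLinearMap.comp_apply,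
      innerSL_apply_apply, nsmul_eq_mul, Nat.cast_ofNat] at h6 ⊢
    rw [yPartL_apply] at h6
    field_simp
    linarith
  rw [← h5]
  exact hd.hasFDerivAt

lemma abs_fderiv_rho_le {q : Ambient n k} (hq : yPart q ≠ 0) (v : Ambient n k) :
    |fderiv ℝ rho q v| ≤ ‖v‖ := by
  have hρ := rho_pos hq
  rw [(hasFDerivAt_rho hq).fderiv]
  simp only [smul_apply, smul_eq_mul, ContinuousLinearMap.comp_apply, innerSL_apply_apply,
    yPartL_apply]
  rw [abs_mul, abs_of_pos (inv_pos.mpr hρ), inv_mul_le_iff₀ hρ]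
  exact (abs_real_inner_le_norm _ _).trans
    (mul_le_mul_of_nonneg_left (norm_yPart_le v) (norm_nonneg _))

/-- The isometry is `(x, y) ↦ (x / (1 + |y|), y / |y|)`. -/
lemma isometricToHyperbolicTimesSphere :
    IsometricToHyperbolicTimesSphere (equatorialFactor n k) := by
  have hρs : ContDiffOn ℝ ∞ rho {q : Ambient n k | yPart q ≠ 0} := fun q hq =>
    (contDiffAt_rho hq).contDiffWithinAt
  have hρ0 : ∀ q : Ambient n k, 0 ≤ rho q := fun q => norm_nonneg _
  have hnorm : ∀ p : RoundSphere n k,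
      ‖xPart (p : Ambient n k)‖ ^ 2 + rho (p : Ambient n k) ^ 2 = 1 := fun p => by
    rw [rho, ← norm_sq_eq_add, norm_eq_of_mem_sphere p]; norm_num
  refine ⟨fun q => (1 + rho q)⁻¹ • xPart q, fun q => (rho q)⁻¹ • yPart q, ?_, ?_, ⟨?_, ?_, ?_⟩, ?_⟩
  · refine ContDiffOn.smul (ContDiffOn.inv (contDiffOn_const.add hρs) fun q _ => ?_)
      (xPartL n k).contDiff.contDiffOn
    have := hρ0 q; positivity
  · exact ContDiffOn.smul (hρs.inv fun q hq => (rho_pos hq).ne') (yPartL n k).contDiff.contDiffOn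
  · intro p hp
    have hy : yPart (p : Ambient n k) ≠ 0 := hp
    have hρ := rho_pos hy
    refine ⟨?_, ?_⟩
    · rw [mem_ball_zero_iff, norm_smul, norm_inv, Real.norm_of_nonneg (by positivity),
        inv_mul_lt_iff₀ (by positivity), mul_one]
      have := hnorm p
      nlinarith [norm_nonneg (xPart (p : Ambient n k))]
    · rw [mem_sphere_zero_iff_norm, norm_smul, norm_inv, Real.norm_of_nonneg hρ.le]
      exact inv_mul_cancel₀ hρ.ne'
  · intro p hp p' hp' heq
    have hy : yPart (p : Ambient n k) ≠ 0 := hp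
    have hy' : yPart (p' : Ambient n k) ≠ 0 := hp'
    have hρ := rho_pos hy
    have hρ' := rho_pos hy'
    have h1 : (1 + rho (p : Ambient n k))⁻¹ • xPart (p : Ambient n k) =
      (1 + rho (p' : Ambient n k))⁻¹ • xPart (p' : Ambient n k) := congrArg Prod.fst heq
    have h2 : (rho (p : Ambient n k))⁻¹ • yPart (p : Ambient n k) =
      (rho (p' : Ambient n k))⁻¹ • yPart (p' : Ambient n k) := congrArg Prod.snd heq
    have h3 : rho (p : Ambient n k) = rho (p' : Ambient n k) := by
      have h4 := congrArg (fun z => ‖z‖ ^ 2) h1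
      simp only [norm_smul, norm_inv] at h4
      rw [Real.norm_of_nonneg (by positivity), Real.norm_of_nonneg (by positivity), mul_pow,
        mul_pow, eq_sub_of_add_eq (hnorm p), eq_sub_of_add_eq (hnorm p')] at h4
      field_simp at h4
      have h5 : ((1 + rho (p : Ambient n k)) * (1 + rho (p' : Ambient n k))) *
          (rho (p' : Ambient n k) - rho (p : Ambient n k)) = 0 := by
        linear_combination (1 / 2) * h4
      have h6 := (mul_eq_zero.mp h5).resolve_left (by positivity)
      linarith
    rw [h3] at h1 h2
    refine Subtype.ext (ambient_ext ?_ ?_)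
    · exact smul_right_injective _ (inv_ne_zero (by positivity)) h1
    · exact smul_right_injective _ (inv_ne_zero hρ'.ne') h2
  · rintro ⟨z, w⟩ ⟨hz, hw⟩
    rw [mem_ball_zero_iff] at hz
    rw [mem_sphere_zero_iff_norm] at hw
    have hs : 0 ≤ ‖z‖ ^ 2 := by positivity
    have hs1 : ‖z‖ ^ 2 < 1 := by nlinarith [norm_nonneg z]
    set s := ‖z‖ ^ 2 with hsdef
    have hr : 0 < (1 - s) / (1 + s) := div_pos (by linarith) (by linarith)
    -- stereographic projection from the ball to the hemisphere of the points `(x, t)` with `t > 0`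
    set q : Ambient n k := ambientMk ((2 / (1 + s)) • z) (((1 - s) / (1 + s)) • w) with hq
    have hρ : rho q = (1 - s) / (1 + s) := by
      rw [rho, hq, yPart_ambientMk, norm_smul, Real.norm_of_nonneg hr.le, hw, mul_one]
    have hqn : ‖q‖ = 1 := by
      have h1 : ‖q‖ ^ 2 = 1 := by
        rw [norm_sq_eq_add, ← rho, hρ, hq, xPart_ambientMk, norm_smul, mul_pow, ← hsdef,
          Real.norm_eq_abs, sq_abs]
        field_simp
        ring
      nlinarith [norm_nonneg q]
    refine ⟨⟨q, by simp [hqn]⟩, ?_, ?_⟩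
    · change yPart q ≠ 0
      rw [← norm_pos_iff]
      change 0 < rho q
      rw [hρ]; exact hr
    · have h1 : (1 + rho q)⁻¹ * (2 / (1 + s)) = 1 := by rw [hρ]; field_simp; ring
      have h2 : (rho q)⁻¹ * ((1 - s) / (1 + s)) = 1 := by rw [hρ]; exact inv_mul_cancel₀ hr.ne'
      simp only
      rw [Prod.mk.injEq]
      constructor
      · rw [hq, xPart_ambientMk, smul_smul, ← hq, h1, one_smul]
      · rw [hq, yPart_ambientMk, smul_smul, ← hq, h2, one_smul]
  · intro p hp v hv
    have hy : yPart (p : Ambient n k) ≠ 0 := hp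
    have hρ := rho_pos hy
    set q : Ambient n k := (p : Ambient n k) with hqdef
    set c : ℝ := (rho q)⁻¹ * inner ℝ (yPart q) (yPart v) with hc
    have hdρ := hasFDerivAt_rho hy
    have hdc : fderiv ℝ rho q v = c := by
      rw [hdρ.fderiv]; rfl
    have hd := (contDiffAt_rho (m := 1) hy).differentiableAt (by simp)
    have hΦ : fderiv ℝ (fun q : Ambient n k => (1 + rho q)⁻¹ • xPart q) q v =
        (1 + rho q)⁻¹ • xPart v - (c / (1 + rho q) ^ 2) • xPart q := by
      have h1 : HasFDerivAt (fun z : Ambient n k => (1 + rho z)⁻¹)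
          (-((1 + rho q) ^ 2)⁻¹ • fderiv ℝ rho q) q :=
        (hasDerivAt_inv (by positivity : 1 + rho q ≠ 0)).comp_hasFDerivAt q
          (hd.hasFDerivAt.const_add 1)
      have h2 : HasFDerivAt (fun z : Ambient n k => (1 + rho z)⁻¹ • xPart z) _ q :=
        h1.fun_smul (xPartL n k).hasFDerivAt
      rw [h2.fderiv]
      simp only [add_apply, smul_apply, ContinuousLinearMap.smulRight_apply, hdc, xPartL_apply,
        smul_eq_mul, div_eq_mul_inv]
      module
    have hΘ : fderiv ℝ (fun q : Ambient n k => (rho q)⁻¹ • yPart q) q v =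
        (rho q)⁻¹ • yPart v - (c / rho q ^ 2) • yPart q := by
      have h1 : HasFDerivAt (fun z : Ambient n k => (rho z)⁻¹)
          (-((rho q) ^ 2)⁻¹ • fderiv ℝ rho q) q :=
        (hasDerivAt_inv hρ.ne').comp_hasFDerivAt q hd.hasFDerivAt
      have h2 : HasFDerivAt (fun z : Ambient n k => (rho z)⁻¹ • yPart z) _ q :=
        h1.fun_smul (yPartL n k).hasFDerivAt
      rw [h2.fderiv]
      simp only [add_apply, smul_apply, ContinuousLinearMap.smulRight_apply, hdc, yPartL_apply,
        smul_eq_mul, div_eq_mul_inv]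
      module
    rw [hΦ, hΘ]
    have hyv : inner ℝ (yPart q) (yPart v) = rho q * c := by rw [hc]; field_simp
    have hxv : inner ℝ (xPart q) (xPart v) = -(rho q * c) := by
      rw [inner_eq_add, hyv] at hv; linarith
    have hx2 : ‖xPart q‖ ^ 2 = 1 - rho q ^ 2 := eq_sub_of_add_eq (hnorm p)
    have hy2 : ‖yPart q‖ ^ 2 = rho q ^ 2 := rfl
    have e1 : ‖(1 + rho q)⁻¹ • xPart q‖ ^ 2 = (1 - rho q) / (1 + rho q) := by
      rw [norm_smul, mul_pow, Real.norm_eq_abs, sq_abs, hx2]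
      field_simp
      ring
    have e2 : ‖(1 + rho q)⁻¹ • xPart v - (c / (1 + rho q) ^ 2) • xPart q‖ ^ 2 =
        (‖xPart v‖ ^ 2 + c ^ 2) / (1 + rho q) ^ 2 := by
      rw [norm_sub_sq_real, norm_smul, norm_smul, mul_pow, mul_pow, Real.norm_eq_abs,
        Real.norm_eq_abs, sq_abs, sq_abs, hx2, real_inner_smul_left, real_inner_smul_right,
        real_inner_comm, hxv]
      field_simp
      ring
    have e3 : ‖(rho q)⁻¹ • yPart v - (c / rho q ^ 2) • yPart q‖ ^ 2 =
        (‖yPart v‖ ^ 2 - c ^ 2) / rho q ^ 2 := by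
      rw [norm_sub_sq_real, norm_smul, norm_smul, mul_pow, mul_pow, Real.norm_eq_abs,
        Real.norm_eq_abs, sq_abs, sq_abs, hy2, real_inner_smul_left, real_inner_smul_right,
        real_inner_comm, hyv]
      field_simp
      ring
    rw [e1, e2, e3, norm_sq_eq_add v]
    have e4 : equatorialFactor n k p = rho q := rfl
    rw [e4]
    have e5 : 1 - (1 - rho q) / (1 + rho q) = 2 * rho q / (1 + rho q) := by field_simp; ring
    rw [e5]
    field_simp
    ring

end Isometry

/-! ### Lengths of curves and distances of conformal metrics -/

section Curves

open Set

variable {n k : ℕ}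

/-- A `C¹` map on `[0, 1]` moves its endpoint no further than the integral of any bound for its
speed. -/
lemma ofReal_norm_sub_le_lintegral {E : Type*} [NormedAddCommGroup E] [NormedSpace ℝ E]
    {h : ℝ → E} {w : ℝ → ℝ} (hh : ContDiffOn ℝ 1 h (Icc 0 1))
    (hw : ∀ s ∈ Icc (0 : ℝ) 1, ‖derivWithin h (Icc 0 1) s‖ ≤ w s) :
    ENNReal.ofReal ‖h 1 - h 0‖ ≤ ∫⁻ s in Icc (0 : ℝ) 1, ENNReal.ofReal (w s) := by
  rw [ofReal_norm]
  refine (enorm_sub_le_lintegral_derivWithin_Icc_of_contDiffOn_Icc hh zero_le_one).trans ?_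
  refine MeasureTheory.setLIntegral_mono' measurableSet_Icc fun s hs => ?_
  rw [← ofReal_norm]
  exact ENNReal.ofReal_le_ofReal (hw s hs)

/-- Lower bound for the distance through a function of the curve whose speed is controlled. -/
lemma le_conformalDist {u : RoundSphere n k → ℝ} {A : Set (RoundSphere n k)}
    {p q : RoundSphere n k} {L : ℝ≥0∞}
    (h : ∀ γ : ℝ → RoundSphere n k, ContDiffOn ℝ 1 (fun τ => (γ τ : Ambient n k)) (Icc 0 1) →
      γ 0 = p → γ 1 = q → (∀ s ∈ Icc (0 : ℝ) 1, γ s ∈ A) → L ≤ conformalLength u γ) :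
    L ≤ conformalDist u A p q := by
  unfold conformalDist
  refine le_iInf₂ fun γ hγ => h γ hγ.1 hγ.2.1 hγ.2.2.1 hγ.2.2.2

lemma uniqueDiff_Icc {s : ℝ} (hs : s ∈ Icc (0 : ℝ) 1) :
    UniqueDiffWithinAt ℝ (Icc (0 : ℝ) 1) s := uniqueDiffOn_Icc zero_lt_one s hs

lemma hasDerivWithinAt_curve {γ : ℝ → RoundSphere n k}
    (hγ : ContDiffOn ℝ 1 (fun τ => (γ τ : Ambient n k)) (Icc 0 1)) {s : ℝ}
    (hs : s ∈ Icc (0 : ℝ) 1) :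
    HasDerivWithinAt (fun τ => (γ τ : Ambient n k))
      (derivWithin (fun τ => (γ τ : Ambient n k)) (Icc 0 1) s) (Icc 0 1) s :=
  ((hγ.differentiableOn (by simp)) s hs).hasDerivWithinAt

/-- If `u ≤ B`, then `u⁻² g`-distances dominate chordal distances divided by `B`. -/
lemma chord_le_conformalDist {u : RoundSphere n k → ℝ} {A : Set (RoundSphere n k)} {B : ℝ}
    (hu : ∀ p ∈ A, 0 < u p) (hB : ∀ p ∈ A, u p ≤ B) (hB0 : 0 < B) (p q : RoundSphere n k) :
    ENNReal.ofReal (‖(q : Ambient n k) - p‖ / B) ≤ conformalDist u A p q := by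
  refine le_conformalDist fun γ hγ h0 h1 hA => ?_
  have h2 : ContDiffOn ℝ 1 (fun τ => B⁻¹ • (γ τ : Ambient n k)) (Icc 0 1) := hγ.const_smul B⁻¹
  have h3 := ofReal_norm_sub_le_lintegral
    (w := fun s => ‖derivWithin (fun τ => (γ τ : Ambient n k)) (Icc 0 1) s‖ / u (γ s)) h2
    fun s hs => ?_
  · simp only [h0, h1] at h3
    rw [← smul_sub, norm_smul, norm_inv, Real.norm_of_nonneg hB0.le, inv_mul_eq_div] at h3
    exact h3
  · have h4 := ((hasDerivWithinAt_curve hγ hs).fun_const_smul B⁻¹).derivWithin (uniqueDiff_Icc hs)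
    rw [h4, norm_smul, norm_inv, Real.norm_of_nonneg hB0.le, inv_mul_eq_div]
    exact div_le_div_of_nonneg_left (norm_nonneg _) (hu _ (hA s hs)) (hB _ (hA s hs))

/-- In the metric `|y|⁻² g`, distances dominate the variation of `log |y|`. -/
lemma log_rho_le_conformalDist (p q : RoundSphere n k) :
    ENNReal.ofReal |Real.log (rho (q : Ambient n k)) - Real.log (rho (p : Ambient n k))| ≤
      conformalDist (equatorialFactor n k) (equator n k)ᶜ p q := by
  refine le_conformalDist fun γ hγ h0 h1 hA => ?_
  have hy : ∀ s ∈ Icc (0 : ℝ) 1, yPart (γ s : Ambient n k) ≠ 0 := fun s hs => hA s hs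
  have h2 : ContDiffOn ℝ 1 (fun τ => Real.log (rho (γ τ : Ambient n k))) (Icc 0 1) := by
    intro s hs
    exact (contDiffAt_log_rho (hy s hs)).comp_contDiffWithinAt s (hγ s hs)
  have h3 := ofReal_norm_sub_le_lintegral
    (w := fun s => ‖derivWithin (fun τ => (γ τ : Ambient n k)) (Icc 0 1) s‖ /
      equatorialFactor n k (γ s)) h2 fun s hs => ?_
  · simp only [h0, h1] at h3
    exact h3
  · have hρ := rho_pos (hy s hs)
    have hd := ((contDiffAt_rho (m := 1) (hy s hs)).differentiableAt (by simp)).hasFDerivAt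
    have h5 : HasDerivWithinAt (fun τ => rho (γ τ : Ambient n k)) _ (Icc 0 1) s :=
      HasFDerivAt.comp_hasDerivWithinAt (l := rho) s hd (hasDerivWithinAt_curve hγ hs)
    have h4 := (h5.log hρ.ne').derivWithin (uniqueDiff_Icc hs)
    rw [h4, norm_div, Real.norm_of_nonneg hρ.le]
    exact div_le_div_of_nonneg_right (abs_fderiv_rho_le (hy s hs) _) hρ.le

/-- Upper bound for the distance by the length of a curve given in the ambient space. -/
lemma conformalDist_le_lintegral {u : RoundSphere n k → ℝ} {A : Set (RoundSphere n k)}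
    {c : ℝ → Ambient n k} (hc : ContDiffOn ℝ 1 c (Icc 0 1)) (hn : ∀ s ∈ Icc (0 : ℝ) 1, ‖c s‖ = 1)
    (hA : ∀ s ∈ Icc (0 : ℝ) 1, ∀ p : RoundSphere n k, (p : Ambient n k) = c s → p ∈ A)
    {p q : RoundSphere n k} (hp : (p : Ambient n k) = c 0) (hq : (q : Ambient n k) = c 1) :
    conformalDist u A p q ≤ ∫⁻ s in Icc (0 : ℝ) 1,
      ENNReal.ofReal (‖derivWithin c (Icc 0 1) s‖ / homExt u (c s)) := by
  classical
  set γ : ℝ → RoundSphere n k := fun s =>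
    if h : s ∈ Icc (0 : ℝ) 1 then ⟨c s, by simp [hn s h]⟩ else p with hγ
  have hγc : ∀ s ∈ Icc (0 : ℝ) 1, (γ s : Ambient n k) = c s := fun s hs => by
    rw [hγ]; simp only [dif_pos hs]
  have hγd : ContDiffOn ℝ 1 (fun τ => (γ τ : Ambient n k)) (Icc 0 1) :=
    hc.congr fun s hs => hγc s hs
  have h0 : γ 0 = p := Subtype.ext ((hγc 0 (by simp)).trans hp.symm)
  have h1 : γ 1 = q := Subtype.ext ((hγc 1 (by simp)).trans hq.symm)
  unfold conformalDist
  refine (iInf₂_le γ ⟨hγd, h0, h1, fun s hs => hA s hs _ (hγc s hs)⟩).trans (le_of_eq ?_)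
  unfold conformalLength
  refine MeasureTheory.setLIntegral_congr_fun measurableSet_Icc fun s hs => ?_
  have h3 : derivWithin (fun τ => (γ τ : Ambient n k)) (Icc 0 1) s = derivWithin c (Icc 0 1) s :=
    derivWithin_congr (fun t ht => hγc t ht) (hγc s hs)
  rw [h3, ← hγc s hs, homExt_coe]

/-- Nearby points off the equator are joined by a short curve (a normalized segment). -/
lemma conformalDist_le_of_near {p a : RoundSphere n k} {δ : ℝ} (hδ : 0 < δ)
    (hp : δ ≤ rho (p : Ambient n k)) (hap : ‖(p : Ambient n k) - a‖ ≤ δ / 2) :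
    conformalDist (equatorialFactor n k) (equator n k)ᶜ a p ≤
      ENNReal.ofReal (8 * ‖(p : Ambient n k) - a‖ / δ) := by
  set w : Ambient n k := (p : Ambient n k) - a with hw
  set z : ℝ → Ambient n k := fun s => (a : Ambient n k) + s • w with hz
  have hδ1 : δ ≤ 1 := hp.trans (rho_coe_le_one p)
  have hzp : ∀ s ∈ Icc (0 : ℝ) 1, ‖(p : Ambient n k) - z s‖ ≤ δ / 2 := by
    intro s hs
    have : (p : Ambient n k) - z s = (1 - s) • w := by simp only [hz, hw]; module
    rw [this, norm_smul, Real.norm_of_nonneg (by linarith [hs.2])]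
    calc (1 - s) * ‖w‖ ≤ 1 * ‖w‖ := by gcongr; linarith [hs.1]
      _ ≤ δ / 2 := by rw [one_mul]; exact hap
  have hpn : ‖(p : Ambient n k)‖ = 1 := norm_eq_of_mem_sphere p
  have han : ‖(a : Ambient n k)‖ = 1 := norm_eq_of_mem_sphere a
  have hzn : ∀ s ∈ Icc (0 : ℝ) 1, 1 / 2 ≤ ‖z s‖ := by
    intro s hs
    have h1 := norm_sub_norm_le (p : Ambient n k) (z s)
    have h2 := hzp s hs
    linarith
  have hzn1 : ∀ s ∈ Icc (0 : ℝ) 1, ‖z s‖ ≤ 1 := by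
    intro s hs
    have : z s = (1 - s) • (a : Ambient n k) + s • (p : Ambient n k) := by
      simp only [hz, hw]; module
    rw [this]
    refine (norm_add_le _ _).trans ?_
    rw [norm_smul, norm_smul, hpn, han, Real.norm_of_nonneg hs.1,
      Real.norm_of_nonneg (by linarith [hs.2])]
    linarith
  have hzρ : ∀ s ∈ Icc (0 : ℝ) 1, δ / 2 ≤ rho (z s) := by
    intro s hs
    have h1 : rho (p : Ambient n k) - rho (z s) ≤ ‖(p : Ambient n k) - z s‖ := by
      refine (norm_sub_norm_le _ _).trans ?_
      exact norm_yPart_le ((p : Ambient n k) - z s)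
    have h2 := hzp s hs
    linarith
  have hz0 : ∀ s ∈ Icc (0 : ℝ) 1, z s ≠ 0 := fun s hs h => by
    have := hzn s hs; rw [h, norm_zero] at this; linarith
  have hzs : ContDiff ℝ 1 z := by fun_prop
  have hzd : ∀ s, HasDerivAt z w s := fun s => by
    exact (((hasDerivAt_id s).smul_const w).const_add (a : Ambient n k)).congr_deriv (one_smul _ _)
  have hcs : ∀ s ∈ Icc (0 : ℝ) 1, ContDiffAt ℝ 1 (fun s => ‖z s‖⁻¹ • z s) s := fun s hs =>
    ((hzs.contDiffAt.norm ℝ (hz0 s hs)).inv (norm_ne_zero_iff.mpr (hz0 s hs))).smul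
      hzs.contDiffAt
  refine (conformalDist_le_lintegral (u := equatorialFactor n k) (c := fun s => ‖z s‖⁻¹ • z s)
    (fun s hs => (hcs s hs).contDiffWithinAt) ?_ ?_ ?_ ?_).trans ?_
  · intro s hs
    rw [norm_smul, norm_inv, norm_norm, inv_mul_cancel₀ (norm_ne_zero_iff.mpr (hz0 s hs))]
  · intro s hs p' hp' h
    have h1 : yPart (p' : Ambient n k) = 0 := h
    rw [hp', yPart_smul] at h1
    have h2 := (smul_eq_zero.mp h1).resolve_left
      (inv_ne_zero (norm_ne_zero_iff.mpr (hz0 s hs)))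
    have h3 := hzρ s hs
    rw [rho, h2, norm_zero] at h3
    linarith
  · simp [hz, han]
  · simp [hz, hw, hpn]
  · have hbound : ∀ s ∈ Icc (0 : ℝ) 1,
        ENNReal.ofReal (‖derivWithin (fun s => ‖z s‖⁻¹ • z s) (Icc 0 1) s‖ /
          homExt (equatorialFactor n k) (‖z s‖⁻¹ • z s)) ≤ ENNReal.ofReal (8 * ‖w‖ / δ) := by
      intro s hs
      refine ENNReal.ofReal_le_ofReal ?_
      have hzpos : 0 < ‖z s‖ := norm_pos_iff.mpr (hz0 s hs)
      have hnd : DifferentiableAt ℝ (fun s => ‖z s‖) s :=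
        (hzs.contDiffAt.norm ℝ (hz0 s hs)).differentiableAt (by simp)
      have hlip : |deriv (fun s => ‖z s‖) s| ≤ ‖w‖ := by
        have := norm_deriv_le_of_lipschitz (f := fun s => ‖z s‖) (x₀ := s) (C := ‖w‖₊) ?_
        · simpa using this
        · refine LipschitzWith.of_dist_le_mul fun s t => ?_
          rw [Real.dist_eq, Real.dist_eq]
          refine (abs_norm_sub_norm_le _ _).trans ?_
          have : z s - z t = (s - t) • w := by simp only [hz]; module
          rw [this, norm_smul, Real.norm_eq_abs, coe_nnnorm, mul_comm]
      have hd : HasDerivAt (fun s => ‖z s‖⁻¹ • z s)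
          (‖z s‖⁻¹ • w + (-deriv (fun s => ‖z s‖) s / ‖z s‖ ^ 2) • z s) s :=
        (hnd.hasDerivAt.fun_inv hzpos.ne').fun_smul (hzd s)
      rw [hd.hasDerivWithinAt.derivWithin (uniqueDiff_Icc hs), homExt_equatorialFactor,
        rho_smul (inv_pos.mpr hzpos)]
      have h1 : ‖‖z s‖⁻¹ • w + (-deriv (fun s => ‖z s‖) s / ‖z s‖ ^ 2) • z s‖ ≤
          2 * (‖z s‖⁻¹ * ‖w‖) := by
        refine (norm_add_le _ _).trans ?_
        rw [norm_smul, norm_smul, norm_inv, norm_norm, norm_div, norm_neg, norm_pow, norm_norm,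
          Real.norm_eq_abs]
        have : |deriv (fun s => ‖z s‖) s| / ‖z s‖ ^ 2 * ‖z s‖ ≤ ‖z s‖⁻¹ * ‖w‖ := by
          rw [div_mul_eq_mul_div, div_le_iff₀ (by positivity)]
          have : ‖z s‖⁻¹ * ‖w‖ * ‖z s‖ ^ 2 = ‖w‖ * ‖z s‖ := by field_simp
          rw [this]
          gcongr
        linarith
      have hρs := hzρ s hs
      have hρpos : 0 < rho (z s) := by linarith
      rw [div_le_div_iff₀ (by positivity) hδ]
      calc _ ≤ 2 * (‖z s‖⁻¹ * ‖w‖) * δ := by gcongr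
        _ ≤ 2 * (‖z s‖⁻¹ * ‖w‖) * (2 * rho (z s)) := by gcongr; linarith
        _ ≤ 8 * ‖w‖ * (‖z s‖⁻¹ * rho (z s)) := by
          have : 0 ≤ ‖w‖ * (‖z s‖⁻¹ * rho (z s)) := by positivity
          nlinarith
    refine (MeasureTheory.setLIntegral_mono' measurableSet_Icc hbound).trans ?_
    simp

/-- The metric `|y|⁻² g` is complete off the equator: `log |y|` is bounded along a Cauchy
sequence, which therefore stays in a compact subset of the complement of the equator. -/
theorem conformalComplete_equatorialFactor :
    ConformalComplete (equatorialFactor n k) (equator n k)ᶜ := by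
  intro a ha hC
  have hpos : ∀ p ∈ (equator n k)ᶜ, 0 < equatorialFactor n k p := fun p hp =>
    norm_pos_iff.mpr hp
  obtain ⟨m₀, hm₀⟩ := hC 1 one_pos
  set δ := rho (a m₀ : Ambient n k) * Real.exp (-1) with hδ
  have hρm : 0 < rho (a m₀ : Ambient n k) := norm_pos_iff.mpr (ha m₀)
  have hδ0 : 0 < δ := mul_pos hρm (Real.exp_pos _)
  have hlow : ∀ i ≥ m₀, δ ≤ rho (a i : Ambient n k) := by
    intro i hi
    have h1 := (log_rho_le_conformalDist (a m₀) (a i)).trans (hm₀ m₀ le_rfl i hi).le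
    rw [← ENNReal.ofReal_one, ENNReal.ofReal_le_ofReal_iff zero_le_one] at h1
    have hρi : 0 < rho (a i : Ambient n k) := norm_pos_iff.mpr (ha i)
    have h2 := (abs_le.mp h1).1
    rw [← Real.log_le_log_iff hδ0 hρi, hδ, Real.log_mul hρm.ne' (Real.exp_pos _).ne', Real.log_exp]
    linarith
  have hcau : CauchySeq fun i => (a i : Ambient n k) := by
    rw [Metric.cauchySeq_iff]
    intro ε hε
    obtain ⟨m, hm⟩ := hC (ENNReal.ofReal ε) (ENNReal.ofReal_pos.mpr hε)
    refine ⟨m, fun i hi j hj => ?_⟩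
    have h1 := (chord_le_conformalDist hpos (fun p _ => rho_coe_le_one p) one_pos
      (a j) (a i)).trans_lt (hm j hj i hi)
    rw [div_one, ENNReal.ofReal_lt_ofReal_iff hε] at h1
    rwa [dist_eq_norm]
  obtain ⟨b, hb⟩ := cauchySeq_tendsto_of_complete hcau
  have hbS : b ∈ Metric.sphere (0 : Ambient n k) 1 :=
    Metric.isClosed_sphere.mem_of_tendsto hb (Filter.Eventually.of_forall fun i => (a i).2)
  have hbρ : δ ≤ rho b := by
    refine ge_of_tendsto ((continuous_rho.tendsto b).comp hb) ?_
    filter_upwards [Filter.eventually_ge_atTop m₀] with i hi using hlow i hi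
  refine ⟨⟨b, hbS⟩, ?_, ?_⟩
  · intro h
    have h1 : yPart b = 0 := h
    rw [rho, h1, norm_zero] at hbρ
    linarith
  · have hnorm : Filter.Tendsto (fun i => ‖b - (a i : Ambient n k)‖) Filter.atTop (𝓝 0) := by
      have := (tendsto_const_nhds (x := b)).sub hb
      simpa using this.norm
    have hlim : Filter.Tendsto (fun i => ENNReal.ofReal (8 * ‖b - (a i : Ambient n k)‖ / δ))
        Filter.atTop (𝓝 0) := by
      have := ENNReal.tendsto_ofReal ((hnorm.const_mul 8).div_const δ)
      simpa using this
    refine tendsto_of_tendsto_of_tendsto_of_le_of_le' tendsto_const_nhds hlim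
      (Filter.Eventually.of_forall fun i => zero_le) ?_
    filter_upwards [hnorm.eventually (ge_mem_nhds (show (0 : ℝ) < δ / 2 by linarith))] with i hi
    exact conformalDist_le_of_near (p := ⟨b, hbS⟩) hδ0 hbρ hi

theorem isSingularYamabe_equatorialFactor : IsSingularYamabe (equatorialFactor n k) where
  continuous := continuous_rho.comp continuous_subtype_val
  eq_zero p hp := by
    have h : yPart (p : Ambient n k) = 0 := hp
    rw [equatorialFactor, h, norm_zero]
  pos p hp := norm_pos_iff.mpr hp
  smooth := by
    intro p hp
    have h1 : ContMDiffAt 𝓘(ℝ, Ambient n k) 𝓘(ℝ, ℝ) ∞ rho (p : Ambient n k) :=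
      (contDiffAt_rho hp).contMDiffAt
    exact (h1.comp p (contMDiff_coe_sphere.contMDiffAt)).contMDiffWithinAt
  complete := conformalComplete_equatorialFactor
  scalar p hp := conformalScalarCurvature_equatorialFactor hp

end Curves

/-! ### Averaging over `O(n+1) × O(k)` -/

section Averaging

open Set MeasureTheory

/-- Differentiation under the integral sign over a compact space. -/
lemma hasDerivAt_integral_of_compact {G : Type*} [TopologicalSpace G] [CompactSpace G]
    [MeasurableSpace G] [OpensMeasurableSpace G] {μ : Measure G} [IsFiniteMeasure μ]
    {S : Set ℝ} (hS : IsOpen S) {H H' : ℝ → G → ℝ} (hc : ∀ t ∈ S, Continuous (H t))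
    (hd : ∀ t ∈ S, ∀ g, HasDerivAt (fun τ => H τ g) (H' t g) t)
    (hc' : ContinuousOn (Function.uncurry H') (S ×ˢ univ)) {t₀ : ℝ} (ht₀ : t₀ ∈ S) :
    HasDerivAt (fun t => ∫ g, H t g ∂μ) (∫ g, H' t₀ g ∂μ) t₀ := by
  obtain ⟨ε, hε, hball⟩ := Metric.isOpen_iff.mp hS t₀ ht₀
  have hsub : Metric.closedBall t₀ (ε / 2) ⊆ S :=
    (Metric.closedBall_subset_ball (by linarith)).trans hball
  have hK : IsCompact (Metric.closedBall t₀ (ε / 2) ×ˢ (univ : Set G)) :=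
    (isCompact_closedBall _ _).prod isCompact_univ
  obtain ⟨C, hC⟩ := hK.exists_bound_of_continuousOn (hc'.mono (prod_mono hsub subset_rfl))
  have hint : ∀ {h : G → ℝ}, Continuous h → Integrable h μ := fun hh =>
    hh.integrable_of_hasCompactSupport (HasCompactSupport.of_compactSpace _)
  have hcH' : Continuous (H' t₀) := by
    rw [← continuousOn_univ]
    exact hc'.comp (f := fun g : G => (t₀, g)) (by fun_prop) fun g _ => ⟨ht₀, trivial⟩
  refine (hasDerivAt_integral_of_dominated_loc_of_deriv_le (bound := fun _ => C)
    (Metric.closedBall_mem_nhds t₀ (by linarith : 0 < ε / 2)) ?_ (hint (hc t₀ ht₀))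
    hcH'.aestronglyMeasurable ?_ (integrable_const _) ?_).2
  · filter_upwards [hS.mem_nhds ht₀] with t ht using (hc t ht).aestronglyMeasurable
  · exact Filter.Eventually.of_forall fun g t ht => hC (t, g) ⟨ht, trivial⟩
  · exact Filter.Eventually.of_forall fun g t ht => hd t (hsub ht) g

/-- The orthogonal group of `ℝ^m`. -/
abbrev OrthGroup (m : ℕ) : Type :=
  unitary (EuclideanSpace ℝ (Fin m) →L[ℝ] EuclideanSpace ℝ (Fin m))

instance continuousStar_endomorphism (m : ℕ) :
    ContinuousStar (EuclideanSpace ℝ (Fin m) →L[ℝ] EuclideanSpace ℝ (Fin m)) :=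
  ⟨LinearIsometryEquiv.continuous ContinuousLinearMap.adjoint⟩

instance compactSpace_orthGroup (m : ℕ) : CompactSpace (OrthGroup m) := by
  refine isCompact_iff_compactSpace.mp (Metric.isCompact_of_isClosed_isBounded isClosed_unitary ?_)
  rw [isBounded_iff_forall_norm_le]
  exact ⟨1, fun U hU => ContinuousLinearMap.opNorm_le_bound _ zero_le_one fun x => by
    rw [one_mul]; exact (Unitary.norm_map ⟨U, hU⟩ x).le⟩

lemma exists_orthGroup_apply_eq {m : ℕ} {v w : EuclideanSpace ℝ (Fin m)} (h : ‖v‖ = ‖w‖) :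
    ∃ U : OrthGroup m, (U : EuclideanSpace ℝ (Fin m) →L[ℝ] EuclideanSpace ℝ (Fin m)) v = w :=
  ⟨Unitary.linearIsometryEquiv.symm (ℝ ∙ (v - w))ᗮ.reflection, Submodule.reflection_sub h⟩

/-- The group `O(n+1) × O(k)` of isometries of `ℝ^{n+1} × ℝ^k` preserving both factors. -/
def Rot (n k : ℕ) : Type := OrthGroup (n + 1) × OrthGroup k

instance group_rot (n k : ℕ) : Group (Rot n k) :=
  inferInstanceAs (Group (OrthGroup (n + 1) × OrthGroup k))

instance topologicalSpace_rot (n k : ℕ) : TopologicalSpace (Rot n k) :=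
  inferInstanceAs (TopologicalSpace (OrthGroup (n + 1) × OrthGroup k))

instance isTopologicalGroup_rot (n k : ℕ) : IsTopologicalGroup (Rot n k) :=
  inferInstanceAs (IsTopologicalGroup (OrthGroup (n + 1) × OrthGroup k))

instance compactSpace_rot (n k : ℕ) : CompactSpace (Rot n k) :=
  inferInstanceAs (CompactSpace (OrthGroup (n + 1) × OrthGroup k))

instance measurableSpace_rot (n k : ℕ) : MeasurableSpace (Rot n k) := borel _

instance borelSpace_rot (n k : ℕ) : BorelSpace (Rot n k) := ⟨rfl⟩

variable {n k : ℕ}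

/-- The component in `O(n+1)`. -/
def Rot.xMap (g : Rot n k) : OrthGroup (n + 1) := g.1

/-- The component in `O(k)`. -/
def Rot.yMap (g : Rot n k) : OrthGroup k := g.2

lemma Rot.continuous_xMap : Continuous (Rot.xMap (n := n) (k := k)) := continuous_fst

lemma Rot.continuous_yMap : Continuous (Rot.yMap (n := n) (k := k)) := continuous_snd

/-- The normalized Haar measure on `O(n+1) × O(k)`. -/
def rotMeasure (n k : ℕ) : Measure (Rot n k) := Measure.haarMeasure ⊤

instance isProbabilityMeasure_rotMeasure (n k : ℕ) : IsProbabilityMeasure (rotMeasure n k) :=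
  ⟨Measure.haarMeasure_self⟩

instance isHaarMeasure_rotMeasure (n k : ℕ) : (rotMeasure n k).IsHaarMeasure :=
  inferInstanceAs (Measure.haarMeasure ⊤).IsHaarMeasure

lemma continuous_ambientMk :
    Continuous fun z : EuclideanSpace ℝ (Fin (n + 1)) × EuclideanSpace ℝ (Fin k) =>
      (ambientMk z.1 z.2 : Ambient n k) := by
  refine (PiLp.continuous_toLp 2 _).comp (continuous_pi ?_)
  rintro (i | j)
  · exact (EuclideanSpace.proj i).continuous.comp continuous_fst
  · exact (EuclideanSpace.proj j).continuous.comp continuous_snd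

/-- The map `(x, y) ↦ (A x, B y)` given by `(A, B) ∈ O(n+1) × O(k)`. -/
def Rot.toFun (g : Rot n k) (q : Ambient n k) : Ambient n k :=
  ambientMk
    ((g.xMap : EuclideanSpace ℝ (Fin (n + 1)) →L[ℝ] EuclideanSpace ℝ (Fin (n + 1))) (xPart q))
    ((g.yMap : EuclideanSpace ℝ (Fin k) →L[ℝ] EuclideanSpace ℝ (Fin k)) (yPart q))

/-- The linear action of `O(n+1) × O(k)` on `ℝ^{n+1} × ℝ^k`. -/
def act (g : Rot n k) : Ambient n k →ₗᵢ[ℝ] Ambient n k where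
  toFun := g.toFun
  map_add' q q' := ambient_ext (by simp [Rot.toFun, xPart_add]) (by simp [Rot.toFun, yPart_add])
  map_smul' t q := ambient_ext (by simp [Rot.toFun, xPart_smul]) (by simp [Rot.toFun, yPart_smul])
  norm_map' q := by
    have h : ‖g.toFun q‖ ^ 2 = ‖q‖ ^ 2 := by
      rw [Rot.toFun, norm_sq_eq_add, norm_sq_eq_add q, xPart_ambientMk, yPart_ambientMk,
        Unitary.norm_map g.xMap, Unitary.norm_map g.yMap]
    exact (sq_eq_sq₀ (norm_nonneg _) (norm_nonneg _)).mp h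

@[simp] lemma xPart_act (g : Rot n k) (q : Ambient n k) : xPart (act g q) =
    (g.xMap : EuclideanSpace ℝ (Fin (n + 1)) →L[ℝ] EuclideanSpace ℝ (Fin (n + 1))) (xPart q) := rfl

@[simp] lemma yPart_act (g : Rot n k) (q : Ambient n k) : yPart (act g q) =
    (g.yMap : EuclideanSpace ℝ (Fin k) →L[ℝ] EuclideanSpace ℝ (Fin k)) (yPart q) := rfl

lemma rho_act (g : Rot n k) (q : Ambient n k) : rho (act g q) = rho q := by
  rw [rho, yPart_act, Unitary.norm_map g.yMap, rho]

lemma yPart_act_ne (g : Rot n k) {q : Ambient n k} (hq : yPart q ≠ 0) : yPart (act g q) ≠ 0 := by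
  rw [← norm_pos_iff]
  change 0 < rho (act g q)
  rw [rho_act]
  exact rho_pos hq

lemma act_mul (g h : Rot n k) (q : Ambient n k) : act (g * h) q = act g (act h q) := rfl

lemma continuous_act : Continuous fun z : Rot n k × Ambient n k => act z.1 z.2 := by
  refine continuous_ambientMk.comp (Continuous.prodMk ?_ ?_)
  · exact (continuous_subtype_val.comp (Rot.continuous_xMap.comp continuous_fst)).clm_apply
      (continuous_xPart.comp continuous_snd)
  · exact (continuous_subtype_val.comp (Rot.continuous_yMap.comp continuous_fst)).clm_apply
      (continuous_yPart.comp continuous_snd)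

lemma exists_act_eq {q q' : Ambient n k} (hx : ‖xPart q‖ = ‖xPart q'‖)
    (hy : ‖yPart q‖ = ‖yPart q'‖) : ∃ g : Rot n k, act g q = q' := by
  obtain ⟨A, hA⟩ := exists_orthGroup_apply_eq hx
  obtain ⟨B, hB⟩ := exists_orthGroup_apply_eq hy
  exact ⟨(A, B), ambient_ext hA hB⟩

/-- The action of the inverse element. -/
def actInv (g : Rot n k) : Ambient n k →ₗᵢ[ℝ] Ambient n k := act g⁻¹

lemma actInv_def (g : Rot n k) : actInv g = act g⁻¹ := rfl

lemma rho_actInv (g : Rot n k) (q : Ambient n k) : rho (actInv g q) = rho q := rho_act _ q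

lemma yPart_actInv_ne (g : Rot n k) {q : Ambient n k} (hq : yPart q ≠ 0) :
    yPart (actInv g q) ≠ 0 := yPart_act_ne _ hq

lemma continuous_actInv : Continuous fun z : Rot n k × Ambient n k => actInv z.1 z.2 :=
  continuous_act.comp ((continuous_inv.comp continuous_fst).prodMk continuous_snd)

lemma continuous_actInv_left (q : Ambient n k) : Continuous fun g : Rot n k => actInv g q :=
  (continuous_actInv (n := n) (k := k)).comp
    (f := fun g : Rot n k => (g, q)) (continuous_id.prodMk continuous_const)

attribute [irreducible] act actInv

/-- The average of a function over the orbits of `O(n+1) × O(k)`. -/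
def orbitAverage (f : Ambient n k → ℝ) (q : Ambient n k) : ℝ :=
  ∫ g, f (actInv g q) ∂rotMeasure n k

lemma orbitAverage_act (f : Ambient n k → ℝ) (h : Rot n k) (q : Ambient n k) :
    orbitAverage f (act h q) = orbitAverage f q := by
  unfold orbitAverage
  rw [← integral_mul_left_eq_self (fun g : Rot n k => f (actInv g q)) h⁻¹]
  refine integral_congr_ae (Filter.Eventually.of_forall fun g => ?_)
  simp only [actInv_def, mul_inv_rev, inv_inv, act_mul]

lemma orbitAverage_eq {f : Ambient n k → ℝ} {q q' : Ambient n k} (hx : ‖xPart q‖ = ‖xPart q'‖)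
    (hy : ‖yPart q‖ = ‖yPart q'‖) : orbitAverage f q = orbitAverage f q' := by
  obtain ⟨g, rfl⟩ := exists_act_eq hx hy
  rw [orbitAverage_act]

/-- The averaged first derivative. -/
def avgFDeriv (f : Ambient n k → ℝ) (q v : Ambient n k) : ℝ :=
  ∫ g, fderiv ℝ f (actInv g q) (actInv g v) ∂rotMeasure n k

/-- The averaged second derivative on the diagonal. -/
def avgHess (f : Ambient n k → ℝ) (q v : Ambient n k) : ℝ :=
  ∫ g, fderiv ℝ (fderiv ℝ f) (actInv g q) (actInv g v) (actInv g v) ∂rotMeasure n k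

lemma integrable_of_continuous {h : Rot n k → ℝ} (hh : Continuous h) :
    Integrable h (rotMeasure n k) :=
  hh.integrable_of_hasCompactSupport (HasCompactSupport.of_compactSpace _)

variable {f : Ambient n k → ℝ}

lemma continuous_actInv_comp {X : Type*} [TopologicalSpace X] {c : X → Ambient n k}
    (hc : Continuous c) : Continuous fun z : X × Rot n k => actInv z.2 (c z.1) :=
  (continuous_actInv (n := n) (k := k)).comp
    (f := fun z : X × Rot n k => (z.2, c z.1)) (continuous_snd.prodMk (hc.comp continuous_fst))

lemma continuousOn_fderiv_of_contDiffOn (hf : ContDiffOn ℝ 2 f {q | yPart q ≠ 0}) :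
    ContinuousOn (fderiv ℝ f) {q | yPart q ≠ 0} :=
  hf.continuousOn_fderiv_of_isOpen isOpen_yPart_ne (by norm_num)

lemma contDiffOn_fderiv (hf : ContDiffOn ℝ 2 f {q | yPart q ≠ 0}) :
    ContDiffOn ℝ 1 (fderiv ℝ f) {q | yPart q ≠ 0} :=
  hf.fderiv_of_isOpen isOpen_yPart_ne (by norm_num)

lemma continuousOn_fderiv_fderiv (hf : ContDiffOn ℝ 2 f {q | yPart q ≠ 0}) :
    ContinuousOn (fderiv ℝ (fderiv ℝ f)) {q | yPart q ≠ 0} :=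
  (contDiffOn_fderiv hf).continuousOn_fderiv_of_isOpen isOpen_yPart_ne (by norm_num)

lemma continuous_fderiv_act (hf : ContDiffOn ℝ 2 f {q | yPart q ≠ 0}) {q : Ambient n k}
    (hq : yPart q ≠ 0) (v : Ambient n k) :
    Continuous fun g : Rot n k => fderiv ℝ f (actInv g q) (actInv g v) := by
  exact ((continuousOn_fderiv_of_contDiffOn hf).comp_continuous (continuous_actInv_left q)
    fun g : Rot n k => yPart_actInv_ne g hq).clm_apply (continuous_actInv_left v)

lemma continuous_hess_act (hf : ContDiffOn ℝ 2 f {q | yPart q ≠ 0}) {q : Ambient n k}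
    (hq : yPart q ≠ 0) (v w : Ambient n k) :
    Continuous fun g : Rot n k => fderiv ℝ (fderiv ℝ f) (actInv g q) (actInv g v) (actInv g w) := by
  exact (((continuousOn_fderiv_fderiv hf).comp_continuous (continuous_actInv_left q) fun g =>
    yPart_actInv_ne g hq).clm_apply (continuous_actInv_left v)).clm_apply
      (continuous_actInv_left w)

lemma continuousOn_fderiv_actInv (hf : ContDiffOn ℝ 2 f {q | yPart q ≠ 0}) {S : Set ℝ}
    {c d : ℝ → Ambient n k} (hc : Continuous c) (hd : Continuous d)
    (hcS : ∀ t ∈ S, yPart (c t) ≠ 0) :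
    ContinuousOn (fun z : ℝ × Rot n k => fderiv ℝ f (actInv z.2 (c z.1)) (actInv z.2 (d z.1)))
      (S ×ˢ univ) := by
  have h : ContinuousOn (fun z : ℝ × Rot n k => fderiv ℝ f (actInv z.2 (c z.1))) (S ×ˢ univ) :=
    (continuousOn_fderiv_of_contDiffOn hf).comp (continuous_actInv_comp hc).continuousOn
      fun z hz => yPart_actInv_ne _ (hcS z.1 hz.1)
  exact h.clm_apply (continuous_actInv_comp hd).continuousOn

lemma continuousOn_hess_actInv (hf : ContDiffOn ℝ 2 f {q | yPart q ≠ 0}) {S : Set ℝ}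
    {c d : ℝ → Ambient n k} (hc : Continuous c) (hd : Continuous d)
    (hcS : ∀ t ∈ S, yPart (c t) ≠ 0) :
    ContinuousOn (fun z : ℝ × Rot n k =>
      fderiv ℝ (fderiv ℝ f) (actInv z.2 (c z.1)) (actInv z.2 (d z.1)) (actInv z.2 (d z.1)))
      (S ×ˢ univ) := by
  have h : ContinuousOn (fun z : ℝ × Rot n k => fderiv ℝ (fderiv ℝ f) (actInv z.2 (c z.1)))
      (S ×ˢ univ) :=
    (continuousOn_fderiv_fderiv hf).comp (continuous_actInv_comp hc).continuousOn
      fun z hz => yPart_actInv_ne _ (hcS z.1 hz.1)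
  have h' := h.clm_apply (continuous_actInv_comp hd).continuousOn
  exact h'.clm_apply (continuous_actInv_comp hd).continuousOn

lemma avgFDeriv_smul (q v : Ambient n k) (t : ℝ) : avgFDeriv f q (t • v) = t * avgFDeriv f q v := by
  unfold avgFDeriv
  rw [← integral_const_mul]
  refine integral_congr_ae (Filter.Eventually.of_forall fun g => ?_)
  simp

lemma avgFDeriv_add (hf : ContDiffOn ℝ 2 f {q | yPart q ≠ 0}) {q : Ambient n k}
    (hq : yPart q ≠ 0) (v w : Ambient n k) :
    avgFDeriv f q (v + w) = avgFDeriv f q v + avgFDeriv f q w := by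
  unfold avgFDeriv
  rw [← integral_add (integrable_of_continuous (continuous_fderiv_act hf hq v))
    (integrable_of_continuous (continuous_fderiv_act hf hq w))]
  refine integral_congr_ae (Filter.Eventually.of_forall fun g => ?_)
  simp

lemma avgHess_smul (q v : Ambient n k) (t : ℝ) : avgHess f q (t • v) = t ^ 2 * avgHess f q v := by
  unfold avgHess
  rw [← integral_const_mul]
  refine integral_congr_ae (Filter.Eventually.of_forall fun g => ?_)
  simp
  ring

/-- First derivative of the orbit average along a curve. -/
lemma hasDerivAt_orbitAverage (hf : ContDiffOn ℝ 2 f {q | yPart q ≠ 0}) {S : Set ℝ}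
    (hS : IsOpen S) {c c' : ℝ → Ambient n k} (hc : ∀ t, HasDerivAt c (c' t) t)
    (hc' : Continuous c') (hcS : ∀ t ∈ S, yPart (c t) ≠ 0) {t₀ : ℝ} (ht₀ : t₀ ∈ S) :
    HasDerivAt (fun t => orbitAverage f (c t)) (avgFDeriv f (c t₀) (c' t₀)) t₀ := by
  have hcc : Continuous c := continuous_iff_continuousAt.mpr fun t => (hc t).continuousAt
  refine hasDerivAt_integral_of_compact hS (H := fun t (g : Rot n k) => f (actInv g (c t)))
    (H' := fun t (g : Rot n k) => fderiv ℝ f (actInv g (c t)) (actInv g (c' t))) ?_ ?_ ?_ ht₀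
  · intro t ht
    exact hf.continuousOn.comp_continuous
      (continuous_actInv_left _)
      fun g : Rot n k => yPart_actInv_ne _ (hcS t ht)
  · intro t ht g
    have h1 : DifferentiableAt ℝ f (actInv g (c t)) :=
      (hf.contDiffAt (isOpen_yPart_ne.mem_nhds (yPart_actInv_ne _ (hcS t ht)))).differentiableAt
        (by simp)
    have h2 : HasDerivAt (fun t => actInv g (c t)) (actInv g (c' t)) t :=
      (actInv g).toContinuousLinearMap.hasFDerivAt.comp_hasDerivAt t (hc t)
    exact h1.hasFDerivAt.comp_hasDerivAt t h2
  · exact continuousOn_fderiv_actInv hf hcc hc' hcS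

/-- Second derivative of the orbit average along a curve. -/
lemma hasDerivAt_avgFDeriv (hf : ContDiffOn ℝ 2 f {q | yPart q ≠ 0}) {S : Set ℝ}
    (hS : IsOpen S) {c c' c'' : ℝ → Ambient n k} (hc : ∀ t, HasDerivAt c (c' t) t)
    (hc' : ∀ t, HasDerivAt c' (c'' t) t) (hc'' : Continuous c'')
    (hcS : ∀ t ∈ S, yPart (c t) ≠ 0) {t₀ : ℝ} (ht₀ : t₀ ∈ S) :
    HasDerivAt (fun t => avgFDeriv f (c t) (c' t))
      (avgHess f (c t₀) (c' t₀) + avgFDeriv f (c t₀) (c'' t₀)) t₀ := by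
  have hcc : Continuous c := continuous_iff_continuousAt.mpr fun t => (hc t).continuousAt
  have hcc' : Continuous c' := continuous_iff_continuousAt.mpr fun t => (hc' t).continuousAt
  unfold avgHess avgFDeriv
  rw [← integral_add (integrable_of_continuous (continuous_hess_act hf (hcS t₀ ht₀) _ _))
    (integrable_of_continuous (continuous_fderiv_act hf (hcS t₀ ht₀) _))]
  refine hasDerivAt_integral_of_compact hS
    (H := fun t (g : Rot n k) => fderiv ℝ f (actInv g (c t)) (actInv g (c' t)))
    (H' := fun t (g : Rot n k) =>
      fderiv ℝ (fderiv ℝ f) (actInv g (c t)) (actInv g (c' t)) (actInv g (c' t))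
      + fderiv ℝ f (actInv g (c t)) (actInv g (c'' t))) ?_ ?_ ?_ ht₀
  · intro t ht
    exact continuous_fderiv_act hf (hcS t ht) _
  · intro t ht g
    have h1 : DifferentiableAt ℝ (fderiv ℝ f) (actInv g (c t)) :=
      ((contDiffOn_fderiv hf).contDiffAt
        (isOpen_yPart_ne.mem_nhds (yPart_actInv_ne _ (hcS t ht)))).differentiableAt (by simp)
    have h2 : HasDerivAt (fun t => actInv g (c t)) (actInv g (c' t)) t :=
      (actInv g).toContinuousLinearMap.hasFDerivAt.comp_hasDerivAt t (hc t)
    have h3 : HasDerivAt (fun t => actInv g (c' t)) (actInv g (c'' t)) t :=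
      (actInv g).toContinuousLinearMap.hasFDerivAt.comp_hasDerivAt t (hc' t)
    have h4 : HasDerivAt (fun t => fderiv ℝ f (actInv g (c t)))
        (fderiv ℝ (fderiv ℝ f) (actInv g (c t)) (actInv g (c' t))) t :=
      h1.hasFDerivAt.comp_hasDerivAt t h2
    exact h4.clm_apply h3
  · have h5 := (continuousOn_hess_actInv hf hcc hcc' hcS).add
      (continuousOn_fderiv_actInv hf hcc hc'' hcS)
    exact h5

/-- If the orbit average agrees along two curves, so do the second-order expressions. -/
lemma avgHess_add_avgFDeriv_congr (hf : ContDiffOn ℝ 2 f {q | yPart q ≠ 0}) {S : Set ℝ}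
    (hS : IsOpen S) {c c' c'' b b' b'' : ℝ → Ambient n k} (hc : ∀ t, HasDerivAt c (c' t) t)
    (hc' : ∀ t, HasDerivAt c' (c'' t) t) (hc'' : Continuous c'')
    (hcS : ∀ t ∈ S, yPart (c t) ≠ 0) (hb : ∀ t, HasDerivAt b (b' t) t)
    (hb' : ∀ t, HasDerivAt b' (b'' t) t) (hb'' : Continuous b'')
    (hbS : ∀ t ∈ S, yPart (b t) ≠ 0)
    (heq : ∀ t ∈ S, orbitAverage f (c t) = orbitAverage f (b t)) {t₀ : ℝ} (ht₀ : t₀ ∈ S) :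
    avgHess f (c t₀) (c' t₀) + avgFDeriv f (c t₀) (c'' t₀) =
      avgHess f (b t₀) (b' t₀) + avgFDeriv f (b t₀) (b'' t₀) := by
  have hcc' : Continuous c' := continuous_iff_continuousAt.mpr fun t => (hc' t).continuousAt
  have hbc' : Continuous b' := continuous_iff_continuousAt.mpr fun t => (hb' t).continuousAt
  have h1 : ∀ t ∈ S, avgFDeriv f (c t) (c' t) = avgFDeriv f (b t) (b' t) := by
    intro t ht
    have h2 := hasDerivAt_orbitAverage hf hS hc hcc' hcS ht
    have h3 := hasDerivAt_orbitAverage hf hS hb hbc' hbS ht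
    refine h2.unique (h3.congr_of_eventuallyEq ?_)
    filter_upwards [hS.mem_nhds ht] with s hs using heq s hs
  have h2 := hasDerivAt_avgFDeriv hf hS hc hc' hc'' hcS ht₀
  have h3 := hasDerivAt_avgFDeriv hf hS hb hb' hb'' hbS ht₀
  refine h2.unique (h3.congr_of_eventuallyEq ?_)
  filter_upwards [hS.mem_nhds ht₀] with s hs using h1 s hs

end Averaging

/-! ### The radial equation for orbit averages -/

section RadialEquation

open Set MeasureTheory

variable {n k : ℕ} {f : Ambient n k → ℝ}

/-- The operator `ρ² Δf - (n+k-2) y·∇_y f`. On functions that are homogeneous of degree zero it is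
the Laplacian of the metric `|y|⁻² g` on the sphere, extended with homogeneity zero. -/
def hypLap (f : Ambient n k → ℝ) (q : Ambient n k) : ℝ :=
  rho q ^ 2 * lap f q - ((n : ℝ) + k - 2) * fderiv ℝ f q (ambientMk 0 (yPart q))

/-- The `i`-th coordinate vector of `ℝ^{n+1}`. -/
def xVec (i : Fin (n + 1)) : Ambient n k := EuclideanSpace.single (Sum.inl i) 1

/-- The `j`-th coordinate vector of `ℝ^k`. -/
def yVec (j : Fin k) : Ambient n k := EuclideanSpace.single (Sum.inr j) 1

lemma xPart_xVec (i : Fin (n + 1)) : xPart (xVec i : Ambient n k) = EuclideanSpace.single i 1 := by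
  ext l; simp [xPart, xVec]

lemma yPart_xVec (i : Fin (n + 1)) : yPart (xVec i : Ambient n k) = 0 := by
  ext l; simp [yPart, xVec]

lemma xPart_yVec (j : Fin k) : xPart (yVec j : Ambient n k) = 0 := by
  ext l; simp [xPart, yVec]

lemma yPart_yVec (j : Fin k) : yPart (yVec j : Ambient n k) = EuclideanSpace.single j 1 := by
  ext l; simp [yPart, yVec]

/-- The curve `s ↦ (sinh s, 0, …, 0; 1 in the j-th place)`. Its radial projection to the sphere is a
unit speed geodesic of `|y|⁻² g` in the hyperbolic factor, and meets every orbit of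
`O(n+1) × O(k)` off the equator. -/
def crossCurve (n : ℕ) {k : ℕ} (j : Fin k) (s : ℝ) : Ambient n k :=
  Real.sinh s • xVec 0 + yVec j

lemma yPart_crossCurve (j : Fin k) (s : ℝ) :
    yPart (crossCurve n j s) = EuclideanSpace.single j 1 := by
  rw [crossCurve, yPart_add, yPart_smul, yPart_xVec, yPart_yVec, smul_zero, zero_add]

lemma yPart_crossCurve_ne (j : Fin k) (s : ℝ) : yPart (crossCurve n j s) ≠ 0 := by
  rw [yPart_crossCurve, ← norm_ne_zero_iff]; simp

lemma rho_crossCurve (j : Fin k) (s : ℝ) : rho (crossCurve n j s) = 1 := by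
  rw [rho, yPart_crossCurve]; simp

lemma hasDerivAt_crossCurve (j : Fin k) (s : ℝ) :
    HasDerivAt (crossCurve n j) (Real.cosh s • xVec 0) s :=
  ((Real.hasDerivAt_sinh s).smul_const _).add_const _

lemma lap_actInv (hf : ContDiffOn ℝ 2 f {q | yPart q ≠ 0}) {q : Ambient n k} (hq : yPart q ≠ 0)
    (g : Rot n k) :
    lap f (actInv g q) = ∑ i, fderiv ℝ (fderiv ℝ f) (actInv g q)
      (actInv g (EuclideanSpace.single i 1)) (actInv g (EuclideanSpace.single i 1)) := by
  have hc : ContDiffAt ℝ 2 f (actInv g q) :=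
    hf.contDiffAt (isOpen_yPart_ne.mem_nhds (yPart_actInv_ne _ hq))
  rw [lap_eq_sum_orthonormalBasis hc
    ((EuclideanSpace.basisFun _ ℝ).map ((actInv g).toLinearIsometryEquiv rfl))]
  refine Finset.sum_congr rfl fun i _ => ?_
  rw [fderiv_fderiv_apply hc]
  simp

lemma integral_lap_actInv (hf : ContDiffOn ℝ 2 f {q | yPart q ≠ 0}) {q : Ambient n k}
    (hq : yPart q ≠ 0) :
    ∫ g, lap f (actInv g q) ∂rotMeasure n k = ∑ i, avgHess f q (EuclideanSpace.single i 1) := by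
  simp only [lap_actInv hf hq]
  exact integral_finsetSum _ fun i _ => integrable_of_continuous (continuous_hess_act hf hq _ _)

lemma continuous_lap_actInv (hf : ContDiffOn ℝ 2 f {q | yPart q ≠ 0}) {q : Ambient n k}
    (hq : yPart q ≠ 0) : Continuous fun g : Rot n k => lap f (actInv g q) := by
  simp only [lap_actInv hf hq]
  exact continuous_finsetSum _ fun i _ => continuous_hess_act hf hq _ _

lemma ambientMk_yPart_actInv (g : Rot n k) (q : Ambient n k) :
    ambientMk 0 (yPart (actInv g q)) = actInv g (ambientMk 0 (yPart q)) := by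
  rw [actInv_def]
  refine ambient_ext ?_ ?_
  · rw [xPart_act, xPart_ambientMk, xPart_ambientMk, map_zero]
  · rw [yPart_act, yPart_ambientMk, yPart_act, yPart_ambientMk]

lemma ambientMk_yPart_crossCurve (j : Fin k) (s : ℝ) :
    ambientMk 0 (yPart (crossCurve n j s)) = (yVec j : Ambient n k) :=
  ambient_ext (by rw [xPart_ambientMk, xPart_yVec])
    (by rw [yPart_ambientMk, yPart_crossCurve, yPart_yVec])

lemma hypLap_actInv_crossCurve (g : Rot n k) (j : Fin k) (s : ℝ) :
    hypLap f (actInv g (crossCurve n j s)) = lap f (actInv g (crossCurve n j s)) -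
      ((n : ℝ) + k - 2) * fderiv ℝ f (actInv g (crossCurve n j s)) (actInv g (yVec j)) := by
  rw [hypLap, ambientMk_yPart_actInv, rho_actInv, rho_crossCurve, ambientMk_yPart_crossCurve]
  ring

lemma integral_hypLap_actInv (hf : ContDiffOn ℝ 2 f {q | yPart q ≠ 0}) (j : Fin k) (s : ℝ) :
    ∫ g, hypLap f (actInv g (crossCurve n j s)) ∂rotMeasure n k =
      (∑ i, avgHess f (crossCurve n j s) (EuclideanSpace.single i 1)) -
        ((n : ℝ) + k - 2) * avgFDeriv f (crossCurve n j s) (yVec j) := by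
  have hq := yPart_crossCurve_ne (n := n) j s
  simp only [hypLap_actInv_crossCurve]
  rw [integral_sub (integrable_of_continuous (continuous_lap_actInv hf hq))
    ((integrable_of_continuous (continuous_fderiv_act hf hq _)).const_mul _),
    integral_lap_actInv hf hq, integral_const_mul, avgFDeriv]

lemma avgFDeriv_self (hf : ContDiffOn ℝ 2 f {q | yPart q ≠ 0})
    (hom : ∀ t : ℝ, 0 < t → ∀ q, f (t • q) = f q) {q : Ambient n k} (hq : yPart q ≠ 0) :
    avgFDeriv f q q = 0 := by
  have h1 : HasDerivAt (fun t : ℝ => orbitAverage f (Real.exp t • q))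
      (avgFDeriv f (Real.exp 0 • q) (Real.exp 0 • q)) 0 := by
    refine hasDerivAt_orbitAverage hf isOpen_univ (c' := fun t => Real.exp t • q)
      (fun t => (Real.hasDerivAt_exp t).smul_const q)
      (Real.continuous_exp.smul continuous_const) (fun t _ => ?_) (mem_univ _)
    rw [yPart_smul]
    exact smul_ne_zero (Real.exp_pos t).ne' hq
  have h2 : (fun t : ℝ => orbitAverage f (Real.exp t • q)) = fun _ => orbitAverage f q := by
    funext t
    simp only [orbitAverage, map_smul, hom _ (Real.exp_pos t)]
  rw [h2, Real.exp_zero, one_smul] at h1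
  exact h1.unique (hasDerivAt_const _ _)

lemma orbitAverage_smul (hom : ∀ t : ℝ, 0 < t → ∀ q, f (t • q) = f q) {t : ℝ} (ht : 0 < t)
    (q : Ambient n k) : orbitAverage f (t • q) = orbitAverage f q := by
  simp only [orbitAverage, map_smul, hom _ ht]

/-- Invariance under dilations expresses the averaged derivative along `y` through the one along
`x`. -/
lemma avgFDeriv_yVec (hf : ContDiffOn ℝ 2 f {q | yPart q ≠ 0})
    (hom : ∀ t : ℝ, 0 < t → ∀ q, f (t • q) = f q) (j : Fin k) (s : ℝ) :
    avgFDeriv f (crossCurve n j s) (yVec j) =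
      -(Real.sinh s * avgFDeriv f (crossCurve n j s) (xVec 0)) := by
  have hq := yPart_crossCurve_ne (n := n) j s
  have h1 := avgFDeriv_self hf hom hq
  have h2 : avgFDeriv f (crossCurve n j s) (crossCurve n j s) =
      avgFDeriv f (crossCurve n j s) (Real.sinh s • xVec 0 + yVec j) := rfl
  rw [h2, avgFDeriv_add hf hq, avgFDeriv_smul] at h1
  linarith

/-- The rotation of `v` towards `w`, and its first two derivatives. -/
lemma hasDerivAt_rotation (v w z : Ambient n k) (t : ℝ) :
    HasDerivAt (fun t => Real.cos t • v + Real.sin t • w + z)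
      (-Real.sin t • v + Real.cos t • w) t ∧
    HasDerivAt (fun t => -Real.sin t • v + Real.cos t • w)
      (-Real.cos t • v + -Real.sin t • w) t :=
  ⟨(((Real.hasDerivAt_cos t).smul_const v).add ((Real.hasDerivAt_sin t).smul_const w)).add_const z,
    ((Real.hasDerivAt_sin t).fun_neg.smul_const v).add ((Real.hasDerivAt_cos t).smul_const w)⟩

/-- If the orbit average is constant along the rotation of `v` towards `w`, its averaged second
derivative in the direction `w` is the averaged first derivative in the direction `v`. -/
lemma avgHess_of_rotation (hf : ContDiffOn ℝ 2 f {q | yPart q ≠ 0}) {v w z : Ambient n k}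
    (hy : ∀ t : ℝ, yPart (Real.cos t • v + Real.sin t • w + z) ≠ 0)
    (hconst : ∀ t : ℝ, orbitAverage f (Real.cos t • v + Real.sin t • w + z) =
      orbitAverage f (v + z)) :
    avgHess f (v + z) w = avgFDeriv f (v + z) v := by
  have hy0 : yPart (v + z) ≠ 0 := by simpa using hy 0
  have h := avgHess_add_avgFDeriv_congr hf isOpen_univ (b := fun _ => v + z) (b' := fun _ => 0)
    (b'' := fun _ => 0) (fun t => (hasDerivAt_rotation v w z t).1)
    (fun t => (hasDerivAt_rotation v w z t).2) (by fun_prop) (fun t _ => hy t)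
    (fun t => hasDerivAt_const t _) (fun t => hasDerivAt_const t _) continuous_const
    (fun _ _ => hy0) (fun t _ => hconst t) (mem_univ 0)
  simp only [Real.cos_zero, Real.sin_zero, one_smul, zero_smul, add_zero, neg_zero, zero_add] at h
  have h1 : avgHess f (v + z) 0 = 0 := by
    have := avgHess_smul (f := f) (v + z) 0 0
    simpa using this
  have h2 : avgFDeriv f (v + z) 0 = 0 := by
    have := avgFDeriv_smul (f := f) (v + z) 0 0
    simpa using this
  have h3 : avgFDeriv f (v + z) (-1 • v) = -avgFDeriv f (v + z) v := by
    have := avgFDeriv_smul (f := f) (v + z) v (-1)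
    simpa using this
  rw [h1, h2] at h
  simp only [neg_smul, one_smul] at h h3
  rw [h3] at h
  linarith

lemma xPart_crossCurve (j : Fin k) (s : ℝ) :
    xPart (crossCurve n j s) = Real.sinh s • EuclideanSpace.single 0 1 := by
  rw [crossCurve, xPart_add, xPart_smul, xPart_xVec, xPart_yVec, add_zero]

lemma norm_cos_add_sin {m : ℕ} {i l : Fin m} (hil : i ≠ l) (t : ℝ) :
    ‖Real.cos t • (EuclideanSpace.single i 1 : EuclideanSpace ℝ (Fin m)) +
      Real.sin t • EuclideanSpace.single l 1‖ = 1 := by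
  have h : ‖Real.cos t • (EuclideanSpace.single i 1 : EuclideanSpace ℝ (Fin m)) +
      Real.sin t • EuclideanSpace.single l 1‖ ^ 2 = 1 := by
    rw [norm_add_sq_real, norm_smul, norm_smul, inner_smul_left, inner_smul_right]
    simp [EuclideanSpace.inner_single_left, hil]
  have h0 := norm_nonneg (Real.cos t • (EuclideanSpace.single i 1 : EuclideanSpace ℝ (Fin m)) +
      Real.sin t • EuclideanSpace.single l 1)
  nlinarith

/-- Invariance of the orbit average under rotations of `ℝ^{n+1}`. -/
lemma avgHess_xVec (hf : ContDiffOn ℝ 2 f {q | yPart q ≠ 0}) (j : Fin k) {s : ℝ}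
    (hs : Real.sinh s ≠ 0) {i : Fin (n + 1)} (hi : 0 ≠ i) :
    avgHess f (crossCurve n j s) (xVec i) =
      avgFDeriv f (crossCurve n j s) (xVec 0) / Real.sinh s := by
  have hy : ∀ t : ℝ, yPart (Real.cos t • (Real.sinh s • xVec 0 : Ambient n k) +
      Real.sin t • (Real.sinh s • xVec i) + yVec j) = EuclideanSpace.single j 1 := by
    intro t
    simp only [yPart_add, yPart_smul, yPart_xVec, yPart_yVec, smul_zero, zero_add]
  have h := avgHess_of_rotation (v := Real.sinh s • xVec 0) (w := Real.sinh s • xVec i)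
    (z := yVec j) hf (fun t => by rw [hy, ← norm_ne_zero_iff]; simp) (fun t => ?_)
  · change avgHess f (crossCurve n j s) _ = avgFDeriv f (crossCurve n j s) _ at h
    rw [avgHess_smul, avgFDeriv_smul] at h
    field_simp
    have := mul_left_cancel₀ hs (show Real.sinh s * (Real.sinh s *
      avgHess f (crossCurve n j s) (xVec i)) = Real.sinh s *
        avgFDeriv f (crossCurve n j s) (xVec 0) by linarith)
    linarith
  · refine orbitAverage_eq ?_ ?_
    · simp only [xPart_add, xPart_smul, xPart_xVec, xPart_yVec, add_zero]
      rw [smul_comm (Real.cos t), smul_comm (Real.sin t), ← smul_add, norm_smul, norm_smul,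
        norm_cos_add_sin hi]
      simp
    · rw [hy]
      simp only [yPart_add, yPart_smul, yPart_xVec, yPart_yVec, smul_zero, zero_add]

/-- Invariance of the orbit average under rotations of `ℝ^k`. -/
lemma avgHess_yVec (hf : ContDiffOn ℝ 2 f {q | yPart q ≠ 0})
    {j l : Fin k} (hjl : j ≠ l) (s : ℝ) :
    avgHess f (crossCurve n j s) (yVec l) = avgFDeriv f (crossCurve n j s) (yVec j) := by
  have hc : crossCurve n j s = yVec j + Real.sinh s • xVec 0 := add_comm _ _
  have hy : ∀ t : ℝ, yPart (Real.cos t • (yVec j : Ambient n k) +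
      Real.sin t • yVec l + Real.sinh s • xVec 0) =
        Real.cos t • EuclideanSpace.single j 1 + Real.sin t • EuclideanSpace.single l 1 := by
    intro t
    simp only [yPart_add, yPart_smul, yPart_xVec, yPart_yVec, smul_zero, add_zero]
  rw [hc]
  refine avgHess_of_rotation hf (fun t => ?_) (fun t => orbitAverage_eq ?_ ?_)
  · rw [hy, ← norm_ne_zero_iff, norm_cos_add_sin hjl]; simp
  · simp only [xPart_add, xPart_smul, xPart_xVec, xPart_yVec, smul_zero, zero_add]
  · rw [hy, norm_cos_add_sin hjl]
    simp only [yPart_add, yPart_smul, yPart_xVec, yPart_yVec, smul_zero, add_zero]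
    simp

/-- Invariance of the orbit average under dilations, to second order: moving `y` by a factor `e^t`
has the same effect as moving `x` by `e^{-t}`. -/
lemma avgHess_yVec_self (hf : ContDiffOn ℝ 2 f {q | yPart q ≠ 0})
    (hom : ∀ t : ℝ, 0 < t → ∀ q, f (t • q) = f q) (j : Fin k) (s : ℝ) :
    avgHess f (crossCurve n j s) (yVec j) =
      Real.sinh s ^ 2 * avgHess f (crossCurve n j s) (xVec 0) +
        2 * (Real.sinh s * avgFDeriv f (crossCurve n j s) (xVec 0)) := by
  have hy1 : ∀ t : ℝ, yPart (Real.exp t • (yVec j : Ambient n k) + Real.sinh s • xVec 0) ≠ 0 := by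
    intro t
    simp only [yPart_add, yPart_smul, yPart_xVec, yPart_yVec, smul_zero, add_zero]
    rw [← norm_ne_zero_iff, norm_smul]; simp [(Real.exp_pos t).ne']
  have hy2 : ∀ t : ℝ,
      yPart (Real.exp (-t) • (Real.sinh s • xVec 0 : Ambient n k) + yVec j) ≠ 0 := by
    intro t
    simp only [yPart_add, yPart_smul, yPart_xVec, yPart_yVec, smul_zero, zero_add]
    rw [← norm_ne_zero_iff]; simp
  have hexp : ∀ t : ℝ, HasDerivAt (fun t => Real.exp (-t)) (-Real.exp (-t)) t := by
    intro t
    have h := (hasDerivAt_neg t).exp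
    rwa [mul_neg_one] at h
  have hexp' : ∀ t : ℝ, HasDerivAt (fun t => -Real.exp (-t)) (Real.exp (-t)) t := by
    intro t
    simpa using (hexp t).fun_neg
  have h := avgHess_add_avgFDeriv_congr hf isOpen_univ
    (c := fun t => Real.exp t • (yVec j : Ambient n k) + Real.sinh s • xVec 0)
    (c' := fun t => Real.exp t • (yVec j : Ambient n k))
    (c'' := fun t => Real.exp t • (yVec j : Ambient n k))
    (b := fun t => Real.exp (-t) • (Real.sinh s • xVec 0 : Ambient n k) + yVec j)
    (b' := fun t => -Real.exp (-t) • (Real.sinh s • xVec 0 : Ambient n k))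
    (b'' := fun t => Real.exp (-t) • (Real.sinh s • xVec 0 : Ambient n k))
    (fun t => ((Real.hasDerivAt_exp t).smul_const _).add_const _)
    (fun t => (Real.hasDerivAt_exp t).smul_const _) (by fun_prop) (fun t _ => hy1 t)
    (fun t => ((hexp t).smul_const _).add_const _)
    (fun t => (hexp' t).smul_const _) (by fun_prop) (fun t _ => hy2 t) (fun t _ => ?_) (mem_univ 0)
  · have hc : yVec j + Real.sinh s • xVec 0 = crossCurve n j s := add_comm _ _
    have hc' : Real.sinh s • xVec 0 + yVec j = crossCurve n j s := rfl
    simp only [Real.exp_zero, one_smul, neg_zero, hc, hc'] at h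
    rw [neg_smul, one_smul, ← neg_smul, avgHess_smul, avgFDeriv_smul,
      avgFDeriv_yVec hf hom] at h
    linarith
  · have h1 : Real.exp t • (yVec j : Ambient n k) + Real.sinh s • xVec 0 =
        Real.exp t • (Real.exp (-t) • (Real.sinh s • xVec 0 : Ambient n k) + yVec j) := by
      rw [smul_add, smul_smul, ← Real.exp_add, add_neg_cancel, Real.exp_zero, one_smul, add_comm]
    rw [h1, orbitAverage_smul hom (Real.exp_pos t)]

lemma sum_avgHess (hf : ContDiffOn ℝ 2 f {q | yPart q ≠ 0})
    (hom : ∀ t : ℝ, 0 < t → ∀ q, f (t • q) = f q) (j : Fin k) {s : ℝ} (hs : Real.sinh s ≠ 0) :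
    ∑ i, avgHess f (crossCurve n j s) (EuclideanSpace.single i 1) =
      Real.cosh s ^ 2 * avgHess f (crossCurve n j s) (xVec 0) +
      (n / Real.sinh s + (3 - k) * Real.sinh s) * avgFDeriv f (crossCurve n j s) (xVec 0) := by
  rw [Fintype.sum_sum_type, Fin.sum_univ_succ, ← Finset.add_sum_erase _ _ (Finset.mem_univ j)]
  have h1 : ∀ i : Fin n, avgHess f (crossCurve n j s) (EuclideanSpace.single (Sum.inl i.succ) 1) =
      avgFDeriv f (crossCurve n j s) (xVec 0) / Real.sinh s := fun i =>
    avgHess_xVec hf j hs (Fin.succ_ne_zero i).symm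
  have h2 : ∀ l ∈ Finset.univ.erase j,
      avgHess f (crossCurve n j s) (EuclideanSpace.single (Sum.inr l) 1) =
      -(Real.sinh s * avgFDeriv f (crossCurve n j s) (xVec 0)) := fun l hl =>
    (avgHess_yVec hf (Finset.ne_of_mem_erase hl).symm s).trans (avgFDeriv_yVec hf hom j s)
  have h3 := avgHess_yVec_self hf hom j s
  have hk : 1 ≤ k := j.pos
  rw [Finset.sum_congr rfl h2, Finset.sum_congr rfl fun i _ => h1 i]
  simp only [Finset.sum_const, Finset.card_erase_of_mem (Finset.mem_univ j), Finset.card_univ,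
    Fintype.card_fin, nsmul_eq_mul]
  change avgHess f (crossCurve n j s) (xVec 0) + _ + (avgHess f (crossCurve n j s) (yVec j) + _) = _
  rw [h3, Real.cosh_sq]
  push_cast [hk]
  ring

/-- The orbit average along the transversal curve satisfies `F'' + n coth(s) F' = avg (L f)`. -/
theorem orbitAverage_equation (hf : ContDiffOn ℝ 2 f {q | yPart q ≠ 0})
    (hom : ∀ t : ℝ, 0 < t → ∀ q, f (t • q) = f q) (j : Fin k) :
    ∃ F' F'' : ℝ → ℝ, (∀ s, HasDerivAt (fun s => orbitAverage f (crossCurve n j s)) (F' s) s) ∧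
      (∀ s, HasDerivAt F' (F'' s) s) ∧
      ∀ s, 0 < s → F'' s + n * (Real.cosh s / Real.sinh s) * F' s =
        ∫ g, hypLap f (actInv g (crossCurve n j s)) ∂rotMeasure n k := by
  refine ⟨fun s => avgFDeriv f (crossCurve n j s) (Real.cosh s • xVec 0),
    fun s => avgHess f (crossCurve n j s) (Real.cosh s • xVec 0) +
      avgFDeriv f (crossCurve n j s) (Real.sinh s • xVec 0), fun s => ?_, fun s => ?_,
      fun s hs => ?_⟩
  · exact hasDerivAt_orbitAverage hf isOpen_univ (c' := fun s => Real.cosh s • xVec 0)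
      (hasDerivAt_crossCurve j) (by fun_prop) (fun t _ => yPart_crossCurve_ne j t) (mem_univ s)
  · exact hasDerivAt_avgFDeriv hf isOpen_univ (c' := fun s => Real.cosh s • xVec 0)
      (c'' := fun s => Real.sinh s • xVec 0)
      (hasDerivAt_crossCurve j) (fun s => (Real.hasDerivAt_cosh s).smul_const _) (by fun_prop)
      (fun t _ => yPart_crossCurve_ne j t) (mem_univ s)
  · have hs' : Real.sinh s ≠ 0 := (Real.sinh_pos_iff.mpr hs).ne'
    rw [integral_hypLap_actInv hf, sum_avgHess hf hom j hs', avgFDeriv_yVec hf hom]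
    simp only [avgFDeriv_smul, avgHess_smul]
    field_simp
    rw [Real.cosh_sq]
    ring

end RadialEquation

/-! ### The differential inequality for the ratio `|y| / u` -/

section RatioInequality

open Set

variable {n k : ℕ}

lemma fderiv_ambientMk_yPart (f : Ambient n k → ℝ) {q : Ambient n k} (hq : yPart q ≠ 0) :
    fderiv ℝ f q (ambientMk 0 (yPart q)) = rho q * gdot rho f q := by
  have hd := (contDiffAt_rho (m := 1) hq).differentiableAt (by simp)
  have h1 : gdot (fun z : Ambient n k => rho z * rho z) f q = 2 * (rho q * gdot rho f q) := by
    rw [gdot_mul_left hd hd]; ring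
  have h2 : gdot (fun z : Ambient n k => rho z * rho z) f q =
      2 * fderiv ℝ f q (ambientMk 0 (yPart q)) := by
    conv_rhs => rw [← (EuclideanSpace.basisFun _ ℝ).sum_repr (ambientMk 0 (yPart q) : Ambient n k)]
    unfold gdot
    rw [Fintype.sum_sum_type, map_sum, Fintype.sum_sum_type]
    simp only [pd_inl_rho_sq, pd_inr_rho_sq, zero_mul, Finset.sum_const_zero, zero_add]
    have h3 : ∀ i : Fin (n + 1), (ambientMk 0 (yPart q) : Ambient n k) (Sum.inl i) = 0 :=
      fun i => rfl
    have h4 : ∀ j : Fin k, (ambientMk 0 (yPart q) : Ambient n k) (Sum.inr j) = q (Sum.inr j) :=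
      fun i => rfl
    simp only [EuclideanSpace.basisFun_repr, EuclideanSpace.basisFun_apply, h3, h4, zero_smul,
      map_zero, Finset.sum_const_zero, zero_add, map_smul, smul_eq_mul, Finset.mul_sum, pd]
    exact Finset.sum_congr rfl fun _ _ => by ring
  linarith

/-- The fourth root of `|y| / u`, extended to the ambient space by homogeneity of degree zero. -/
def rootRatio (u : RoundSphere n k → ℝ) (q : Ambient n k) : ℝ :=
  Real.exp (Real.log (rho q / homExt u q) / 4)

variable {u : RoundSphere n k → ℝ}

lemma rootRatio_smul {t : ℝ} (ht : 0 < t) (q : Ambient n k) :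
    rootRatio u (t • q) = rootRatio u q := by
  rw [rootRatio, rho_smul ht, homExt_smul u ht, mul_div_mul_left _ _ ht.ne', rootRatio]

lemma rootRatio_pos (q : Ambient n k) : 0 < rootRatio u q := Real.exp_pos _

lemma rootRatio_pow (hu : IsSingularYamabe u) {q : Ambient n k} (hq : yPart q ≠ 0) :
    rootRatio u q ^ 4 = rho q / homExt u q := by
  have h := div_pos (rho_pos hq) (hu.homExt_pos hq)
  rw [rootRatio, ← Real.exp_nat_mul]
  rw [show ((4 : ℕ) : ℝ) * (Real.log (rho q / homExt u q) / 4) = Real.log (rho q / homExt u q) by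
    push_cast; ring, Real.exp_log h]

lemma rootRatio_le_one (hn : 1 ≤ n) (hk : 1 ≤ k) (hkn : k < n + 2) (hu : IsSingularYamabe u)
    {q : Ambient n k} (hq : yPart q ≠ 0) : rootRatio u q ≤ 1 := by
  have hq0 := ne_zero_of_yPart hq
  have hU := hu.homExt_pos hq
  have h1 : rho q ≤ homExt u q := by
    have ht : 0 < ‖q‖⁻¹ := inv_pos.mpr (norm_pos_iff.mpr hq0)
    have hp : sphereProj q hq0 ∉ equator n k := by
      change yPart (‖q‖⁻¹ • q) ≠ 0
      rw [yPart_smul]; exact smul_ne_zero ht.ne' hq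
    have h2 := hu.equatorialFactor_le hn hk hkn hp
    rw [homExt_eq u hq0]
    have h3 : rho ((sphereProj q hq0 : RoundSphere n k) : Ambient n k) = ‖q‖⁻¹ * rho q :=
      rho_smul ht q
    rw [h3] at h2
    have h4 := norm_pos_iff.mpr hq0
    calc rho q = ‖q‖ * (‖q‖⁻¹ * rho q) := by field_simp
      _ ≤ _ := by gcongr
  rw [rootRatio, Real.exp_le_one_iff]
  have := Real.log_nonpos (div_nonneg (rho_pos hq).le hU.le) ((div_le_one hU).mpr h1)
  linarith

lemma contDiffOn_rootRatio (hu : IsSingularYamabe u) :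
    ContDiffOn ℝ 2 (rootRatio u) {q | yPart q ≠ 0} := by
  intro q hq
  have h1 : ContDiffAt ℝ 2 (homExt u) q := (hu.contDiffAt hq).of_le (by norm_cast)
  have hU := hu.homExt_pos hq
  refine ContDiffAt.contDiffWithinAt ?_
  exact (((((contDiffAt_rho hq).div h1 hU.ne').log
    (div_pos (rho_pos hq) hU).ne').div_const 4).exp :)

lemma lap_log_homExt (hn : 1 ≤ n) (hk : 1 ≤ k) (hu : IsSingularYamabe u) {q : Ambient n k}
    (hq : yPart q ≠ 0) :
    lap (fun z => Real.log (homExt u z)) q =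
      ((n : ℝ) + k - 2) / 2 *
        gdot (fun z => Real.log (homExt u z)) (fun z => Real.log (homExt u z)) q -
      ((n : ℝ) + 2 - k) / 2 * (homExt u q ^ 2)⁻¹ := by
  have h0 := hu.homExt_pos hq
  have hU : ContDiffAt ℝ 2 (homExt u) q := (hu.contDiffAt hq).of_le (by norm_cast)
  have hd := hU.differentiableAt (by simp)
  have hE := hu.equation hn hk hq
  rw [lap_comp (φ := Real.log) (φ' := fun s => s⁻¹) (φ'' := -(homExt u q ^ 2)⁻¹) (f := homExt u) ?_
    (hasDerivAt_inv h0.ne') hU, gdot_comp_left (Real.hasDerivAt_log h0.ne') hd,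
    gdot_comm (f := homExt u) (h := fun z => Real.log (homExt u z)),
    gdot_comp_left (Real.hasDerivAt_log h0.ne') hd]
  · field_simp
    linarith
  · filter_upwards [eventually_ne_nhds h0.ne'] with s hs using Real.hasDerivAt_log hs

/-- The equation for the logarithm of `|y| / u`. -/
lemma hypLap_log_ratio (hn : 1 ≤ n) (hk : 1 ≤ k) (hu : IsSingularYamabe u) {q : Ambient n k}
    (hq : yPart q ≠ 0) {w : Ambient n k → ℝ}
    (hw : w = fun z => Real.log (rho z) - Real.log (homExt u z)) :
    rho q ^ 2 * lap w q - ((n : ℝ) + k - 2) * (rho q * gdot rho w q) =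
      -(((n : ℝ) + 2 - k) / 2 * (1 - (rho q / homExt u q) ^ 2)) -
        ((n : ℝ) + k - 2) / 2 * (rho q ^ 2 * gdot w w q) := by
  have h0 := hu.homExt_pos hq
  have hr := rho_pos hq
  have hU : ContDiffAt ℝ 2 (homExt u) q := (hu.contDiffAt hq).of_le (by norm_cast)
  have hL : ContDiffAt ℝ 2 (fun z => Real.log (homExt u z)) q := hU.log h0.ne'
  have hR : ContDiffAt ℝ 2 (fun z : Ambient n k => Real.log (rho z)) q := contDiffAt_log_rho hq
  have hLd := hL.differentiableAt (by simp)
  have hRd := hR.differentiableAt (by simp)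
  set lam : Ambient n k → ℝ := fun z => Real.log (homExt u z) with hlam
  have h1 : lap w q = ((k : ℝ) - 2) / rho q ^ 2 - lap lam q := by
    rw [hw, lap_sub hR hL, lap_log_rho hq]
  have hrr := gdot_rho_rho hq
  have h2 : gdot rho w q = (rho q)⁻¹ - gdot rho lam q := by
    rw [gdot_comm, hw, gdot_sub_left hRd hLd, gdot_log_rho_left hq, hrr, gdot_comm (f := lam)]
    ring
  have h3 : gdot w w q = (rho q)⁻¹ ^ 2 - 2 * (rho q)⁻¹ * gdot rho lam q + gdot lam lam q := by
    have h4 : ∀ e : Ambient n k → ℝ, gdot w e q = (rho q)⁻¹ * gdot rho e q - gdot lam e q := by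
      intro e
      rw [hw, gdot_sub_left hRd hLd, gdot_log_rho_left hq]
    rw [h4, h2, gdot_comm (f := lam), h4]
    ring
  have h5 := lap_log_homExt hn hk hu hq
  rw [← hlam] at h5
  rw [h1, h2, h3, h5]
  field_simp
  ring

/-- The fourth root `φ` of `|y| / u` satisfies
`-L φ ≥ φ (1 - φ⁸) / 8 + ρ² |∇φ|²` for the operator `L = ρ² Δ - (n+k-2) y·∇_y`. For a power
`(|y| / u)^a` the gradient term in `-L` has the sign of `(n + k - 2) / 2 - a`, so that `a = 1 / 4`
leaves a positive multiple of `|∇φ|²` when `n + k ≥ 3`. -/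
theorem le_neg_hypLap_rootRatio (hn : 1 ≤ n) (hk : 2 ≤ k) (hkn : k < n + 2)
    (hu : IsSingularYamabe u) {q : Ambient n k} (hq : yPart q ≠ 0) :
    rootRatio u q * (1 - rootRatio u q ^ 8) / 8 +
      rho q ^ 2 * gdot (rootRatio u) (rootRatio u) q ≤ -hypLap (rootRatio u) q := by
  have h0 := hu.homExt_pos hq
  have hr := rho_pos hq
  have hU : ContDiffAt ℝ 2 (homExt u) q := (hu.contDiffAt hq).of_le (by norm_cast)
  set w : Ambient n k → ℝ := fun z => Real.log (rho z) - Real.log (homExt u z) with hw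
  have hwc : ContDiffAt ℝ 2 w q := (contDiffAt_log_rho hq).sub (hU.log h0.ne')
  have hwd := hwc.differentiableAt (by simp)
  have hE := hypLap_log_ratio hn (by omega) hu hq hw
  have hev : rootRatio u =ᶠ[𝓝 q] fun z => Real.exp (w z / 4) := by
    filter_upwards [isOpen_yPart_ne.mem_nhds hq] with z hz
    rw [rootRatio, Real.log_div (rho_pos hz).ne' (hu.homExt_pos hz).ne']
  have hexp : ∀ s : ℝ, HasDerivAt (fun s => Real.exp (s / 4)) (Real.exp (s / 4) / 4) s := by
    intro s
    simpa [div_eq_mul_inv] using ((hasDerivAt_id s).div_const 4).exp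
  have hφ : rootRatio u q = Real.exp (w q / 4) := hev.self_of_nhds
  have hlap : lap (rootRatio u) q =
      rootRatio u q / 4 / 4 * gdot w w q + rootRatio u q / 4 * lap w q := by
    rw [lap_congr hev, lap_comp (φ := fun s => Real.exp (s / 4))
      (Filter.Eventually.of_forall hexp) ((hexp (w q)).div_const 4) hwc, hφ]
  have hg : ∀ e : Ambient n k → ℝ, gdot (rootRatio u) e q = rootRatio u q / 4 * gdot w e q := by
    intro e
    rw [gdot_congr hev Filter.EventuallyEq.rfl, gdot_comp_left (hexp (w q)) hwd, hφ]
  have hφ1 := rootRatio_le_one hn (by omega) hkn hu hq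
  have hφ0 := rootRatio_pos (u := u) q
  have hφ8 : rootRatio u q ^ 8 = (rho q / homExt u q) ^ 2 := by
    rw [← rootRatio_pow hu hq]; ring
  have hgg : gdot (rootRatio u) (rootRatio u) q = (rootRatio u q / 4) ^ 2 * gdot w w q := by
    rw [hg, gdot_comm, hg]; ring
  rw [hypLap, fderiv_ambientMk_yPart _ hq, hlap, hgg, gdot_comm (f := rho), hg, hφ8]
  set φ := rootRatio u q with hφdef
  have hkn' : (k : ℝ) + 1 ≤ n + 2 := by exact_mod_cast hkn
  have hN : (3 : ℝ) ≤ (n : ℝ) + k := by exact_mod_cast (by omega : 3 ≤ n + k)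
  have hW : (rho q / homExt u q) ^ 2 ≤ 1 := by
    rw [← hφ8]; exact pow_le_one₀ hφ0.le hφ1
  have hG : 0 ≤ rho q ^ 2 * gdot w w q := mul_nonneg (sq_nonneg _) gdot_self_nonneg
  set G := rho q ^ 2 * gdot w w q with hGdef
  set W2 := (rho q / homExt u q) ^ 2 with hW2
  have e1 : -(rho q ^ 2 * (φ / 4 / 4 * gdot w w q + φ / 4 * lap w q) -
      ((n : ℝ) + k - 2) * (rho q * (φ / 4 * gdot rho w q))) =
      φ / 4 * (((n : ℝ) + 2 - k) / 2 * (1 - W2) + ((n : ℝ) + k - 2) / 2 * G) - φ / 16 * G := by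
    linear_combination (-φ / 4) * hE
  have e2 : rho q ^ 2 * ((φ / 4) ^ 2 * gdot w w q) = φ ^ 2 / 16 * G := by rw [hGdef]; ring
  rw [gdot_comm (f := w) (h := rho), e1, e2]
  have h6 : 0 ≤ φ * (1 - W2) * ((n : ℝ) + 2 - k - 1) :=
    mul_nonneg (mul_nonneg hφ0.le (by linarith)) (by linarith)
  have h7 : 0 ≤ φ * G * ((n : ℝ) + k - 3) := mul_nonneg (mul_nonneg hφ0.le hG) (by linarith)
  have h8 : 0 ≤ φ * G * (1 - φ) := mul_nonneg (mul_nonneg hφ0.le hG) (by linarith)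
  linarith

end RatioInequality

/-! ### Two lemmas on functions of one real variable -/

section RealVariable

open Set MeasureTheory Filter

/-- A bounded radial supersolution `F'' + n coth(s) F' ≤ -H ≤ 0` is decreasing, and `H` is
integrable at infinity. -/
lemma radial_supersolution {n : ℕ} (hn : 1 ≤ n) {F F' F'' H : ℝ → ℝ}
    (hF : ∀ s, HasDerivAt F (F' s) s) (hF' : ∀ s, HasDerivAt F' (F'' s) s) (hHc : Continuous H)
    (hH0 : ∀ s, 0 ≤ H s)
    (hineq : ∀ s, 0 < s → F'' s + n * (Real.cosh s / Real.sinh s) * F' s ≤ -H s)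
    (hF0 : ∀ s, 0 ≤ F s) (hF1 : ∀ s, F s ≤ 1) :
    AntitoneOn F (Ici 0) ∧ IntegrableOn H (Ioi 1) := by
  have hFc : Continuous F := continuous_iff_continuousAt.mpr fun s => (hF s).continuousAt
  have hF'c : Continuous F' := continuous_iff_continuousAt.mpr fun s => (hF' s).continuousAt
  obtain ⟨m, rfl⟩ : ∃ m, n = m + 1 := ⟨n - 1, by omega⟩
  -- `sinhⁿ F'` is decreasing and vanishes at `0`
  have hneg : ∀ s, 0 < s → F' s ≤ 0 := by
    have hd : ∀ s, HasDerivAt (fun s => Real.sinh s ^ (m + 1) * F' s)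
        (((m + 1 : ℕ) * Real.sinh s ^ m * Real.cosh s) * F' s + Real.sinh s ^ (m + 1) * F'' s) s :=
      fun s => ((Real.hasDerivAt_sinh s).fun_pow (m + 1)).fun_mul (hF' s)
    have hanti : AntitoneOn (fun s => Real.sinh s ^ (m + 1) * F' s) (Ici 0) := by
      refine antitoneOn_of_deriv_nonpos (convex_Ici 0) (by fun_prop)
        (fun s _ => (hd s).differentiableAt.differentiableWithinAt) fun s hs => ?_
      rw [interior_Ici] at hs
      have hs' : 0 < Real.sinh s := Real.sinh_pos_iff.mpr hs
      rw [(hd s).deriv]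
      have h1 := hineq s hs
      have h2 : ((m + 1 : ℕ) * Real.sinh s ^ m * Real.cosh s) * F' s +
          Real.sinh s ^ (m + 1) * F'' s = Real.sinh s ^ (m + 1) *
            (F'' s + (m + 1 : ℕ) * (Real.cosh s / Real.sinh s) * F' s) := by
        field_simp
        ring
      rw [h2]
      exact mul_nonpos_of_nonneg_of_nonpos (pow_nonneg hs'.le _) (by linarith [hH0 s])
    intro s hs
    have h1 := hanti (mem_Ici.mpr le_rfl) (mem_Ici.mpr hs.le) hs.le
    simp only [Real.sinh_zero, ne_eq, Nat.add_eq_zero_iff, one_ne_zero, and_false,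
      not_false_eq_true, zero_pow, zero_mul] at h1
    by_contra! h
    exact absurd h1 (not_le.mpr (mul_pos (pow_pos (Real.sinh_pos_iff.mpr hs) _) h))
  have hantiF : AntitoneOn F (Ici 0) := by
    refine antitoneOn_of_deriv_nonpos (convex_Ici 0) hFc.continuousOn
      (fun s _ => (hF s).differentiableAt.differentiableWithinAt) fun s hs => ?_
    rw [interior_Ici] at hs
    rw [(hF s).deriv]
    exact hneg s hs
  refine ⟨hantiF, ?_⟩
  -- `coth` is at most `1 + 1 / sinh 1` beyond `1`
  set K : ℝ := 1 + 1 / Real.sinh 1 with hK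
  have hsinh1 : 0 < Real.sinh 1 := Real.sinh_pos_iff.mpr one_pos
  have hK0 : 0 ≤ K := by positivity
  have hcoth : ∀ s, 1 ≤ s → Real.cosh s / Real.sinh s ≤ K := by
    intro s hs
    have h1 : Real.sinh 1 ≤ Real.sinh s := Real.sinh_le_sinh.mpr hs
    have h2 : Real.cosh s ≤ Real.sinh s + 1 := by
      have h3 := Real.cosh_sub_sinh s
      have h4 : Real.exp (-s) ≤ 1 := Real.exp_le_one_iff.mpr (by linarith)
      linarith
    rw [div_le_iff₀ (hsinh1.trans_le h1), hK, add_mul, one_mul]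
    have h5 : 1 ≤ 1 / Real.sinh 1 * Real.sinh s := by
      rw [one_div, inv_mul_eq_div, le_div_iff₀ hsinh1]; linarith
    linarith
  have hQ : ∀ s, HasDerivAt (fun s => ∫ t in (1 : ℝ)..s, H t) (H s) s := fun s =>
    intervalIntegral.integral_hasDerivAt_right (hHc.intervalIntegrable _ _)
      hHc.aestronglyMeasurable.stronglyMeasurableAtFilter hHc.continuousAt
  -- with `coth ≤ K`, the inequality makes `-F' - n K F - ∫ H` nondecreasing, which bounds `∫ H`
  set Ψ : ℝ → ℝ := fun s => -F' s - (m + 1 : ℕ) * K * F s - ∫ t in (1 : ℝ)..s, H t with hΨ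
  have hΨd : ∀ s, HasDerivAt Ψ (-F'' s - (m + 1 : ℕ) * K * F' s - H s) s := fun s =>
    ((hF' s).fun_neg.fun_sub ((hF s).const_mul _)).fun_sub (hQ s)
  have hmono : MonotoneOn Ψ (Ici 1) := by
    refine monotoneOn_of_deriv_nonneg (convex_Ici 1)
      (fun s _ => (hΨd s).continuousAt.continuousWithinAt)
      (fun s _ => (hΨd s).differentiableAt.differentiableWithinAt) fun s hs => ?_
    rw [interior_Ici] at hs
    have hs1 : (1 : ℝ) < s := hs
    rw [(hΨd s).deriv]
    have h1 := hineq s (by linarith)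
    have h2 := mul_le_mul_of_nonneg_right (hcoth s hs1.le)
      (mul_nonneg (Nat.cast_nonneg (m + 1)) (neg_nonneg.mpr (hneg s (by linarith))))
    nlinarith
  -- along a sequence going to infinity the slope `-F'` is at most one
  have hslope : ∀ j : ℕ, ∃ R : ℝ, (j : ℝ) + 1 < R ∧ -F' R ≤ 1 := by
    intro j
    obtain ⟨R, hR, hR'⟩ := exists_hasDerivAt_eq_slope F F' (a := (j : ℝ) + 1) (b := j + 2)
      (by linarith) hFc.continuousOn fun s _ => hF s
    refine ⟨R, hR.1, ?_⟩
    rw [hR']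
    have := hF0 ((j : ℝ) + 2)
    have := hF1 ((j : ℝ) + 1)
    rw [show (j : ℝ) + 2 - (j + 1) = 1 by ring, div_one]
    linarith
  choose R hR hR' using hslope
  have hRtop : Tendsto R atTop atTop := tendsto_atTop_mono (fun j => by linarith [hR j])
    tendsto_natCast_atTop_atTop
  refine integrableOn_Ioi_of_intervalIntegral_norm_bounded (1 + (m + 1 : ℕ) * K) 1
    (fun j => (hHc.integrableOn_Icc (a := 1) (b := R j)).mono_set Ioc_subset_Icc_self) hRtop
    (Eventually.of_forall fun j => ?_)
  have hj : (0 : ℝ) ≤ j := Nat.cast_nonneg j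
  have h1 := hmono (mem_Ici.mpr le_rfl) (mem_Ici.mpr (by linarith [hR j] : 1 ≤ R j))
    (by linarith [hR j])
  simp only [hΨ, intervalIntegral.integral_same, sub_zero] at h1
  simp only [Real.norm_of_nonneg (hH0 _)]
  have h2 := hneg 1 one_pos
  have h3 : 0 ≤ (m + 1 : ℕ) * K * F (R j) := by have := hF0 (R j); positivity
  have h4 : (m + 1 : ℕ) * K * F 1 ≤ (m + 1 : ℕ) * K * 1 :=
    mul_le_mul_of_nonneg_left (hF1 1) (by positivity)
  linarith [hR' j]

/-- If `f (1 - f⁸) / 8 + f'²` is integrable at infinity, then `f` tends to `1`, or it tends to `0`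
and is itself integrable. -/
lemma tendsto_one_or_integrable {f f' : ℝ → ℝ} (hf : ∀ s, HasDerivAt f (f' s) s)
    (hf' : Continuous f') (h0 : ∀ s, 0 < f s) (h1 : ∀ s, f s ≤ 1) {h : ℝ → ℝ}
    (hle : ∀ s, f s * (1 - f s ^ 8) / 8 + f' s ^ 2 ≤ h s)
    (hint : IntegrableOn h (Ioi 1)) :
    Tendsto f atTop (𝓝 1) ∨ IntegrableOn f (Ici 1) := by
  have hfc : Continuous f := continuous_iff_continuousAt.mpr fun s => (hf s).continuousAt
  have hpow : ∀ s, f s ^ 8 ≤ 1 := fun s => pow_le_one₀ (h0 s).le (h1 s)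
  have hb0 : ∀ s, 0 ≤ f s * (1 - f s ^ 8) := fun s =>
    mul_nonneg (h0 s).le (by linarith [hpow s])
  have hb1 : ∀ s, f s * (1 - f s ^ 8) ≤ 1 := fun s =>
    mul_le_one₀ (h1 s) (by linarith [hpow s]) (by linarith [pow_nonneg (h0 s).le 8])
  have hbint : IntegrableOn (fun s => f s * (1 - f s ^ 8)) (Ioi 1) := by
    refine (hint.const_mul 8).mono' (by fun_prop) (Eventually.of_forall fun s => ?_)
    rw [Real.norm_of_nonneg (hb0 s)]
    linarith [hle s, sq_nonneg (f' s)]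
  -- the function `P (f)` with `P' (x) = x (1 - x⁸)` converges
  set P : ℝ → ℝ := fun x => x ^ 2 / 2 - x ^ 10 / 10 with hP
  have hPd : ∀ x, HasDerivAt P (x * (1 - x ^ 8)) x := by
    intro x
    have := ((hasDerivAt_pow 2 x).div_const 2).fun_sub ((hasDerivAt_pow 10 x).div_const 10)
    exact this.congr_deriv (by norm_num; ring)
  have hPf : ∀ s, HasDerivAt (fun s => P (f s)) (f s * (1 - f s ^ 8) * f' s) s := fun s =>
    (hPd (f s)).comp s (hf s)
  have hPint : IntegrableOn (fun s => f s * (1 - f s ^ 8) * f' s) (Ioi 1) := by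
    refine (hint.const_mul 8).mono' (by fun_prop) (Eventually.of_forall fun s => ?_)
    rw [Real.norm_eq_abs, abs_mul, abs_of_nonneg (hb0 s)]
    nlinarith [hle s, sq_nonneg (f s * (1 - f s ^ 8) - |f' s|), sq_abs (f' s), hb0 s, hb1 s]
  have hPlim := tendsto_limUnder_of_hasDerivAt_of_integrableOn_Ioi (fun s _ => hPf s) hPint
  have hPmono : StrictMonoOn P (Icc 0 1) := by
    refine strictMonoOn_of_deriv_pos (convex_Icc 0 1)
      (fun x _ => (hPd x).continuousAt.continuousWithinAt) fun x hx => ?_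
    rw [interior_Icc] at hx
    rw [(hPd x).deriv]
    exact mul_pos hx.1 (by linarith [pow_lt_one₀ hx.1.le hx.2 (n := 8) (by norm_num)])
  have hmem : ∀ s, f s ∈ Icc (0 : ℝ) 1 := fun s => ⟨(h0 s).le, h1 s⟩
  have hcl : ∀ x ∈ Icc (0 : ℝ) 1, MapClusterPt x atTop f →
      P x = limUnder atTop fun s => P (f s) := by
    intro x _ hx
    have h2 : MapClusterPt (P x) atTop (fun s => P (f s)) :=
      hx.continuousAt_comp (hPd x).continuousAt
    exact eq_of_nhds_neBot (h2.clusterPt.mono hPlim)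
  obtain ⟨a, ha, hacl⟩ := (isCompact_Icc (a := (0 : ℝ)) (b := 1)).exists_mapClusterPt
    (f := atTop) (u := f) (tendsto_principal.mpr (Eventually.of_forall hmem))
  have hlim : Tendsto f atTop (𝓝 a) := by
    refine isCompact_Icc.tendsto_nhds_of_unique_mapClusterPt (Eventually.of_forall hmem)
      fun x hx hxcl => ?_
    exact hPmono.injOn hx ha ((hcl x hx hxcl).trans (hcl a ha hacl).symm)
  have hprod : a * (1 - a ^ 8) = 0 := by
    refine IntegrableAtFilter.eq_zero_of_tendsto (μ := volume) (l := atTop)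
      ⟨Ioi 1, Ioi_mem_atTop 1, hbint⟩ ?_ (hlim.mul (tendsto_const_nhds.sub (hlim.pow 8)))
    intro s hs
    obtain ⟨b, hb⟩ := mem_atTop_sets.mp hs
    exact measure_mono_top (fun x hx => hb x hx) (Real.volume_Ici (a := b))
  rcases mul_eq_zero.mp hprod with h | h
  · right
    subst h
    refine LocallyIntegrableOn.integrableOn_of_isBigO_atTop
      (hfc.locallyIntegrable.locallyIntegrableOn _) (g := fun s => f s * (1 - f s ^ 8)) ?_
      ⟨Ioi 1, Ioi_mem_atTop 1, hbint⟩
    refine Asymptotics.IsBigO.of_bound 2 ?_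
    have h2 : ∀ᶠ s in atTop, f s ^ 8 < 1 / 2 :=
      (hlim.pow 8).eventually (gt_mem_nhds (by norm_num))
    filter_upwards [h2] with s hs
    rw [Real.norm_of_nonneg (h0 s).le, Real.norm_of_nonneg (hb0 s)]
    nlinarith [h0 s]
  · left
    have : a = 1 := by
      by_contra hne
      have := pow_lt_one₀ ha.1 (lt_of_le_of_ne ha.2 hne) (n := 8) (by norm_num)
      linarith
    rwa [this] at hlim

end RealVariable

/-! ### Uniqueness -/

section Uniqueness

open Set MeasureTheory Filter

variable {n k : ℕ} {u : RoundSphere n k → ℝ}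

lemma continuousOn_gdot_self {f : Ambient n k → ℝ} (hf : ContDiffOn ℝ 2 f {q | yPart q ≠ 0}) :
    ContinuousOn (gdot f f) {q | yPart q ≠ 0} := by
  unfold gdot pd
  refine continuousOn_finsetSum _ fun i _ => ?_
  have h := (continuousOn_fderiv_of_contDiffOn hf).clm_apply
    (continuousOn_const (c := (EuclideanSpace.single i 1 : Ambient n k)))
  exact h.mul h

lemma continuous_crossCurve (j : Fin k) : Continuous (crossCurve n j) :=
  continuous_iff_continuousAt.mpr fun s => (hasDerivAt_crossCurve j s).continuousAt

lemma continuous_slice {h : ℝ × Rot n k → ℝ} (hh : Continuous h) (s : ℝ) :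
    Continuous fun g : Rot n k => h (s, g) :=
  hh.comp (f := fun g : Rot n k => (s, g)) (continuous_const.prodMk continuous_id)

/-- The lower bound `φ (1 - φ⁸) / 8 + |∇φ|²` for `-L φ` along the orbit through the transversal
curve. -/
def dissipation (u : RoundSphere n k → ℝ) (j : Fin k) (s : ℝ) (g : Rot n k) : ℝ :=
  rootRatio u (actInv g (crossCurve n j s)) *
    (1 - rootRatio u (actInv g (crossCurve n j s)) ^ 8) / 8 +
  gdot (rootRatio u) (rootRatio u) (actInv g (crossCurve n j s))

lemma continuous_rootRatio_actInv (hu : IsSingularYamabe u) (j : Fin k) :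
    Continuous fun z : ℝ × Rot n k => rootRatio u (actInv z.2 (crossCurve n j z.1)) :=
  (contDiffOn_rootRatio hu).continuousOn.comp_continuous
    (continuous_actInv_comp (continuous_crossCurve j))
    fun z => yPart_actInv_ne _ (yPart_crossCurve_ne j z.1)

lemma continuous_dissipation (hu : IsSingularYamabe u) (j : Fin k) :
    Continuous fun z : ℝ × Rot n k => dissipation u j z.1 z.2 := by
  have h1 := continuous_rootRatio_actInv hu j
  have h2 : Continuous fun z : ℝ × Rot n k =>
      gdot (rootRatio u) (rootRatio u) (actInv z.2 (crossCurve n j z.1)) :=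
    (continuousOn_gdot_self (contDiffOn_rootRatio hu)).comp_continuous
      (continuous_actInv_comp (continuous_crossCurve j))
      fun z => yPart_actInv_ne _ (yPart_crossCurve_ne j z.1)
  unfold dissipation
  fun_prop

lemma dissipation_nonneg (hn : 1 ≤ n) (hk : 1 ≤ k) (hkn : k < n + 2) (hu : IsSingularYamabe u)
    (j : Fin k) (s : ℝ) (g : Rot n k) : 0 ≤ dissipation u j s g := by
  have h1 := rootRatio_le_one hn hk hkn hu (yPart_actInv_ne g (yPart_crossCurve_ne (n := n) j s))
  have h0 := rootRatio_pos (u := u) (actInv g (crossCurve n j s))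
  have h8 := pow_le_one₀ h0.le h1 (n := 8)
  exact add_nonneg (div_nonneg (mul_nonneg h0.le (by linarith)) (by norm_num)) gdot_self_nonneg

lemma dissipation_le (hn : 1 ≤ n) (hk : 2 ≤ k) (hkn : k < n + 2) (hu : IsSingularYamabe u)
    (j : Fin k) (s : ℝ) (g : Rot n k) :
    dissipation u j s g ≤ -hypLap (rootRatio u) (actInv g (crossCurve n j s)) := by
  have h := le_neg_hypLap_rootRatio hn hk hkn hu
    (yPart_actInv_ne g (yPart_crossCurve_ne (n := n) j s))
  rwa [rho_actInv, rho_crossCurve, one_pow, one_mul] at h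

lemma orbitAverage_rootRatio_mem (hn : 1 ≤ n) (hk : 1 ≤ k) (hkn : k < n + 2)
    (hu : IsSingularYamabe u) (j : Fin k) (s : ℝ) :
    0 ≤ orbitAverage (rootRatio u) (crossCurve n j s) ∧
      orbitAverage (rootRatio u) (crossCurve n j s) ≤ 1 := by
  refine ⟨integral_nonneg fun g => (rootRatio_pos _).le, ?_⟩
  have h1 : Continuous fun g : Rot n k => rootRatio u (actInv g (crossCurve n j s)) :=
    continuous_slice (h := fun z => rootRatio u (actInv z.2 (crossCurve n j z.1)))
      (continuous_rootRatio_actInv hu j) s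
  calc orbitAverage (rootRatio u) (crossCurve n j s) ≤ ∫ _g, (1 : ℝ) ∂rotMeasure n k :=
        integral_mono (integrable_of_continuous h1) (integrable_const _) fun g =>
          rootRatio_le_one hn hk hkn hu (yPart_actInv_ne g (yPart_crossCurve_ne j s))
    _ = 1 := by simp

/-- The orbit averages of `φ` decrease along the transversal curve, and the dissipation is
integrable along almost every ray. -/
lemma antitoneOn_orbitAverage (hn : 1 ≤ n) (hk : 2 ≤ k) (hkn : k < n + 2)
    (hu : IsSingularYamabe u) (j : Fin k) :
    AntitoneOn (fun s => orbitAverage (rootRatio u) (crossCurve n j s)) (Ici 0) ∧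
      ∀ᵐ g ∂rotMeasure n k, IntegrableOn (fun s => dissipation u j s g) (Ioi 1) := by
  obtain ⟨F', F'', hF, hF', hE⟩ := orbitAverage_equation (contDiffOn_rootRatio hu)
    (fun t ht q => rootRatio_smul ht q) j
  have hk1 : 1 ≤ k := by omega
  have hc := continuous_dissipation hu j
  have hcs : ∀ s, Continuous (dissipation u j s) := fun s =>
    continuous_slice (h := fun z => dissipation u j z.1 z.2) hc s
  have h0 := dissipation_nonneg hn hk1 hkn hu j
  have hH : Continuous fun s => ∫ g, dissipation u j s g ∂rotMeasure n k := by
    have h := continuous_parametric_integral_of_continuous (μ := rotMeasure n k)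
      (f := dissipation u j) hc isCompact_univ
    simpa only [Measure.restrict_univ] using h
  have hineq : ∀ s, 0 < s → F'' s + n * (Real.cosh s / Real.sinh s) * F' s ≤
      -∫ g, dissipation u j s g ∂rotMeasure n k := by
    intro s hs
    rw [hE s hs, le_neg, ← integral_neg]
    refine integral_mono (integrable_of_continuous (hcs s)) (Integrable.neg ?_)
      fun g => dissipation_le hn hk hkn hu j s g
    simp only [hypLap_actInv_crossCurve]
    have hq := yPart_crossCurve_ne (n := n) j s
    exact (integrable_of_continuous (continuous_lap_actInv (contDiffOn_rootRatio hu) hq)).sub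
      ((integrable_of_continuous
        (continuous_fderiv_act (contDiffOn_rootRatio hu) hq _)).const_mul _)
  have h := radial_supersolution hn hF hF' hH (fun s => integral_nonneg (h0 s)) hineq
    (fun s => (orbitAverage_rootRatio_mem hn hk1 hkn hu j s).1)
    (fun s => (orbitAverage_rootRatio_mem hn hk1 hkn hu j s).2)
  refine ⟨h.1, ?_⟩
  have hprod : Integrable (fun z : ℝ × Rot n k => dissipation u j z.1 z.2)
      ((volume.restrict (Ioi (1 : ℝ))).prod (rotMeasure n k)) := by
    rw [integrable_prod_iff hc.aestronglyMeasurable]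
    refine ⟨Eventually.of_forall fun s => integrable_of_continuous (hcs s), ?_⟩
    simp only [Real.norm_of_nonneg (h0 _ _)]
    exact h.2
  exact hprod.prod_left_ae

/-- The direction of the radial projection of the transversal curve to the sphere is a unit
vector. -/
lemma norm_unitTangent (j : Fin k) (s : ℝ) :
    ‖((Real.cosh s)⁻¹ • xVec 0 - (Real.sinh s / Real.cosh s) • yVec j : Ambient n k)‖ ^ 2 = 1 := by
  have hcosh := Real.cosh_pos s
  rw [norm_sq_eq_add]
  have h6 : xPart ((Real.cosh s)⁻¹ • xVec 0 - (Real.sinh s / Real.cosh s) • yVec j :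
      Ambient n k) = (Real.cosh s)⁻¹ • EuclideanSpace.single 0 1 := by
    rw [sub_eq_add_neg, ← neg_smul, xPart_add, xPart_smul, xPart_smul, xPart_xVec, xPart_yVec,
      smul_zero, add_zero]
  have h7 : yPart ((Real.cosh s)⁻¹ • xVec 0 - (Real.sinh s / Real.cosh s) • yVec j :
      Ambient n k) = (-(Real.sinh s / Real.cosh s)) • EuclideanSpace.single j 1 := by
    rw [sub_eq_add_neg, ← neg_smul, yPart_add, yPart_smul, yPart_smul, yPart_xVec, yPart_yVec,
      smul_zero, zero_add]
  rw [h6, h7, norm_smul, norm_smul]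
  simp only [PiLp.norm_single, norm_one, mul_one, Real.norm_eq_abs, sq_abs, neg_sq]
  field_simp
  linarith [Real.cosh_sq s]

/-- The function `φ` along a ray of the hyperbolic factor has squared speed at most `|∇φ|²`: the
ray is parametrized by arc length modulo dilations. -/
lemma hasDerivAt_rootRatio_ray (hu : IsSingularYamabe u) (j : Fin k) (g : Rot n k) :
    ∃ f' : ℝ → ℝ, Continuous f' ∧
      (∀ s, HasDerivAt (fun s => rootRatio u (actInv g (crossCurve n j s))) (f' s) s) ∧
      ∀ s, f' s ^ 2 ≤ gdot (rootRatio u) (rootRatio u) (actInv g (crossCurve n j s)) := by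
  have hy : ∀ s, yPart (actInv g (crossCurve n j s)) ≠ 0 := fun s =>
    yPart_actInv_ne g (yPart_crossCurve_ne j s)
  have hφ := contDiffOn_rootRatio hu
  have hφd : ∀ s, DifferentiableAt ℝ (rootRatio u) (actInv g (crossCurve n j s)) := fun s =>
    (hφ.contDiffAt (isOpen_yPart_ne.mem_nhds (hy s))).differentiableAt (by simp)
  refine ⟨fun s => fderiv ℝ (rootRatio u) (actInv g (crossCurve n j s))
    (actInv g (Real.cosh s • xVec 0)), ?_, fun s => ?_, fun s => ?_⟩
  · have h1 : Continuous fun s => actInv g (crossCurve n j s) :=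
      (actInv g).continuous.comp (continuous_crossCurve j)
    have h2 : Continuous fun s : ℝ => actInv g (Real.cosh s • (xVec 0 : Ambient n k)) :=
      (actInv g).continuous.comp (by fun_prop)
    exact ((continuousOn_fderiv_of_contDiffOn hφ).comp_continuous h1 hy).clm_apply h2
  · have h2 : HasDerivAt (fun t => actInv g (crossCurve n j t))
        (actInv g (Real.cosh s • xVec 0)) s :=
      (actInv g).toContinuousLinearMap.hasFDerivAt.comp_hasDerivAt s (hasDerivAt_crossCurve j s)
    exact (hφd s).hasFDerivAt.comp_hasDerivAt s h2
  · set z := actInv g (crossCurve n j s) with hz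
    -- Euler's relation in degree zero
    have hE : fderiv ℝ (rootRatio u) z z = 0 := by
      have h1 : HasDerivAt (fun t : ℝ => rootRatio u (Real.exp t • z))
          (fderiv ℝ (rootRatio u) z z) 0 := by
        have h2 : HasDerivAt (fun t : ℝ => Real.exp t • z) z 0 := by
          simpa using (Real.hasDerivAt_exp 0).smul_const z
        exact HasFDerivAt.comp_hasDerivAt (l := rootRatio u) 0
          (by simpa using (hφd s).hasFDerivAt) h2
      refine h1.unique ?_
      simp only [rootRatio_smul (Real.exp_pos _)]
      exact hasDerivAt_const _ _
    have hcosh := Real.cosh_pos s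
    -- subtract the radial component of the velocity
    have h3 : fderiv ℝ (rootRatio u) z (actInv g (Real.cosh s • xVec 0)) =
        fderiv ℝ (rootRatio u) z (actInv g ((Real.cosh s)⁻¹ • xVec 0 -
          (Real.sinh s / Real.cosh s) • yVec j)) := by
      have h4 : (Real.cosh s)⁻¹ • xVec 0 - (Real.sinh s / Real.cosh s) • yVec j =
          Real.cosh s • (xVec 0 : Ambient n k) -
            (Real.sinh s / Real.cosh s) • crossCurve n j s := by
        rw [crossCurve, smul_add, smul_smul, ← sub_sub, ← sub_smul]
        congr 2
        field_simp
        linarith [Real.cosh_sq s]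
      rw [h4, map_sub, map_sub, map_smul (actInv g) (Real.sinh s / Real.cosh s), ← hz,
        map_smul _ (Real.sinh s / Real.cosh s), hE, smul_zero, sub_zero]
    have h5 : ‖actInv g ((Real.cosh s)⁻¹ • xVec 0 -
        (Real.sinh s / Real.cosh s) • yVec j : Ambient n k)‖ ^ 2 = 1 := by
      rw [LinearIsometry.norm_map, norm_unitTangent]
    change fderiv ℝ (rootRatio u) z (actInv g (Real.cosh s • xVec 0)) ^ 2 ≤ _
    rw [h3]
    refine (sq_fderiv_le_gdot _).trans (le_of_eq ?_)
    rw [h5, one_mul]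

lemma norm_crossCurve (j : Fin k) (s : ℝ) : ‖crossCurve n j s‖ = Real.cosh s := by
  have h : ‖crossCurve n j s‖ ^ 2 = Real.cosh s ^ 2 := by
    rw [norm_sq_eq_add, xPart_crossCurve, yPart_crossCurve, norm_smul, Real.cosh_sq]
    simp
  exact (sq_eq_sq₀ (norm_nonneg _) (Real.cosh_pos s).le).mp h

lemma lintegral_abs_mul_comp_add_mul {f : ℝ → ℝ} (hf : Continuous f) (h0 : ∀ s, 0 ≤ f s)
    (a d : ℝ) : ∫⁻ τ in Icc (0 : ℝ) 1, ENNReal.ofReal (|d| * f (a + d * τ)) =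
      ENNReal.ofReal |∫ s in a..(a + d), f s| := by
  have hc : Continuous fun τ => |d| * f (a + d * τ) := by fun_prop
  rw [← ofReal_integral_eq_lintegral_ofReal hc.integrableOn_Icc
    (Eventually.of_forall fun τ => mul_nonneg (abs_nonneg _) (h0 _)), integral_const_mul]
  congr 1
  have h1 := intervalIntegral.mul_integral_comp_add_mul (a := 0) (b := 1) (f := f) d a
  rw [mul_zero, add_zero, mul_one] at h1
  rw [← h1, abs_mul, integral_Icc_eq_integral_Ioc, ← intervalIntegral.integral_of_le zero_le_one,
    abs_of_nonneg (intervalIntegral.integral_nonneg zero_le_one fun _ _ => h0 _)]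

/-- Completeness prevents `φ`, the fourth root of `|y| / u`, from being integrable along a ray. As
`|y| / u = φ⁴ ≤ φ`, the ray would otherwise have finite length for `u⁻² g`. -/
lemma not_integrableOn_rootRatio (hn : 1 ≤ n) (hk : 1 ≤ k) (hkn : k < n + 2)
    (hu : IsSingularYamabe u) (j : Fin k) (g : Rot n k) :
    ¬ IntegrableOn (fun s => rootRatio u (actInv g (crossCurve n j s))) (Ici 1) := by
  intro hint
  set f : ℝ → ℝ := fun s => rootRatio u (actInv g (crossCurve n j s)) with hf
  have hfc : Continuous f := by
    obtain ⟨f', -, h, -⟩ := hasDerivAt_rootRatio_ray hu j g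
    exact continuous_iff_continuousAt.mpr fun s => (h s).continuousAt
  have hf0 : ∀ s, 0 ≤ f s := fun s => (rootRatio_pos _).le
  have hf1 : ∀ s, f s ≤ 1 := fun s =>
    rootRatio_le_one hn hk hkn hu (yPart_actInv_ne g (yPart_crossCurve_ne j s))
  -- the ray on the sphere
  set e : ℝ → Ambient n k := fun s => (Real.cosh s)⁻¹ • actInv g (crossCurve n j s) with he
  have hcosh := Real.cosh_pos
  have hen : ∀ s, ‖e s‖ = 1 := fun s => by
    simp only [he]
    rw [norm_smul, LinearIsometry.norm_map, norm_crossCurve, norm_inv,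
      Real.norm_of_nonneg (hcosh s).le, inv_mul_cancel₀ (hcosh s).ne']
  have hey : ∀ s, yPart (e s) ≠ 0 := fun s => by
    simp only [he, yPart_smul]
    exact smul_ne_zero (inv_ne_zero (hcosh s).ne') (yPart_actInv_ne g (yPart_crossCurve_ne j s))
  have hrho : ∀ s, rho (e s) = (Real.cosh s)⁻¹ := fun s => by
    simp only [he]
    rw [rho_smul (inv_pos.mpr (hcosh s)), rho_actInv, rho_crossCurve, mul_one]
  have hratio : ∀ s, (Real.cosh s)⁻¹ / homExt u (e s) ≤ f s := fun s => by
    have h1 : rootRatio u (e s) = f s := rootRatio_smul (inv_pos.mpr (hcosh s)) _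
    rw [← hrho, ← rootRatio_pow hu (hey s), h1]
    calc f s ^ 4 ≤ f s ^ 1 := pow_le_pow_of_le_one (hf0 s) (hf1 s) (by norm_num)
      _ = f s := pow_one _
  set e' : ℝ → Ambient n k := fun s => (Real.cosh s)⁻¹ •
    actInv g ((Real.cosh s)⁻¹ • xVec 0 - (Real.sinh s / Real.cosh s) • yVec j) with he'
  have hed : ∀ s, HasDerivAt e (e' s) s := by
    intro s
    have h1 : HasDerivAt (fun t => actInv g (crossCurve n j t))
        (actInv g (Real.cosh s • xVec 0)) s :=
      (actInv g).toContinuousLinearMap.hasFDerivAt.comp_hasDerivAt s (hasDerivAt_crossCurve j s)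
    have h2 := ((Real.hasDerivAt_cosh s).fun_inv (hcosh s).ne').fun_smul h1
    refine h2.congr_deriv ?_
    simp only [he']
    rw [← map_smul, ← map_smul, ← map_smul, ← map_add]
    congr 1
    rw [crossCurve, smul_smul, smul_add, smul_smul, smul_sub, smul_smul, smul_smul, ← add_assoc,
      ← add_smul, sub_eq_add_neg, ← neg_smul]
    congr 2
    · have := (hcosh s).ne'
      field_simp
      linarith [Real.cosh_sq s]
    · have := (hcosh s).ne'
      field_simp
  have he'n : ∀ s, ‖e' s‖ = (Real.cosh s)⁻¹ := fun s => by
    simp only [he']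
    rw [norm_smul, LinearIsometry.norm_map, norm_inv, Real.norm_of_nonneg (hcosh s).le]
    have h1 := norm_unitTangent (n := n) j s
    have h2 : ‖((Real.cosh s)⁻¹ • xVec 0 - (Real.sinh s / Real.cosh s) • yVec j :
        Ambient n k)‖ = 1 := (pow_eq_one_iff_of_nonneg (norm_nonneg _) two_ne_zero).mp h1
    rw [h2, mul_one]
  have hec : ContDiff ℝ 1 e := by
    refine contDiff_one_iff_deriv.mpr ⟨fun s => (hed s).differentiableAt, ?_⟩
    have h1 : deriv e = e' := funext fun s => (hed s).deriv
    rw [h1]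
    have h2 : Continuous fun s : ℝ => ((Real.cosh s)⁻¹ • xVec 0 -
        (Real.sinh s / Real.cosh s) • yVec j : Ambient n k) := by
      have h3 : Continuous fun s => (Real.cosh s)⁻¹ :=
        Real.continuous_cosh.inv₀ fun s => (hcosh s).ne'
      have h4 : Continuous fun s => Real.sinh s / Real.cosh s :=
        Real.continuous_sinh.div Real.continuous_cosh fun s => (hcosh s).ne'
      fun_prop
    exact (Real.continuous_cosh.inv₀ fun s => (hcosh s).ne').smul ((actInv g).continuous.comp h2)
  set a : ℝ → RoundSphere n k := fun s => ⟨e s, by simp [hen s]⟩ with ha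
  have hdist : ∀ s d : ℝ, conformalDist u (equator n k)ᶜ (a s) (a (s + d)) ≤
      ENNReal.ofReal |∫ t in s..(s + d), f t| := by
    intro s d
    have hcd : ∀ τ, HasDerivAt (fun τ => e (s + d * τ)) (d • e' (s + d * τ)) τ := by
      intro τ
      have h1 : HasDerivAt (fun τ => s + d * τ) d τ := by
        simpa using ((hasDerivAt_id τ).const_mul d).const_add s
      exact (hed (s + d * τ)).scomp τ h1
    have h1 := conformalDist_le_lintegral (u := u) (A := (equator n k)ᶜ)
      (c := fun τ => e (s + d * τ)) (p := a s) (q := a (s + d))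
      (hec.comp (by fun_prop)).contDiffOn (fun τ _ => hen _)
      (fun τ _ p hp => by change yPart (p : Ambient n k) ≠ 0; rw [hp]; exact hey _)
      (by simp [ha]) (by simp [ha])
    refine h1.trans ?_
    rw [← lintegral_abs_mul_comp_add_mul hfc hf0]
    refine setLIntegral_mono' measurableSet_Icc fun τ hτ => ENNReal.ofReal_le_ofReal ?_
    rw [(hcd τ).hasDerivWithinAt.derivWithin (uniqueDiff_Icc hτ), norm_smul, he'n,
      Real.norm_eq_abs, mul_div_assoc]
    exact mul_le_mul_of_nonneg_left (hratio _) (abs_nonneg _)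
  -- the points at integer parameters form a Cauchy sequence
  have hlim := intervalIntegral_tendsto_integral_Ioi 1 (hint.mono_set Ioi_subset_Ici_self)
    (tendsto_natCast_atTop_atTop (R := ℝ))
  have hcauchy := Metric.cauchySeq_iff.mp hlim.cauchySeq
  obtain ⟨p, hp, hpl⟩ := hu.complete (fun i : ℕ => a i) (fun i => hey i) (by
    intro ε hε
    obtain ⟨δ, hδ0, hδ⟩ := ENNReal.lt_iff_exists_real_btwn.mp hε
    have hδpos : 0 < δ := by
      by_contra! h
      rw [ENNReal.ofReal_of_nonpos h] at hδ
      exact lt_irrefl _ hδ.1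
    obtain ⟨m₀, hm₀⟩ := hcauchy δ hδpos
    refine ⟨m₀, fun i hi l hl => ?_⟩
    have h1 := hdist i (l - i)
    rw [add_sub_cancel] at h1
    refine h1.trans_lt (lt_trans ?_ hδ.2)
    rw [ENNReal.ofReal_lt_ofReal_iff hδpos]
    have h2 := hm₀ l hl i hi
    rw [Real.dist_eq] at h2
    rwa [intervalIntegral.integral_interval_sub_left (hfc.intervalIntegrable _ _)
      (hfc.intervalIntegrable _ _)] at h2)
  -- its limit would lie on the equator
  obtain ⟨B, hB⟩ := (isCompact_univ (X := RoundSphere n k)).exists_bound_of_continuousOn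
    hu.continuous.continuousOn
  have hconv : Tendsto (fun i : ℕ => ((a i : RoundSphere n k) : Ambient n k)) atTop
      (𝓝 (p : Ambient n k)) := by
    have hB0 : 0 < |B| + 1 := by positivity
    have h1 : ∀ i : ℕ, ENNReal.ofReal (‖(p : Ambient n k) - a i‖ / (|B| + 1)) ≤
        conformalDist u (equator n k)ᶜ (a i) p := fun i =>
      chord_le_conformalDist (fun q hq => hu.pos q hq) (fun q _ => by
        have h2 := hB q (mem_univ q)
        have h3 := le_abs_self B
        have h4 := le_abs_self (u q)
        rw [Real.norm_eq_abs] at h2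
        linarith) hB0 (a i) p
    have h2 := tendsto_of_tendsto_of_tendsto_of_le_of_le tendsto_const_nhds hpl
      (fun i => zero_le) h1
    have h3 := (ENNReal.tendsto_toReal ENNReal.zero_ne_top).comp h2
    simp only [Function.comp_def, ENNReal.toReal_zero] at h3
    have h4 : Tendsto (fun i : ℕ => ‖((a i : RoundSphere n k) : Ambient n k) - p‖) atTop (𝓝 0) := by
      have h5 := h3.mul_const (|B| + 1)
      rw [zero_mul] at h5
      refine h5.congr fun i => ?_
      rw [ENNReal.toReal_ofReal (by positivity), div_mul_cancel₀ _ hB0.ne', norm_sub_rev]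
    exact tendsto_iff_norm_sub_tendsto_zero.mpr h4
  have hr1 : Tendsto (fun i : ℕ => rho ((a i : RoundSphere n k) : Ambient n k)) atTop
      (𝓝 (rho (p : Ambient n k))) := (continuous_rho.tendsto _).comp hconv
  have hr2 : Tendsto (fun i : ℕ => rho ((a i : RoundSphere n k) : Ambient n k)) atTop (𝓝 0) := by
    have h1 : Tendsto (fun i : ℕ => (Real.cosh (i : ℝ))⁻¹) atTop (𝓝 0) := by
      refine Tendsto.inv_tendsto_atTop (tendsto_atTop_mono (fun i => ?_)
        (tendsto_natCast_atTop_atTop (R := ℝ)))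
      have h2 := Real.self_le_sinh_iff.mpr (Nat.cast_nonneg (α := ℝ) i)
      exact h2.trans (Real.sinh_lt_cosh _).le
    exact h1.congr fun i => (hrho i).symm
  exact (rho_pos (show yPart (p : Ambient n k) ≠ 0 from hp)).ne (tendsto_nhds_unique hr2 hr1)

/-- Uniqueness in codimension at least two. -/
theorem eq_equatorialFactor_of_two_le (hn : 1 ≤ n) (hk : 2 ≤ k) (hkn : k < n + 2)
    (hu : IsSingularYamabe u) : u = equatorialFactor n k := by
  have hk1 : 1 ≤ k := by omega
  set j : Fin k := ⟨0, by omega⟩ with hj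
  obtain ⟨hanti, hae⟩ := antitoneOn_orbitAverage hn hk hkn hu j
  have hy : ∀ (g : Rot n k) s, yPart (actInv g (crossCurve n j s)) ≠ 0 := fun g s =>
    yPart_actInv_ne g (yPart_crossCurve_ne j s)
  have hle : ∀ (g : Rot n k) s, rootRatio u (actInv g (crossCurve n j s)) ≤ 1 := fun g s =>
    rootRatio_le_one hn hk1 hkn hu (hy g s)
  have hc := continuous_rootRatio_actInv hu j
  have hcs : ∀ s, Continuous fun g : Rot n k => rootRatio u (actInv g (crossCurve n j s)) :=
    fun s => continuous_slice (h := fun z => rootRatio u (actInv z.2 (crossCurve n j z.1))) hc s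
  -- along almost every ray `φ` tends to one
  have hone : ∀ᵐ g ∂rotMeasure n k,
      Tendsto (fun s => rootRatio u (actInv g (crossCurve n j s))) atTop (𝓝 1) := by
    filter_upwards [hae] with g hg
    obtain ⟨f', hf'c, hf', hf'le⟩ := hasDerivAt_rootRatio_ray hu j g
    refine (tendsto_one_or_integrable hf' hf'c (fun s => rootRatio_pos _) (hle g) ?_
      hg).resolve_right (not_integrableOn_rootRatio hn hk1 hkn hu j g)
    intro s
    exact add_le_add le_rfl (hf'le s)
  have hlim : Tendsto (fun s => orbitAverage (rootRatio u) (crossCurve n j s)) atTop (𝓝 1) := by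
    have h := tendsto_integral_filter_of_dominated_convergence (μ := rotMeasure n k)
      (F := fun s (g : Rot n k) => rootRatio u (actInv g (crossCurve n j s)))
      (f := fun _ => (1 : ℝ)) (l := atTop) (fun _ => 1)
      (Eventually.of_forall fun s => (hcs s).aestronglyMeasurable)
      (Eventually.of_forall fun s => Eventually.of_forall fun g => by
        rw [Real.norm_of_nonneg (rootRatio_pos _).le]; exact hle g s)
      (integrable_const _) hone
    simpa [orbitAverage] using h
  have hF1 : ∀ s, 0 ≤ s → orbitAverage (rootRatio u) (crossCurve n j s) = 1 := by
    intro s hs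
    refine le_antisymm (orbitAverage_rootRatio_mem hn hk1 hkn hu j s).2 ?_
    refine le_of_tendsto hlim ?_
    filter_upwards [eventually_ge_atTop s] with t ht
    exact hanti hs (hs.trans ht) ht
  -- hence `φ` is identically one
  have hφ1 : ∀ s, 0 ≤ s → ∀ g : Rot n k, rootRatio u (actInv g (crossCurve n j s)) = 1 := by
    intro s hs g
    have h1 : ∫ g : Rot n k, (1 - rootRatio u (actInv g (crossCurve n j s)))
        ∂rotMeasure n k = 0 := by
      rw [integral_sub (integrable_const _) (integrable_of_continuous (hcs s))]
      have h2 := hF1 s hs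
      rw [orbitAverage] at h2
      rw [h2]; simp
    have h3 : Continuous fun g : Rot n k => 1 - rootRatio u (actInv g (crossCurve n j s)) :=
      continuous_const.sub (hcs s)
    rw [integral_eq_zero_iff_of_nonneg (fun g => sub_nonneg.mpr (hle g s))
      (integrable_of_continuous h3)] at h1
    have h4 := congrFun ((Continuous.ae_eq_iff_eq _ h3 continuous_const).mp h1) g
    linarith [show 1 - rootRatio u (actInv g (crossCurve n j s)) = 0 from h4]
  funext p
  by_cases hp : p ∈ equator n k
  · rw [hu.eq_zero p hp, equatorialFactor, show yPart (p : Ambient n k) = 0 from hp, norm_zero]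
  · have hpy : yPart (p : Ambient n k) ≠ 0 := hp
    have hρ := rho_pos hpy
    set q : Ambient n k := (rho (p : Ambient n k))⁻¹ • (p : Ambient n k) with hq
    obtain ⟨g, hg⟩ := exists_act_eq
      (q := crossCurve n j (Real.arsinh ‖xPart q‖)) (q' := q) (by
        rw [xPart_crossCurve, norm_smul, Real.sinh_arsinh]; simp) (by
        rw [yPart_crossCurve, hq, yPart_smul, norm_smul, norm_inv, Real.norm_of_nonneg hρ.le]
        change _ = (rho (p : Ambient n k))⁻¹ * rho (p : Ambient n k)
        rw [inv_mul_cancel₀ hρ.ne']; simp)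
    have h1 := hφ1 (Real.arsinh ‖xPart q‖) (Real.arsinh_nonneg_iff.mpr (norm_nonneg _)) g⁻¹
    rw [actInv_def, inv_inv, hg, hq, rootRatio_smul (inv_pos.mpr hρ)] at h1
    have h2 := rootRatio_pow hu hpy
    rw [h1, one_pow, eq_div_iff (hu.homExt_pos hpy).ne', one_mul, homExt_coe] at h2
    exact h2

/-- Below the critical codimension, the only singular Yamabe function is `|y|`. -/
theorem IsSingularYamabe.eq_equatorialFactor (hn : 1 ≤ n) (hk : 1 ≤ k) (hkn : k < n + 2)
    (hu : IsSingularYamabe u) : u = equatorialFactor n k := by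
  rcases hk.eq_or_lt with rfl | hk2
  · funext p
    refine le_antisymm (hu.le_equatorialFactor_of_codim_one hn p) ?_
    by_cases hp : p ∈ equator n 1
    · have h : yPart (p : Ambient n 1) = 0 := hp
      rw [hu.eq_zero p hp, equatorialFactor, h, norm_zero]
    · exact hu.equatorialFactor_le hn le_rfl hkn hp
  · exact eq_equatorialFactor_of_two_le hn hk2 hkn hu

end Uniqueness

/-! ### The distance to the equator -/

section Distance

open Set MeasureTheory Filter

variable {n k : ℕ}

lemma norm_coe_sphere (p : RoundSphere n k) : ‖(p : Ambient n k)‖ = 1 :=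
  mem_sphere_zero_iff_norm.mp p.2

/-- For `v` tangent to the unit sphere at `p`, only the component of `e` orthogonal to `p`
contributes to `⟨v, e⟩`. -/
lemma sq_inner_le_of_tangent {p v e : Ambient n k} (hp : ‖p‖ = 1) (he : ‖e‖ = 1)
    (hv : inner ℝ p v = 0) : inner ℝ v e ^ 2 ≤ (1 - inner ℝ p e ^ 2) * ‖v‖ ^ 2 := by
  have h1 : inner ℝ v e = inner ℝ v (e - inner ℝ p e • p) := by
    rw [inner_sub_right, inner_smul_right, real_inner_comm p v, hv, mul_zero, sub_zero]
  have h2 : ‖e - inner ℝ p e • p‖ ^ 2 = 1 - inner ℝ p e ^ 2 := by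
    rw [norm_sub_sq_real, inner_smul_right, norm_smul, he, hp, real_inner_comm, Real.norm_eq_abs,
      mul_one, sq_abs]
    ring
  rw [h1, ← h2]
  have h3 := abs_real_inner_le_norm v (e - inner ℝ p e • p)
  calc inner ℝ v (e - inner ℝ p e • p) ^ 2 = |inner ℝ v (e - inner ℝ p e • p)| ^ 2 :=
        (sq_abs _).symm
    _ ≤ (‖v‖ * ‖e - inner ℝ p e • p‖) ^ 2 := pow_le_pow_left₀ (abs_nonneg _) h3 2
    _ = _ := by ring

lemma inner_curve_derivWithin {γ : ℝ → RoundSphere n k}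
    (hγ : ContDiffOn ℝ 1 (fun τ => (γ τ : Ambient n k)) (Icc 0 1)) {s : ℝ}
    (hs : s ∈ Icc (0 : ℝ) 1) :
    inner ℝ (γ s : Ambient n k) (derivWithin (fun τ => (γ τ : Ambient n k)) (Icc 0 1) s) = 0 := by
  have h1 := (hasDerivWithinAt_curve hγ hs).norm_sq
  have h2 : HasDerivWithinAt (fun τ => ‖(γ τ : Ambient n k)‖ ^ 2) 0 (Icc 0 1) s := by
    simp only [norm_coe_sphere, one_pow]
    exact hasDerivWithinAt_const _ _ _
  have h3 := (uniqueDiff_Icc hs).eq_deriv _ h1 h2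
  linarith

/-- For a unit vector `e` orthogonal to `q`, the spherical distance from `p` to `q` is at least
`arcsin ⟨p, e⟩`. The factor `t < 1` keeps the argument of `arcsin` away from `±1`, where it is not
differentiable. -/
lemma arcsin_mul_le_conformalDist {p q : RoundSphere n k} {e : Ambient n k} (he : ‖e‖ = 1)
    (hq : inner ℝ (q : Ambient n k) e = 0) {t : ℝ} (ht0 : 0 ≤ t) (ht1 : t < 1) :
    ENNReal.ofReal (Real.arcsin (t * inner ℝ (p : Ambient n k) e)) ≤
      conformalDist (fun _ => 1) univ p q := by
  refine le_conformalDist fun γ hγ h0 h1 _ => ?_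
  set h : ℝ → ℝ := fun τ => inner ℝ (γ τ : Ambient n k) e with hh
  have hle : ∀ s, |h s| ≤ 1 := fun s => by
    have := abs_real_inner_le_norm (γ s : Ambient n k) e
    rwa [norm_coe_sphere, he, one_mul] at this
  have hlt : ∀ s, |t * h s| < 1 := fun s => by
    rw [abs_mul, abs_of_nonneg ht0]
    calc t * |h s| ≤ t * 1 := mul_le_mul_of_nonneg_left (hle s) ht0
      _ < 1 := by linarith
  have hne : ∀ s, t * h s ≠ -1 ∧ t * h s ≠ 1 := fun s =>
    ⟨(abs_lt.mp (hlt s)).1.ne', (abs_lt.mp (hlt s)).2.ne⟩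
  have hhc : ContDiffOn ℝ 1 h (Icc 0 1) := hγ.inner ℝ contDiffOn_const
  have hc : ContDiffOn ℝ 1 (fun τ => Real.arcsin (t * h τ)) (Icc 0 1) := by
    intro s hs
    have h3 : ContDiffWithinAt ℝ 1 (fun τ => t * h τ) (Icc 0 1) s :=
      (contDiffOn_const.mul hhc) s hs
    exact ContDiffAt.comp_contDiffWithinAt (g := Real.arcsin) s
      (Real.contDiffAt_arcsin (hne s).1 (hne s).2) h3
  have h2 := ofReal_norm_sub_le_lintegral
    (w := fun s => ‖derivWithin (fun τ => (γ τ : Ambient n k)) (Icc 0 1) s‖ / 1) hc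
    fun s hs => ?_
  · refine le_trans (ENNReal.ofReal_le_ofReal ?_) h2
    simp only [hh, h0, h1, hq, mul_zero, Real.arcsin_zero, zero_sub, norm_neg]
    exact le_abs_self _
  · set v := derivWithin (fun τ => (γ τ : Ambient n k)) (Icc 0 1) s with hv
    have h3 : HasDerivWithinAt h (inner ℝ v e) (Icc 0 1) s := by
      have := (hasDerivWithinAt_curve hγ hs).inner ℝ (hasDerivWithinAt_const s (Icc 0 1) e)
      simpa using this
    have h4 := (Real.hasDerivAt_arcsin (hne s).1 (hne s).2).comp_hasDerivWithinAt s
      (h3.const_mul t)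
    have h5 : derivWithin (fun τ => Real.arcsin (t * h τ)) (Icc 0 1) s =
        1 / √(1 - (t * h s) ^ 2) * (t * inner ℝ v e) := h4.derivWithin (uniqueDiff_Icc hs)
    have h6 := sq_inner_le_of_tangent (norm_coe_sphere (γ s)) he (inner_curve_derivWithin hγ hs)
    have h7 : 0 < 1 - (t * h s) ^ 2 := by
      have := (sq_lt_one_iff_abs_lt_one _).mpr (hlt s)
      linarith
    rw [h5, div_one, norm_mul, norm_div, norm_one, Real.norm_of_nonneg (Real.sqrt_nonneg _),
      one_div_mul_eq_div, div_le_iff₀ (Real.sqrt_pos.mpr h7), Real.norm_eq_abs]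
    refine abs_le_of_sq_le_sq ?_ (by positivity)
    rw [mul_pow, mul_pow, Real.sq_sqrt h7.le]
    have h8 : t ^ 2 ≤ 1 := pow_le_one₀ ht0 ht1.le
    have h9 := mul_le_mul_of_nonneg_left h6 (sq_nonneg t)
    have h10 : 0 ≤ ‖v‖ ^ 2 * (1 - t ^ 2) := mul_nonneg (sq_nonneg _) (by linarith)
    change t ^ 2 * inner ℝ v e ^ 2 ≤ t ^ 2 * ((1 - h s ^ 2) * ‖v‖ ^ 2) at h9
    nlinarith

lemma exists_unit_smul {m : ℕ} (hm : 1 ≤ m) (v : EuclideanSpace ℝ (Fin m)) :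
    ∃ a : EuclideanSpace ℝ (Fin m), ‖a‖ = 1 ∧ v = ‖v‖ • a := by
  by_cases hv : v = 0
  · refine ⟨EuclideanSpace.single ⟨0, hm⟩ 1, by simp, by simp [hv]⟩
  · have := norm_pos_iff.mpr hv
    refine ⟨‖v‖⁻¹ • v, ?_, ?_⟩
    · rw [norm_smul, norm_inv, norm_norm, inv_mul_cancel₀ this.ne']
    · rw [smul_smul, mul_inv_cancel₀ this.ne', one_smul]

/-- The distance to the equator is `arcsin |y|`. -/
theorem distToEquator_eq (hk : 1 ≤ k) (p : RoundSphere n k) :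
    distToEquator p = ENNReal.ofReal (Real.arcsin (rho (p : Ambient n k))) := by
  obtain ⟨a, ha, hxa⟩ := exists_unit_smul (Nat.le_add_left 1 n) (xPart (p : Ambient n k))
  obtain ⟨b, hb, hyb⟩ := exists_unit_smul hk (yPart (p : Ambient n k))
  set A : Ambient n k := ambientMk a 0 with hA
  set B : Ambient n k := ambientMk 0 b with hB
  have hAn : ‖A‖ = 1 := by
    have : ‖A‖ ^ 2 = 1 := by rw [norm_sq_eq_add]; simp [hA, ha]
    exact (pow_eq_one_iff_of_nonneg (norm_nonneg _) two_ne_zero).mp this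
  have hBn : ‖B‖ = 1 := by
    have : ‖B‖ ^ 2 = 1 := by rw [norm_sq_eq_add]; simp [hB, hb]
    exact (pow_eq_one_iff_of_nonneg (norm_nonneg _) two_ne_zero).mp this
  have hAB : inner ℝ A B = 0 := by rw [inner_eq_add]; simp [hA, hB]
  have hr0 : 0 ≤ rho (p : Ambient n k) := norm_nonneg _
  have hr1 : rho (p : Ambient n k) ≤ 1 := rho_coe_le_one p
  apply le_antisymm
  · -- the great circle through `p` and `A`
    set θ := Real.arcsin (rho (p : Ambient n k)) with hθ
    have hsin : Real.sin θ = rho (p : Ambient n k) := Real.sin_arcsin (by linarith) hr1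
    have hcos : Real.cos θ = ‖xPart (p : Ambient n k)‖ := by
      rw [hθ, Real.cos_arcsin, ← Real.sqrt_sq (norm_nonneg (xPart (p : Ambient n k)))]
      congr 1
      have h1 := norm_sq_eq_add (p : Ambient n k)
      rw [norm_coe_sphere] at h1
      rw [rho]
      linarith
    set c : ℝ → Ambient n k := fun τ => Real.cos (θ * (1 - τ)) • A + Real.sin (θ * (1 - τ)) • B
      with hc
    have hp : (p : Ambient n k) = c 0 := by
      refine ambient_ext ?_ ?_
      · simp only [hc, sub_zero, mul_one, xPart_add, xPart_smul, hA, hB, xPart_ambientMk,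
          smul_zero, add_zero, hcos]
        exact hxa
      · simp only [hc, sub_zero, mul_one, yPart_add, yPart_smul, hA, hB, yPart_ambientMk,
          smul_zero, zero_add, hsin]
        exact hyb
    have hA1 : A = c 1 := by simp [hc]
    have hnorm : ∀ x y : ℝ, x ^ 2 + y ^ 2 = 1 → ‖x • A + y • B‖ = 1 := by
      intro x y hxy
      have : ‖x • A + y • B‖ ^ 2 = 1 := by
        rw [norm_add_sq_real, inner_smul_left, inner_smul_right, hAB, norm_smul, norm_smul, hAn,
          hBn]
        simpa using hxy
      exact (pow_eq_one_iff_of_nonneg (norm_nonneg _) two_ne_zero).mp this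
    set q : RoundSphere n k := ⟨A, by simp [hAn]⟩ with hq
    have hqe : q ∈ equator n k := by
      change yPart A = 0
      rw [hA, yPart_ambientMk]
    refine (iInf₂_le q hqe).trans ?_
    have hcd : ∀ τ, HasDerivAt c ((-θ) • (-Real.sin (θ * (1 - τ)) • A +
        Real.cos (θ * (1 - τ)) • B)) τ := by
      intro τ
      have h1 : HasDerivAt (fun τ : ℝ => θ * (1 - τ)) (-θ) τ := by
        simpa using ((hasDerivAt_id τ).const_sub 1).const_mul θ
      have h2 := (h1.cos.smul_const A).fun_add (h1.sin.smul_const B)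
      refine h2.congr_deriv ?_
      module
    have hcs : ContDiff ℝ 1 c := by
      have h1 : ContDiff ℝ 1 fun τ : ℝ => θ * (1 - τ) := by fun_prop
      exact (h1.cos.smul contDiff_const).add (h1.sin.smul contDiff_const)
    have h1 := conformalDist_le_lintegral (u := fun _ : RoundSphere n k => (1 : ℝ)) (A := univ)
      (c := c) (p := p) (q := q) hcs.contDiffOn (fun τ _ => hnorm _ _ (Real.cos_sq_add_sin_sq _))
      (fun _ _ _ _ => mem_univ _) hp hA1
    refine h1.trans ?_
    have hθ0 : 0 ≤ θ := Real.arcsin_nonneg.mpr hr0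
    calc _ ≤ ∫⁻ _s in Icc (0 : ℝ) 1, ENNReal.ofReal θ := by
          refine setLIntegral_mono' measurableSet_Icc fun τ hτ => ENNReal.ofReal_le_ofReal ?_
          have h2 : homExt (fun _ : RoundSphere n k => (1 : ℝ)) (c τ) = 1 := by
            have h3 : ‖c τ‖ = 1 := hnorm _ _ (Real.cos_sq_add_sin_sq _)
            rw [homExt_eq _ (norm_ne_zero_iff.mp (by rw [h3]; exact one_ne_zero)), h3, mul_one]
          rw [(hcd τ).hasDerivWithinAt.derivWithin (uniqueDiff_Icc hτ), h2, div_one, norm_smul,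
            hnorm _ _ (by rw [neg_sq]; exact Real.sin_sq_add_cos_sq _), norm_neg, mul_one,
            Real.norm_of_nonneg hθ0]
      _ = ENNReal.ofReal θ := by simp
  · refine le_iInf₂ fun q hq => ?_
    have hqB : inner ℝ (q : Ambient n k) B = 0 := by
      rw [inner_eq_add, show yPart (q : Ambient n k) = 0 from hq]
      simp [hB]
    have hpB : inner ℝ (p : Ambient n k) B = rho (p : Ambient n k) := by
      rw [inner_eq_add, hyb, inner_smul_left, hB, xPart_ambientMk, yPart_ambientMk,
        inner_zero_right, real_inner_self_eq_norm_sq, hb]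
      simp [rho]
    have h1 : ∀ t : ℝ, 0 ≤ t → t < 1 → ENNReal.ofReal (Real.arcsin (t * rho (p : Ambient n k))) ≤
        conformalDist (fun _ => 1) univ p q := by
      intro t ht0 ht1
      have := arcsin_mul_le_conformalDist (p := p) hBn hqB ht0 ht1
      rwa [hpB] at this
    have h2 : Tendsto (fun t : ℝ => ENNReal.ofReal (Real.arcsin (t * rho (p : Ambient n k))))
        (𝓝[<] 1) (𝓝 (ENNReal.ofReal (Real.arcsin (1 * rho (p : Ambient n k))))) := by
      have h3 : Continuous fun t : ℝ =>
          ENNReal.ofReal (Real.arcsin (t * rho (p : Ambient n k))) :=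
        ENNReal.continuous_ofReal.comp (Real.continuous_arcsin.comp (by fun_prop))
      exact (h3.tendsto 1).mono_left nhdsWithin_le_nhds
    rw [one_mul] at h2
    refine le_of_tendsto h2 ?_
    filter_upwards [Ioo_mem_nhdsLT (show (0 : ℝ) < 1 by norm_num)] with t ht
    exact h1 t ht.1.le ht.2

lemma setOf_lt_distToEquator (hk : 1 ≤ k) {ε : ℝ} (hε : 0 < ε) (hε2 : ε < Real.pi / 2) :
    {p : RoundSphere n k | ENNReal.ofReal ε < distToEquator p} =
      {p : RoundSphere n k | Real.sin ε < rho (p : Ambient n k)} := by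
  ext p
  change ENNReal.ofReal ε < distToEquator p ↔ Real.sin ε < rho (p : Ambient n k)
  rw [distToEquator_eq hk, ENNReal.ofReal_lt_ofReal_iff_of_nonneg hε.le,
    Real.lt_arcsin_iff_sin_lt' ⟨by linarith [Real.pi_pos], hε2⟩]

lemma setOf_lt_distToEquator_eq_empty (hk : 1 ≤ k) {ε : ℝ} (hε2 : Real.pi / 2 ≤ ε) :
    {p : RoundSphere n k | ENNReal.ofReal ε < distToEquator p} = ∅ := by
  refine eq_empty_of_forall_notMem fun p hp => ?_
  change ENNReal.ofReal ε < distToEquator p at hp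
  rw [distToEquator_eq hk] at hp
  have h1 := ENNReal.ofReal_le_ofReal
    ((Real.arcsin_le_pi_div_two (rho (p : Ambient n k))).trans hε2)
  exact absurd hp (not_lt.mpr h1)

end Distance

/-! ### The volume as a one-dimensional integral -/

section Volume

open Set MeasureTheory Filter

variable {n k : ℕ}

/-- Integration with respect to the density `r^m dr` on `(0, ∞)`. -/
lemma lintegral_volumeIoiPow (m : ℕ) {g : ℝ → ℝ≥0∞} (hg : Measurable g) :
    ∫⁻ r : Ioi (0 : ℝ), g r ∂Measure.volumeIoiPow m =
      ∫⁻ r in Ioi (0 : ℝ), ENNReal.ofReal (r ^ m) * g r := by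
  rw [Measure.volumeIoiPow, lintegral_withDensity_eq_lintegral_mul _ (by fun_prop)
    (show Measurable fun r : Ioi (0 : ℝ) => g r from hg.comp measurable_subtype_coe)]
  exact lintegral_subtype_comap measurableSet_Ioi
    (fun r : ℝ => ENNReal.ofReal (r ^ m) * g r)

section Polar

variable {E : Type*} [NormedAddCommGroup E] [NormedSpace ℝ E] [MeasurableSpace E] [BorelSpace E]
  [FiniteDimensional ℝ E] [Nontrivial E] (μ : Measure E) [μ.IsAddHaarMeasure]

/-- Integration in polar coordinates. -/
lemma lintegral_polar {f : E → ℝ≥0∞} (hf : Measurable f) :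
    ∫⁻ x, f x ∂μ = ∫⁻ θ : Metric.sphere (0 : E) 1, (∫⁻ r in Ioi (0 : ℝ),
      ENNReal.ofReal (r ^ (Module.finrank ℝ E - 1)) * f (r • (θ : E))) ∂μ.toSphere := by
  have h1 : ∫⁻ x, f x ∂μ = ∫⁻ x : ({(0 : E)}ᶜ : Set E), f x ∂μ.comap (↑) := by
    rw [lintegral_subtype_comap (measurableSet_singleton _).compl, restrict_compl_singleton]
  have h2 : ∀ x : ({(0 : E)}ᶜ : Set E), f x =
      (fun z : Metric.sphere (0 : E) 1 × Ioi (0 : ℝ) => f ((z.2 : ℝ) • (z.1 : E)))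
        (homeomorphUnitSphereProd E x) := by
    intro x
    have := congrArg Subtype.val ((homeomorphUnitSphereProd E).symm_apply_apply x)
    rw [homeomorphUnitSphereProd_symm_apply_coe] at this
    simp only [this]
  have hm : Measurable fun z : Metric.sphere (0 : E) 1 × Ioi (0 : ℝ) =>
      f ((z.2 : ℝ) • (z.1 : E)) := hf.comp (by fun_prop)
  rw [h1, lintegral_congr h2,
    μ.measurePreserving_homeomorphUnitSphereProd.lintegral_comp hm,
    lintegral_prod _ hm.aemeasurable]
  refine lintegral_congr fun θ => ?_
  exact lintegral_volumeIoiPow _ (g := fun r => f (r • (θ : E))) (hf.comp (by fun_prop))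

lemma lintegral_fun_norm {f : ℝ → ℝ≥0∞} (hf : Measurable f) :
    ∫⁻ x, f ‖x‖ ∂μ = μ.toSphere univ * ∫⁻ r in Ioi (0 : ℝ),
      ENNReal.ofReal (r ^ (Module.finrank ℝ E - 1)) * f r := by
  rw [lintegral_polar μ (f := fun x => f ‖x‖) (hf.comp measurable_norm)]
  have h : ∀ θ : Metric.sphere (0 : E) 1, ∫⁻ r in Ioi (0 : ℝ),
      ENNReal.ofReal (r ^ (Module.finrank ℝ E - 1)) * f ‖r • (θ : E)‖ =
      ∫⁻ r in Ioi (0 : ℝ), ENNReal.ofReal (r ^ (Module.finrank ℝ E - 1)) * f r := by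
    intro θ
    refine setLIntegral_congr_fun measurableSet_Ioi fun r hr => ?_
    rw [norm_smul, mem_sphere_zero_iff_norm.mp θ.2, mul_one, Real.norm_of_nonneg (le_of_lt hr)]
  rw [lintegral_congr h, lintegral_const, mul_comm]

end Polar

/-- The decomposition `ℝ^{n+k+1} = ℝ^{n+1} × ℝ^k` preserves volume. -/
lemma measurePreserving_parts :
    MeasurePreserving (fun q : Ambient n k => (xPart q, yPart q)) volume
      ((volume : Measure (EuclideanSpace ℝ (Fin (n + 1)))).prod
        (volume : Measure (EuclideanSpace ℝ (Fin k)))) := by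
  have h1 := EuclideanSpace.volume_preserving_symm_measurableEquiv_toLp (Fin (n + 1) ⊕ Fin k)
  have h2 := measurePreserving_sumPiEquivProdPi
    (fun _ : Fin (n + 1) ⊕ Fin k => (volume : Measure ℝ))
  have h3 := (EuclideanSpace.volume_preserving_symm_measurableEquiv_toLp (Fin (n + 1))).symm
  have h4 := (EuclideanSpace.volume_preserving_symm_measurableEquiv_toLp (Fin k)).symm
  exact (h3.prod h4).comp (h2.comp h1)

lemma lintegral_parts {f : EuclideanSpace ℝ (Fin (n + 1)) → EuclideanSpace ℝ (Fin k) → ℝ≥0∞}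
    (hf : Measurable fun z : EuclideanSpace ℝ (Fin (n + 1)) × EuclideanSpace ℝ (Fin k) =>
      f z.1 z.2) :
    ∫⁻ q : Ambient n k, f (xPart q) (yPart q) = ∫⁻ y, ∫⁻ x, f x y := by
  rw [← lintegral_prod_symm' _ hf]
  exact measurePreserving_parts.lintegral_comp hf

/-- The integral `∫₀^T sⁿ / √(1 + s²) ds`. -/
def coneIntegral (n : ℕ) (T : ℝ) : ℝ := ∫ s in (0 : ℝ)..T, s ^ n / √(1 + s ^ 2)

lemma coneIntegral_nonneg (n : ℕ) {T : ℝ} (hT : 0 ≤ T) : 0 ≤ coneIntegral n T :=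
  intervalIntegral.integral_nonneg hT fun _s hs =>
    div_nonneg (pow_nonneg hs.1 n) (Real.sqrt_nonneg _)

lemma setLIntegral_Ioo_ofReal {f : ℝ → ℝ} (hf : Continuous f) {a : ℝ} (ha : 0 ≤ a)
    (h0 : ∀ s ∈ Ioo 0 a, 0 ≤ f s) :
    ∫⁻ s in Ioo 0 a, ENNReal.ofReal (f s) = ENNReal.ofReal (∫ s in (0 : ℝ)..a, f s) := by
  rw [intervalIntegral.integral_of_le ha, integral_Ioc_eq_integral_Ioo,
    ofReal_integral_eq_lintegral_ofReal (hf.integrableOn_Icc.mono_set Ioo_subset_Icc_self)]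
  exact (ae_restrict_iff' measurableSet_Ioo).mpr (Eventually.of_forall h0)

lemma integral_cone_scale (n : ℕ) {r : ℝ} (hr : 0 < r) (T : ℝ) :
    ∫ s in (0 : ℝ)..(r * T), s ^ n * (r / √(s ^ 2 + r ^ 2)) = r ^ (n + 1) * coneIntegral n T := by
  have h1 := intervalIntegral.integral_comp_mul_left (a := 0) (b := T)
    (fun s => s ^ n * (r / √(s ^ 2 + r ^ 2))) hr.ne'
  rw [mul_zero, smul_eq_mul, eq_inv_mul_iff_mul_eq₀ hr.ne'] at h1
  rw [← h1, coneIntegral, ← intervalIntegral.integral_const_mul,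
    ← intervalIntegral.integral_const_mul]
  refine intervalIntegral.integral_congr fun s _ => ?_
  have h2 : √((r * s) ^ 2 + r ^ 2) = r * √(1 + s ^ 2) := by
    rw [show (r * s) ^ 2 + r ^ 2 = r ^ 2 * (1 + s ^ 2) by ring, Real.sqrt_mul (sq_nonneg r),
      Real.sqrt_sq hr.le]
  have h3 : 0 < √(1 + s ^ 2) := Real.sqrt_pos.mpr (by positivity)
  simp only [h2]
  field_simp
  rw [mul_pow]
  ring

/-- The cone `{|y| > σ |(x, y)|}`, cut off at `|y| = 1`. -/
def truncatedCone (n k : ℕ) (σ : ℝ) : Set (Ambient n k) :=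
  {q | 0 < rho q ∧ rho q < 1 ∧ σ * ‖q‖ < rho q}

lemma measurableSet_truncatedCone (σ : ℝ) : MeasurableSet (truncatedCone n k σ) := by
  have h : Measurable (rho : Ambient n k → ℝ) := continuous_rho.measurable
  exact (measurableSet_lt measurable_const h).inter ((measurableSet_lt h measurable_const).inter
    (measurableSet_lt (measurable_norm.const_mul σ) h))

/-- The weight `|y| / |(x, y)|` on the truncated cone. Its integral over the ray through a point
`(x, y)` of the sphere is a constant multiple of the density `|y|^{-(n+k)}`. -/
def coneWeight (σ : ℝ) (q : Ambient n k) : ℝ≥0∞ :=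
  (truncatedCone n k σ).indicator (fun q => ENNReal.ofReal (rho q / ‖q‖)) q

lemma measurable_coneWeight (σ : ℝ) : Measurable (coneWeight σ : Ambient n k → ℝ≥0∞) := by
  have h : Measurable (rho : Ambient n k → ℝ) := continuous_rho.measurable
  exact ((h.div measurable_norm).ennreal_ofReal).indicator (measurableSet_truncatedCone σ)

lemma lintegral_coneWeight_ray {σ : ℝ} (hσ : 0 < σ) (p : RoundSphere n k) :
    ∫⁻ r in Ioi (0 : ℝ), ENNReal.ofReal (r ^ (n + k)) * coneWeight σ (r • (p : Ambient n k)) =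
      ENNReal.ofReal (1 / ((n : ℝ) + k + 1)) *
        {p : RoundSphere n k | σ < rho (p : Ambient n k)}.indicator
          (fun p => ENNReal.ofReal ((rho (p : Ambient n k))⁻¹ ^ (n + k))) p := by
  by_cases hp : σ < rho (p : Ambient n k)
  · have hρ : 0 < rho (p : Ambient n k) := hσ.trans hp
    rw [indicator_of_mem (show p ∈ {p : RoundSphere n k | σ < rho (p : Ambient n k)} from hp)]
    have h1 : ∀ r ∈ Ioi (0 : ℝ), ENNReal.ofReal (r ^ (n + k)) *
        coneWeight σ (r • (p : Ambient n k)) =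
        (Ioo 0 (rho (p : Ambient n k))⁻¹).indicator
          (fun r => ENNReal.ofReal (r ^ (n + k) * rho (p : Ambient n k))) r := by
      intro r hr
      have hr0 : 0 < r := hr
      by_cases h2 : r < (rho (p : Ambient n k))⁻¹
      · rw [indicator_of_mem (show r ∈ Ioo 0 (rho (p : Ambient n k))⁻¹ from ⟨hr0, h2⟩), coneWeight,
          indicator_of_mem, rho_smul hr0, norm_smul_of_pos hr0, norm_coe_sphere, mul_one,
          mul_div_cancel_left₀ _ hr0.ne', ENNReal.ofReal_mul (pow_nonneg hr0.le _)]
        refine ⟨?_, ?_, ?_⟩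
        · rw [rho_smul hr0]; positivity
        · rw [rho_smul hr0]
          rwa [lt_inv_comm₀ hr0 hρ, inv_eq_one_div, lt_div_iff₀ hr0, mul_comm] at h2
        · rw [rho_smul hr0, norm_smul_of_pos hr0, norm_coe_sphere, mul_one, mul_comm]
          exact mul_lt_mul_of_pos_left hp hr0
      · rw [indicator_of_notMem fun h => h2 h.2, coneWeight, indicator_of_notMem, mul_zero]
        rintro ⟨-, h3, -⟩
        rw [rho_smul hr0] at h3
        exact h2 (by rwa [lt_inv_comm₀ hr0 hρ, inv_eq_one_div, lt_div_iff₀ hr0, mul_comm])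
    rw [setLIntegral_congr_fun measurableSet_Ioi h1, setLIntegral_indicator measurableSet_Ioo,
      inter_eq_left.mpr Ioo_subset_Ioi_self, setLIntegral_Ioo_ofReal (by fun_prop)
        (inv_nonneg.mpr hρ.le) (fun s hs => mul_nonneg (pow_nonneg hs.1.le _) hρ.le),
      ← ENNReal.ofReal_mul (by positivity), intervalIntegral.integral_mul_const, integral_pow]
    congr 1
    have h2 : (0 : ℝ) ^ (n + k + 1) = 0 := zero_pow (Nat.succ_ne_zero _)
    rw [h2, sub_zero, pow_succ]
    push_cast
    field_simp
  · rw [indicator_of_notMem (show p ∉ {p : RoundSphere n k | σ < rho (p : Ambient n k)} from hp),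
      mul_zero]
    refine (setLIntegral_congr_fun measurableSet_Ioi (g := fun _ => 0) fun r hr => ?_).trans
      (by simp)
    have hr0 : 0 < r := hr
    rw [coneWeight, indicator_of_notMem, mul_zero]
    rintro ⟨-, -, h3⟩
    rw [rho_smul hr0, norm_smul_of_pos hr0, norm_coe_sphere, mul_one, mul_comm] at h3
    exact hp (lt_of_mul_lt_mul_left h3 hr0.le)

instance nontrivial_ambient (n k : ℕ) : Nontrivial (Ambient n k) :=
  Module.nontrivial_of_finrank_pos (R := ℝ) (by
    rw [(finrank_ambient n k).out]; omega)

/-- The weighted volume of the truncated cone in polar coordinates of `ℝ^{n+k+1}`. -/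
lemma lintegral_coneWeight_eq_sphere {σ : ℝ} (hσ : 0 < σ) :
    ∫⁻ q : Ambient n k, coneWeight σ q = ENNReal.ofReal (1 / ((n : ℝ) + k + 1)) *
      ∫⁻ p in {p : RoundSphere n k | σ < rho (p : Ambient n k)},
        ENNReal.ofReal ((rho (p : Ambient n k))⁻¹ ^ (n + k))
          ∂((volume : Measure (Ambient n k)).toSphere) := by
  have hd : Module.finrank ℝ (Ambient n k) - 1 = n + k := by
    rw [(finrank_ambient n k).out]; omega
  have hm : Measurable fun p : RoundSphere n k => rho (p : Ambient n k) :=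
    (continuous_rho.comp continuous_subtype_val).measurable
  rw [lintegral_polar volume (measurable_coneWeight σ), hd,
    lintegral_congr (lintegral_coneWeight_ray hσ), lintegral_const_mul',
    lintegral_indicator (measurableSet_lt measurable_const hm)]
  exact ENNReal.ofReal_ne_top

/-- The radial integral over the slice `|y| = r` of the truncated cone. -/
lemma lintegral_coneWeight_slice {ε : ℝ} (hε : 0 < ε) (hε2 : ε < Real.pi / 2) {r : ℝ} (hr : 0 < r) :
    ∫⁻ s in Ioi (0 : ℝ), ENNReal.ofReal (s ^ n) *
        (if Real.sin ε * √(s ^ 2 + r ^ 2) < r then ENNReal.ofReal (r / √(s ^ 2 + r ^ 2)) else 0) =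
      ENNReal.ofReal (r ^ (n + 1)) * ENNReal.ofReal (coneIntegral n (Real.cos ε / Real.sin ε)) := by
  have hsin : 0 < Real.sin ε := Real.sin_pos_of_pos_of_lt_pi hε (by linarith [Real.pi_pos])
  have hcos : 0 < Real.cos ε := Real.cos_pos_of_mem_Ioo ⟨by linarith, hε2⟩
  set T := Real.cos ε / Real.sin ε with hT
  have hT0 : 0 < T := div_pos hcos hsin
  have hiff : ∀ s : ℝ, 0 < s → (Real.sin ε * √(s ^ 2 + r ^ 2) < r ↔ s < r * T) := by
    intro s hs
    have h1 : 0 < √(s ^ 2 + r ^ 2) := Real.sqrt_pos.mpr (by positivity)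
    rw [← sq_lt_sq₀ (by positivity) hr.le, ← sq_lt_sq₀ hs.le (by positivity), mul_pow, mul_pow,
      Real.sq_sqrt (by positivity), hT, div_pow, mul_div_assoc', lt_div_iff₀ (by positivity)]
    have h2 := Real.sin_sq_add_cos_sq ε
    constructor <;> intro h <;> nlinarith
  have h1 : ∀ s ∈ Ioi (0 : ℝ), ENNReal.ofReal (s ^ n) *
      (if Real.sin ε * √(s ^ 2 + r ^ 2) < r then ENNReal.ofReal (r / √(s ^ 2 + r ^ 2)) else 0) =
      (Ioo 0 (r * T)).indicator (fun s => ENNReal.ofReal (s ^ n * (r / √(s ^ 2 + r ^ 2)))) s := by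
    intro s hs
    have hs0 : 0 < s := hs
    by_cases h : s < r * T
    · rw [if_pos ((hiff s hs0).mpr h), indicator_of_mem (show s ∈ Ioo 0 (r * T) from ⟨hs0, h⟩),
        ENNReal.ofReal_mul (pow_nonneg hs0.le _)]
    · rw [if_neg (fun h' => h ((hiff s hs0).mp h')), indicator_of_notMem fun h' => h h'.2, mul_zero]
  have hc : Continuous fun s : ℝ => s ^ n * (r / √(s ^ 2 + r ^ 2)) := by
    have : ∀ s : ℝ, √(s ^ 2 + r ^ 2) ≠ 0 := fun s => (Real.sqrt_pos.mpr (by positivity)).ne'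
    fun_prop (disch := exact this _)
  rw [setLIntegral_congr_fun measurableSet_Ioi h1, setLIntegral_indicator measurableSet_Ioo,
    inter_eq_left.mpr Ioo_subset_Ioi_self, setLIntegral_Ioo_ofReal hc (by positivity)
      (fun s hs => mul_nonneg (pow_nonneg hs.1.le _) (by positivity)), integral_cone_scale n hr,
    ENNReal.ofReal_mul (by positivity)]

/-- The weighted volume of the truncated cone in polar coordinates of both factors of
`ℝ^{n+1} × ℝ^k`. -/
lemma lintegral_coneWeight_eq (hk : 1 ≤ k) {ε : ℝ} (hε : 0 < ε) (hε2 : ε < Real.pi / 2) :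
    ∫⁻ q : Ambient n k, coneWeight (Real.sin ε) q = ENNReal.ofReal (1 / ((n : ℝ) + k + 1)) *
      ((volume : Measure (EuclideanSpace ℝ (Fin (n + 1)))).toSphere univ *
        (volume : Measure (EuclideanSpace ℝ (Fin k))).toSphere univ *
          ENNReal.ofReal (coneIntegral n (Real.cos ε / Real.sin ε))) := by
  have : Nonempty (Fin k) := ⟨⟨0, hk⟩⟩
  set ωx := (volume : Measure (EuclideanSpace ℝ (Fin (n + 1)))).toSphere univ with hωx
  set ωy := (volume : Measure (EuclideanSpace ℝ (Fin k))).toSphere univ with hωy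
  set I := ENNReal.ofReal (coneIntegral n (Real.cos ε / Real.sin ε)) with hI
  -- the weight depends on `|x|` and `|y|` only
  set w : ℝ → ℝ → ℝ≥0∞ := fun s r =>
    if Real.sin ε * √(s ^ 2 + r ^ 2) < r then ENNReal.ofReal (r / √(s ^ 2 + r ^ 2)) else 0 with hw
  have hwm : Measurable fun z : ℝ × ℝ => w z.1 z.2 := by
    refine Measurable.ite (measurableSet_lt ?_ measurable_snd) ?_ measurable_const <;> fun_prop
  set f : EuclideanSpace ℝ (Fin (n + 1)) → EuclideanSpace ℝ (Fin k) → ℝ≥0∞ := fun x y =>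
    (Ioo (0 : ℝ) 1).indicator (fun _ => w ‖x‖ ‖y‖) ‖y‖ with hf
  have hfm : Measurable fun z : EuclideanSpace ℝ (Fin (n + 1)) × EuclideanSpace ℝ (Fin k) =>
      f z.1 z.2 := by
    have h1 : (fun z : EuclideanSpace ℝ (Fin (n + 1)) × EuclideanSpace ℝ (Fin k) => f z.1 z.2) =
        {z : EuclideanSpace ℝ (Fin (n + 1)) × EuclideanSpace ℝ (Fin k) |
          ‖z.2‖ ∈ Ioo (0 : ℝ) 1}.indicator fun z => w ‖z.1‖ ‖z.2‖ := by
      funext z; rfl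
    rw [h1]
    refine Measurable.indicator (hwm.comp ((measurable_norm.comp measurable_fst).prodMk
      (measurable_norm.comp measurable_snd))) ?_
    exact (measurable_norm.comp measurable_snd) measurableSet_Ioo
  have h1 : ∀ q : Ambient n k, coneWeight (Real.sin ε) q = f (xPart q) (yPart q) := by
    intro q
    have hq : √(‖xPart q‖ ^ 2 + ‖yPart q‖ ^ 2) = ‖q‖ := by
      rw [← norm_sq_eq_add, Real.sqrt_sq (norm_nonneg _)]
    by_cases h2 : ‖yPart q‖ ∈ Ioo (0 : ℝ) 1
    · simp only [hf, indicator_of_mem h2, hw, hq]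
      by_cases h3 : Real.sin ε * ‖q‖ < ‖yPart q‖
      · rw [if_pos h3, coneWeight, indicator_of_mem
          (show q ∈ truncatedCone n k (Real.sin ε) from ⟨h2.1, h2.2, h3⟩)]
        rfl
      · rw [if_neg h3, coneWeight, indicator_of_notMem fun h => h3 h.2.2]
    · simp only [hf, indicator_of_notMem h2]
      rw [coneWeight, indicator_of_notMem fun h => h2 ⟨h.1, h.2.1⟩]
  have h2 : ∀ y : EuclideanSpace ℝ (Fin k), ∫⁻ x, f x y =
      (Ioo (0 : ℝ) 1).indicator (fun r => ωx * (ENNReal.ofReal (r ^ (n + 1)) * I)) ‖y‖ := by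
    intro y
    by_cases h3 : ‖y‖ ∈ Ioo (0 : ℝ) 1
    · simp only [hf, indicator_of_mem h3]
      rw [lintegral_fun_norm volume (f := fun s => w s ‖y‖)
        (hwm.comp (measurable_id.prodMk measurable_const)), ← hωx]
      simp only [finrank_euclideanSpace, Fintype.card_fin, Nat.add_sub_cancel]
      rw [lintegral_coneWeight_slice hε hε2 h3.1]
    · simp only [hf, indicator_of_notMem h3, lintegral_zero]
  rw [lintegral_congr h1, lintegral_parts hfm, lintegral_congr h2,
    lintegral_fun_norm volume (f := (Ioo (0 : ℝ) 1).indicator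
      fun r => ωx * (ENNReal.ofReal (r ^ (n + 1)) * I))
      (Measurable.indicator (by fun_prop) measurableSet_Ioo), ← hωy]
  have h3 : ∀ r ∈ Ioi (0 : ℝ),
      ENNReal.ofReal (r ^ (Module.finrank ℝ (EuclideanSpace ℝ (Fin k)) - 1)) *
      (Ioo (0 : ℝ) 1).indicator (fun r => ωx * (ENNReal.ofReal (r ^ (n + 1)) * I)) r =
      (Ioo (0 : ℝ) 1).indicator (fun r => (ωx * I) * ENNReal.ofReal (r ^ (n + k))) r := by
    intro r hr
    have hr0 : 0 < r := hr
    by_cases h4 : r ∈ Ioo (0 : ℝ) 1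
    · rw [indicator_of_mem h4, indicator_of_mem h4, finrank_euclideanSpace, Fintype.card_fin]
      have h5 : r ^ (n + k) = r ^ (k - 1) * r ^ (n + 1) := by
        rw [← pow_add]; congr 1; omega
      rw [h5, ENNReal.ofReal_mul (pow_nonneg hr0.le _)]
      ring
    · rw [indicator_of_notMem h4, indicator_of_notMem h4, mul_zero]
  rw [setLIntegral_congr_fun measurableSet_Ioi h3, setLIntegral_indicator measurableSet_Ioo,
    inter_eq_left.mpr Ioo_subset_Ioi_self, lintegral_const_mul _ (by fun_prop),
    setLIntegral_Ioo_ofReal (by fun_prop) zero_le_one (fun s hs => pow_nonneg hs.1.le _),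
    integral_pow]
  have h6 : ((1 : ℝ) ^ (n + k + 1) - 0 ^ (n + k + 1)) / ((n + k : ℕ) + 1) =
      1 / ((n : ℝ) + k + 1) := by
    push_cast; simp
  rw [h6]
  ring

/-- The volume of `{t > ε}` for `|y|⁻² g`, by comparison of the two expressions for the weighted
volume of the truncated cone. -/
theorem volumeBeyond_eq (hk : 1 ≤ k) {ε : ℝ} (hε : 0 < ε) (hε2 : ε < Real.pi / 2) :
    volumeBeyond (equatorialFactor n k) ε =
      (volume : Measure (EuclideanSpace ℝ (Fin (n + 1)))).toSphere univ *
        (volume : Measure (EuclideanSpace ℝ (Fin k))).toSphere univ *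
          ENNReal.ofReal (coneIntegral n (Real.cos ε / Real.sin ε)) := by
  have hsin : 0 < Real.sin ε := Real.sin_pos_of_pos_of_lt_pi hε (by linarith [Real.pi_pos])
  have h1 := (lintegral_coneWeight_eq_sphere (n := n) (k := k) hsin).symm.trans
    (lintegral_coneWeight_eq hk hε hε2)
  have h2 : ENNReal.ofReal (1 / ((n : ℝ) + k + 1)) ≠ 0 := by
    rw [ne_eq, ENNReal.ofReal_eq_zero, not_le]; positivity
  rw [volumeBeyond, setOf_lt_distToEquator hk hε hε2]
  exact (ENNReal.mul_right_inj h2 ENNReal.ofReal_ne_top).mp h1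

lemma volumeBeyond_ne_top (hk : 1 ≤ k) {ε : ℝ} (hε : 0 < ε) :
    volumeBeyond (equatorialFactor n k) ε ≠ ⊤ := by
  have : Nonempty (Fin k) := ⟨⟨0, hk⟩⟩
  by_cases hε2 : ε < Real.pi / 2
  · rw [volumeBeyond_eq hk hε hε2]
    exact ENNReal.mul_ne_top (ENNReal.mul_ne_top (measure_ne_top _ _) (measure_ne_top _ _))
      ENNReal.ofReal_ne_top
  · rw [volumeBeyond, setOf_lt_distToEquator_eq_empty hk (not_lt.mp hε2)]
    simp

end Volume

/-! ### Asymptotic expansions in powers of `ε` with a logarithm -/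

section Expansion

open Set Filter Asymptotics

/-- The expansion
`f(ε) = c₀ ε^{-n} + ⋯ + c_{n-1} ε^{-1} + e log (1/ε) + v + o(1)` as `ε → 0⁺`. -/
def HasExpansion (n : ℕ) (f : ℝ → ℝ) (c : ℕ → ℝ) (e v : ℝ) : Prop :=
  Tendsto (fun ε : ℝ => f ε -
    ((∑ j ∈ Finset.range n, c j * ε ^ ((j : ℤ) - (n : ℤ))) + e * Real.log (1 / ε) + v))
    (𝓝[>] 0) (𝓝 0)

variable {n : ℕ} {f g : ℝ → ℝ} {c d : ℕ → ℝ} {e e' v v' : ℝ}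

lemma HasExpansion.linear (hf : HasExpansion n f c e v) (hg : HasExpansion n g d e' v')
    (a b : ℝ) : HasExpansion n (fun ε => a * f ε + b * g ε) (fun j => a * c j + b * d j)
      (a * e + b * e') (a * v + b * v') := by
  have h := (hf.const_mul a).add (hg.const_mul b)
  simp only [mul_zero, add_zero] at h
  refine h.congr fun ε => ?_
  have h1 : ∑ j ∈ Finset.range n, (a * c j + b * d j) * ε ^ ((j : ℤ) - (n : ℤ)) =
      a * ∑ j ∈ Finset.range n, c j * ε ^ ((j : ℤ) - (n : ℤ)) +
        b * ∑ j ∈ Finset.range n, d j * ε ^ ((j : ℤ) - (n : ℤ)) := by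
    rw [Finset.mul_sum, Finset.mul_sum, ← Finset.sum_add_distrib]
    exact Finset.sum_congr rfl fun _ _ => by ring
  rw [h1]
  ring

lemma HasExpansion.congr (hf : HasExpansion n f c e v) (h : f =ᶠ[𝓝[>] 0] g) :
    HasExpansion n g c e v := by
  refine Tendsto.congr' ?_ hf
  filter_upwards [h] with ε hε
  rw [hε]

/-- An expansion of order `n` is one of order `n + 1` without leading term. -/
lemma HasExpansion.succ (hf : HasExpansion n f c e v) :
    HasExpansion (n + 1) f (fun j => if j = 0 then 0 else c (j - 1)) e v := by
  refine Tendsto.congr (fun ε => ?_) hf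
  rw [Finset.sum_range_succ']
  simp only [if_true, zero_mul, add_zero, Nat.add_eq_zero_iff, one_ne_zero, and_false, if_false,
    Nat.add_sub_cancel]
  congr 3
  refine Finset.sum_congr rfl fun j _ => ?_
  congr 2
  push_cast
  ring

lemma tendsto_pow_mul_log (m : ℕ) :
    Tendsto (fun ε : ℝ => ε ^ (m + 1) * Real.log (1 / ε)) (𝓝[>] 0) (𝓝 0) := by
  have h1 := (tendsto_log_mul_rpow_nhdsGT_zero (r := (m + 1 : ℕ)) (by positivity)).neg
  rw [neg_zero] at h1
  refine h1.congr fun ε => ?_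
  rw [Real.rpow_natCast, one_div, Real.log_inv]
  ring

/-- The logarithmic and constant coefficients of an expansion of zero vanish. -/
lemma HasExpansion.eq_zero (hf : HasExpansion n (fun _ => 0) c e v) : e = 0 ∧ v = 0 := by
  induction n generalizing c with
  | zero =>
    have h1 : Tendsto (fun ε : ℝ => e * Real.log (1 / ε) + v) (𝓝[>] 0) (𝓝 0) := by
      have h := hf.neg
      rw [neg_zero] at h
      refine h.congr fun ε => ?_
      simp
    have hlog : Tendsto (fun ε : ℝ => Real.log (1 / ε)) (𝓝[>] 0) atTop := by
      refine Real.tendsto_log_atTop.comp ?_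
      exact (tendsto_inv_nhdsGT_zero (𝕜 := ℝ)).congr fun ε => (one_div ε).symm
    have he : e = 0 := by
      have h2 := h1.mul hlog.inv_tendsto_atTop
      have h3 : Tendsto (fun ε : ℝ => e + v * (Real.log (1 / ε))⁻¹) (𝓝[>] 0) (𝓝 (e + v * 0)) :=
        tendsto_const_nhds.add (hlog.inv_tendsto_atTop.const_mul v)
      have h4 : (fun ε : ℝ => (e * Real.log (1 / ε) + v) * (Real.log (1 / ε))⁻¹) =ᶠ[𝓝[>] 0]
          fun ε => e + v * (Real.log (1 / ε))⁻¹ := by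
        filter_upwards [hlog.eventually (eventually_ne_atTop 0)] with ε hε
        field_simp
      have h5 := tendsto_nhds_unique (h2.congr' h4) h3
      simpa using h5.symm
    refine ⟨he, ?_⟩
    rw [he] at h1
    simp only [zero_mul, zero_add] at h1
    exact tendsto_nhds_unique tendsto_const_nhds h1
  | succ m ih =>
    -- multiplication by `ε^{m+1}` isolates the leading coefficient
    have hid : Tendsto (fun ε : ℝ => ε) (𝓝[>] 0) (𝓝 0) := tendsto_id.mono_left nhdsWithin_le_nhds
    have h0 : c 0 = 0 := by
      have h1 : Tendsto (fun ε : ℝ => -(ε ^ (m + 1) * (0 - ((∑ j ∈ Finset.range (m + 1),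
          c j * ε ^ ((j : ℤ) - ((m + 1 : ℕ) : ℤ))) + e * Real.log (1 / ε) + v)))) (𝓝[>] 0)
          (𝓝 (-(0 ^ (m + 1) * 0))) := ((hid.pow (m + 1)).mul hf).neg
      have h2 : Tendsto (fun ε : ℝ => (∑ j ∈ Finset.range m, c (j + 1) * ε ^ (j + 1) + c 0) +
          e * (ε ^ (m + 1) * Real.log (1 / ε)) + v * ε ^ (m + 1)) (𝓝[>] 0)
          (𝓝 ((∑ j ∈ Finset.range m, c (j + 1) * 0 ^ (j + 1) + c 0) + e * 0 + v * 0 ^ (m + 1))) :=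
        (((tendsto_finsetSum _ fun j _ => (hid.pow (j + 1)).const_mul (c (j + 1))).add_const
          (c 0)).add ((tendsto_pow_mul_log m).const_mul e)).add ((hid.pow (m + 1)).const_mul v)
      have h3 := tendsto_nhds_unique (h1.congr' ?_) h2
      · simpa using h3.symm
      · filter_upwards [self_mem_nhdsWithin] with ε hε
        have hε0 : ε ≠ 0 := ne_of_gt hε
        have h4 : ∀ j : ℕ, ε ^ (m + 1) * ε ^ ((j : ℤ) - ((m + 1 : ℕ) : ℤ)) = ε ^ j := by
          intro j
          rw [← zpow_natCast, ← zpow_add₀ hε0, ← zpow_natCast]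
          congr 1
          ring
        have h5 : ε ^ (m + 1) * ∑ j ∈ Finset.range (m + 1),
            c j * ε ^ ((j : ℤ) - ((m + 1 : ℕ) : ℤ)) =
            ∑ j ∈ Finset.range m, c (j + 1) * ε ^ (j + 1) + c 0 := by
          rw [Finset.sum_range_succ', mul_add, Finset.mul_sum]
          congr 1
          · refine Finset.sum_congr rfl fun j _ => ?_
            rw [← h4 (j + 1)]; ring
          · have := h4 0
            rw [pow_zero] at this
            rw [mul_left_comm, this, mul_one]
        rw [← h5]
        ring
    refine ih (c := fun j => c (j + 1)) ?_
    refine Tendsto.congr (fun ε => ?_) hf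
    rw [Finset.sum_range_succ', h0, zero_mul, add_zero]
    congr 3
    refine Finset.sum_congr rfl fun j _ => ?_
    congr 2
    push_cast
    ring

lemma HasExpansion.unique (hf : HasExpansion n f c e v) (hg : HasExpansion n f d e' v') :
    e = e' ∧ v = v' := by
  have h := (hf.linear hg 1 (-1)).congr (g := fun _ => 0) (Eventually.of_forall fun ε => by ring)
  obtain ⟨h1, h2⟩ := h.eq_zero
  exact ⟨by linarith, by linarith⟩

/-- The Taylor polynomial of `h` gives an expansion of `ε^{-n} h(ε)` without logarithm. -/
lemma hasExpansion_of_isBigO {h : ℝ → ℝ}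
    (hO : (fun y => h y - ∑ j ∈ Finset.range (n + 1), c j * y ^ j) =O[𝓝[>] 0]
      fun y : ℝ => y ^ (n + 1)) :
    HasExpansion n (fun ε => h ε * ε ^ (-(n : ℤ))) c 0 (c n) := by
  have hid : Tendsto (fun ε : ℝ => ε) (𝓝[>] 0) (𝓝 0) := tendsto_id.mono_left nhdsWithin_le_nhds
  have h1 := hO.mul (isBigO_refl (fun y : ℝ => y ^ (-(n : ℤ))) (𝓝[>] 0))
  have h2 : Tendsto (fun y : ℝ => y ^ (n + 1) * y ^ (-(n : ℤ))) (𝓝[>] 0) (𝓝 0) := by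
    refine hid.congr' ?_
    filter_upwards [self_mem_nhdsWithin] with ε hε
    have hε0 : ε ≠ 0 := ne_of_gt hε
    rw [← zpow_natCast, ← zpow_add₀ hε0]
    push_cast
    simp
  refine (h1.trans_tendsto h2).congr' ?_
  filter_upwards [self_mem_nhdsWithin] with ε hε
  have hε0 : ε ≠ 0 := ne_of_gt hε
  rw [Finset.sum_range_succ, zero_mul, add_zero, sub_mul, add_mul, Finset.sum_mul]
  congr 2
  · refine Finset.sum_congr rfl fun j _ => ?_
    rw [mul_assoc, ← zpow_natCast, ← zpow_add₀ hε0, ← sub_eq_add_neg]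
  · rw [mul_assoc, ← zpow_natCast, ← zpow_add₀ hε0, add_neg_cancel, zpow_zero, mul_one]

/-- The expansion of `ε^{-n} h(ε)` for an analytic even function `h`; for odd `n` it has no
constant term. -/
lemma exists_hasExpansion_of_analyticAt {h : ℝ → ℝ} (hh : AnalyticAt ℝ h 0)
    (heven : ∀ y, h (-y) = h y) (n : ℕ) :
    ∃ c v, HasExpansion n (fun ε => h ε * ε ^ (-(n : ℤ))) c 0 v ∧ (Odd n → v = 0) := by
  obtain ⟨p, hp⟩ := hh
  have h1 := hp.isBigO_sub_partialSum_pow (n + 1)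
  have h2 : (fun y => h y - ∑ j ∈ Finset.range (n + 1), p.coeff j * y ^ j) =O[𝓝 0]
      fun y : ℝ => y ^ (n + 1) := by
    refine IsBigO.congr' (h1.trans (isBigO_of_le _ fun y => by simp))
      (Eventually.of_forall fun y => ?_) EventuallyEq.rfl
    simp only [zero_add, FormalMultilinearSeries.partialSum,
      FormalMultilinearSeries.apply_eq_pow_smul_coeff, smul_eq_mul, mul_comm]
  have h3 : (fun y => h y - ∑ j ∈ Finset.range (n + 1), (p.coeff j * (-1) ^ j) * y ^ j) =O[𝓝 0]
      fun y : ℝ => y ^ (n + 1) := by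
    have h4 : Tendsto (fun y : ℝ => -y) (𝓝 0) (𝓝 0) := by
      simpa using (continuous_neg (G := ℝ)).tendsto 0
    refine IsBigO.congr' ((h2.comp_tendsto h4).trans (isBigO_of_le _ fun y => by simp))
      (Eventually.of_forall fun y => ?_) EventuallyEq.rfl
    simp only [Function.comp_apply, heven]
    congr 1
    refine Finset.sum_congr rfl fun j _ => ?_
    rw [neg_pow]; ring
  have e1 := hasExpansion_of_isBigO (c := p.coeff) (h2.mono nhdsWithin_le_nhds)
  have e2 := hasExpansion_of_isBigO (c := fun j => p.coeff j * (-1) ^ j)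
    (h3.mono nhdsWithin_le_nhds)
  -- for odd `n`, the Taylor coefficient of order `n` equals its negative
  refine ⟨p.coeff, p.coeff n, e1, fun hn => ?_⟩
  have h5 := (e1.unique e2).2
  rw [hn.neg_one_pow] at h5
  linarith

/-- The function `cosᵐ / sinⁿ` becomes analytic and even on multiplication by `εⁿ`. -/
lemma exists_hasExpansion_cos_pow_div_sin_pow (m n : ℕ) :
    ∃ c v, HasExpansion n (fun ε => Real.cos ε ^ m / Real.sin ε ^ n) c 0 v ∧ (Odd n → v = 0) := by
  -- `dslope sin 0` is the analytic extension of `sin ε / ε`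
  have hs : AnalyticAt ℝ (dslope Real.sin 0) 0 := by
    obtain ⟨p, hp⟩ := (Real.analyticAt_sin (x := 0))
    exact ⟨_, hp.has_fpower_series_dslope_fslope⟩
  have hs0 : dslope Real.sin 0 0 = 1 := by rw [dslope_same, Real.deriv_sin, Real.cos_zero]
  have hsn : ∀ y : ℝ, y ≠ 0 → dslope Real.sin 0 y = Real.sin y / y := by
    intro y hy
    rw [dslope_of_ne _ hy, slope_def_field]
    simp
  obtain ⟨c, v, h1, h2⟩ := exists_hasExpansion_of_analyticAt
    (h := fun y => Real.cos y ^ m * (dslope Real.sin 0 y)⁻¹ ^ n)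
    ((Real.analyticAt_cos.pow m).mul ((hs.inv (by rw [hs0]; exact one_ne_zero)).pow n))
    (fun y => by
      rcases eq_or_ne y 0 with rfl | hy
      · simp
      · simp only [Real.cos_neg]
        rw [hsn y hy, hsn (-y) (neg_ne_zero.mpr hy), Real.sin_neg, neg_div_neg_eq]) n
  refine ⟨c, v, h1.congr ?_, h2⟩
  filter_upwards [self_mem_nhdsWithin] with ε hε
  have hε0 : ε ≠ 0 := ne_of_gt hε
  rw [hsn ε hε0, inv_div, div_pow, zpow_neg, zpow_natCast]
  field_simp

/-! ### The expansion of the cone integrals -/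

lemma sqrt_one_add_sq_pos (s : ℝ) : 0 < √(1 + s ^ 2) := Real.sqrt_pos.mpr (by positivity)

lemma continuous_coneIntegrand (n : ℕ) : Continuous fun s : ℝ => s ^ n / √(1 + s ^ 2) :=
  (continuous_pow n).div (by fun_prop) fun s => (sqrt_one_add_sq_pos s).ne'

lemma hasDerivAt_sqrt_one_add_sq (s : ℝ) :
    HasDerivAt (fun s => √(1 + s ^ 2)) (s / √(1 + s ^ 2)) s := by
  have h1 : HasDerivAt (fun s : ℝ => 1 + s ^ 2) (2 * s) s := by
    simpa using (hasDerivAt_pow 2 s).const_add 1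
  refine (h1.sqrt (by positivity)).congr_deriv ?_
  have := sqrt_one_add_sq_pos s
  field_simp

lemma coneIntegral_zero (T : ℝ) : coneIntegral 0 T = Real.arsinh T := by
  have h : ∀ s ∈ uIcc 0 T, HasDerivAt Real.arsinh (s ^ 0 / √(1 + s ^ 2)) s := fun s _ => by
    rw [pow_zero, one_div]; exact Real.hasDerivAt_arsinh s
  rw [coneIntegral, intervalIntegral.integral_eq_sub_of_hasDerivAt h
    ((continuous_coneIntegrand 0).intervalIntegrable _ _), Real.arsinh_zero, sub_zero]

lemma coneIntegral_one (T : ℝ) : coneIntegral 1 T = √(1 + T ^ 2) - 1 := by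
  have h : ∀ s ∈ uIcc 0 T, HasDerivAt (fun s => √(1 + s ^ 2)) (s ^ 1 / √(1 + s ^ 2)) s :=
    fun s _ => by rw [pow_one]; exact hasDerivAt_sqrt_one_add_sq s
  rw [coneIntegral, intervalIntegral.integral_eq_sub_of_hasDerivAt h
    ((continuous_coneIntegrand 1).intervalIntegrable _ _)]
  simp

/-- The recursion for the cone integrals, by integration of the derivative of
`s^{m+1} √(1 + s²)`. -/
lemma coneIntegral_add_two (m : ℕ) (T : ℝ) :
    (m + 2) * coneIntegral (m + 2) T =
      T ^ (m + 1) * √(1 + T ^ 2) - (m + 1) * coneIntegral m T := by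
  have h : ∀ s ∈ uIcc 0 T, HasDerivAt (fun s => s ^ (m + 1) * √(1 + s ^ 2))
      ((m + 2) * (s ^ (m + 2) / √(1 + s ^ 2)) + (m + 1) * (s ^ m / √(1 + s ^ 2))) s := by
    intro s _
    refine ((hasDerivAt_pow (m + 1) s).fun_mul (hasDerivAt_sqrt_one_add_sq s)).congr_deriv ?_
    have h1 := sqrt_one_add_sq_pos s
    have h2 : √(1 + s ^ 2) ^ 2 = 1 + s ^ 2 := Real.sq_sqrt (by positivity)
    field_simp
    rw [h2]
    push_cast
    ring
  have h1 := (continuous_coneIntegrand (m + 2)).intervalIntegrable (μ := MeasureTheory.volume) 0 T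
  have h2 := (continuous_coneIntegrand m).intervalIntegrable (μ := MeasureTheory.volume) 0 T
  have h3 := intervalIntegral.integral_eq_sub_of_hasDerivAt h
    ((h1.const_mul _).add (h2.const_mul _))
  rw [intervalIntegral.integral_add (h1.const_mul _) (h2.const_mul _),
    intervalIntegral.integral_const_mul, intervalIntegral.integral_const_mul] at h3
  simp only [coneIntegral]
  rw [zero_pow (Nat.succ_ne_zero m), zero_mul, sub_zero] at h3
  linarith

lemma eventually_Ioo_pi_div_two : ∀ᶠ ε : ℝ in 𝓝[>] 0, ε ∈ Ioo 0 (Real.pi / 2) :=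
  Ioo_mem_nhdsGT (by positivity)

lemma sqrt_one_add_cot_sq {ε : ℝ} (hε : ε ∈ Ioo 0 (Real.pi / 2)) :
    √(1 + (Real.cos ε / Real.sin ε) ^ 2) = 1 / Real.sin ε := by
  have hsin : 0 < Real.sin ε :=
    Real.sin_pos_of_pos_of_lt_pi hε.1 (by linarith [Real.pi_pos, hε.2])
  have h : 1 + (Real.cos ε / Real.sin ε) ^ 2 = (1 / Real.sin ε) ^ 2 := by
    field_simp
    linarith [Real.sin_sq_add_cos_sq ε]
  rw [h, Real.sqrt_sq (by positivity)]

/-- The ratio `Γ((n+1)/2) / (√π Γ(n/2 + 1))`, which solves the recursion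
`(n + 2) a(n + 2) = (n + 1) a(n)` with `a(0) = 1` and `a(1) = 2 / π`. -/
def gammaRatio (n : ℕ) : ℝ :=
  Real.Gamma (((n : ℝ) + 1) / 2) / (√Real.pi * Real.Gamma ((n : ℝ) / 2 + 1))

lemma gammaRatio_zero : gammaRatio 0 = 1 := by
  rw [gammaRatio]
  simp only [Nat.cast_zero, zero_add, zero_div, Real.Gamma_one, mul_one, Real.Gamma_one_half_eq]
  exact div_self (Real.sqrt_pos.mpr Real.pi_pos).ne'

lemma gammaRatio_one : gammaRatio 1 = 2 / Real.pi := by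
  rw [gammaRatio]
  have h1 : Real.Gamma ((1 : ℕ) / 2 + 1) = 1 / 2 * √Real.pi := by
    rw [Nat.cast_one, Real.Gamma_add_one (by norm_num), Real.Gamma_one_half_eq]
  have h2 := Real.mul_self_sqrt Real.pi_pos.le
  have h3 := Real.sqrt_pos.mpr Real.pi_pos
  rw [h1]
  rw [Nat.cast_one, show ((1 : ℝ) + 1) / 2 = 1 by norm_num, Real.Gamma_one,
    show √Real.pi * (1 / 2 * √Real.pi) = Real.pi / 2 by linarith, one_div_div]

lemma gammaRatio_add_two (m : ℕ) : (m + 2) * gammaRatio (m + 2) = (m + 1) * gammaRatio m := by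
  rw [gammaRatio, gammaRatio]
  have h1 : Real.Gamma (((m + 2 : ℕ) + 1) / 2 : ℝ) =
      ((m : ℝ) + 1) / 2 * Real.Gamma (((m : ℝ) + 1) / 2) := by
    rw [← Real.Gamma_add_one (by positivity)]
    congr 1
    push_cast
    ring
  have h2 : Real.Gamma (((m + 2 : ℕ) : ℝ) / 2 + 1) =
      ((m : ℝ) / 2 + 1) * Real.Gamma ((m : ℝ) / 2 + 1) := by
    rw [← Real.Gamma_add_one (by positivity)]
    congr 1
    push_cast
    ring
  have h3 : 0 < Real.Gamma ((m : ℝ) / 2 + 1) := Real.Gamma_pos_of_pos (by positivity)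
  have h4 := Real.sqrt_pos.mpr Real.pi_pos
  rw [h1, h2]
  field_simp

lemma hasExpansion_coneIntegral_zero :
    HasExpansion 0 (fun ε => coneIntegral 0 (Real.cos ε / Real.sin ε)) (fun _ => 0) 1
      (Real.log 2) := by
  have hs : Tendsto (fun ε : ℝ => Real.sin ε / ε) (𝓝[>] 0) (𝓝 1) := by
    have h := (Real.hasDerivAt_sin 0).tendsto_slope_zero_right
    simp only [zero_add, Real.sin_zero, sub_zero, Real.cos_zero, smul_eq_mul] at h
    exact h.congr fun ε => by rw [div_eq_inv_mul]
  have hcos : Tendsto (fun ε : ℝ => 1 + Real.cos ε) (𝓝[>] 0) (𝓝 2) := by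
    have h : Continuous fun ε : ℝ => 1 + Real.cos ε := by fun_prop
    have h1 := (h.tendsto 0).mono_left (nhdsWithin_le_nhds (s := Ioi 0))
    rw [Real.cos_zero] at h1
    norm_num at h1
    exact h1
  have h1 := ((hcos.log two_ne_zero).sub (hs.log one_ne_zero)).sub_const (Real.log 2)
  rw [Real.log_one, sub_zero, sub_self] at h1
  refine h1.congr' ?_
  filter_upwards [eventually_Ioo_pi_div_two] with ε hε
  have hsin : 0 < Real.sin ε :=
    Real.sin_pos_of_pos_of_lt_pi hε.1 (by linarith [Real.pi_pos, hε.2])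
  have hc : 0 < Real.cos ε := Real.cos_pos_of_mem_Ioo ⟨by linarith [hε.1, Real.pi_pos], hε.2⟩
  rw [coneIntegral_zero, Real.arsinh, sqrt_one_add_cot_sq hε, ← add_div,
    Real.log_div (by positivity) hsin.ne', Real.log_div hsin.ne' hε.1.ne', one_div, Real.log_inv,
    add_comm (Real.cos ε)]
  simp
  ring

/-- The boundary term in the recursion for the cone integrals is `cos^{m+1} / sin^{m+2}`. It has no
logarithm, and for odd `m` no constant term, so that the relevant coefficient obeys the recursion of
`gammaRatio` up to a sign. -/
lemma exists_hasExpansion_coneIntegral (n : ℕ) :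
    ∃ c e v, HasExpansion n (fun ε => coneIntegral n (Real.cos ε / Real.sin ε)) c e v ∧
      (Even n → e = (-1) ^ (n / 2) * gammaRatio n) ∧
      (Odd n → v = (-1) ^ ((n + 1) / 2) * (Real.pi / 2 * gammaRatio n)) := by
  induction n using Nat.twoStepInduction with
  | zero =>
    exact ⟨_, _, _, hasExpansion_coneIntegral_zero, fun _ => by simp [gammaRatio_zero],
      fun h => absurd h (by decide)⟩
  | one =>
    obtain ⟨c, v, h1, h2⟩ := exists_hasExpansion_cos_pow_div_sin_pow 0 1
    have h3 : HasExpansion 1 (fun _ => (1 : ℝ)) (fun _ => 0) 0 1 := by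
      refine tendsto_const_nhds.congr fun ε => ?_
      simp
    refine ⟨_, _, _, (h1.linear h3 1 (-1)).congr ?_, fun h => absurd h (by decide), fun _ => ?_⟩
    · filter_upwards [eventually_Ioo_pi_div_two] with ε hε
      rw [coneIntegral_one, sqrt_one_add_cot_sq hε]
      ring
    · rw [h2 odd_one, gammaRatio_one]
      have := Real.pi_pos
      field_simp
      norm_num
  | more m ih _ =>
    obtain ⟨c, e, v, h1, he, hv⟩ := ih
    obtain ⟨d, w, h2, hw⟩ := exists_hasExpansion_cos_pow_div_sin_pow (m + 1) (m + 2)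
    have hm : (0 : ℝ) < m + 2 := by positivity
    have h4 : gammaRatio (m + 2) = (m + 1) / (m + 2) * gammaRatio m := by
      rw [div_mul_eq_mul_div, eq_div_iff hm.ne', ← gammaRatio_add_two, mul_comm]
    refine ⟨_, _, _, (h2.linear h1.succ.succ (1 / (m + 2)) (-((m + 1) / (m + 2)))).congr ?_,
      fun h => ?_, fun h => ?_⟩
    · filter_upwards [eventually_Ioo_pi_div_two] with ε hε
      have hsin : 0 < Real.sin ε :=
        Real.sin_pos_of_pos_of_lt_pi hε.1 (by linarith [Real.pi_pos, hε.2])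
      have h3 := coneIntegral_add_two m (Real.cos ε / Real.sin ε)
      rw [sqrt_one_add_cot_sq hε] at h3
      have h4 : (Real.cos ε / Real.sin ε) ^ (m + 1) * (1 / Real.sin ε) =
          Real.cos ε ^ (m + 1) / Real.sin ε ^ (m + 2) := by
        rw [div_pow]
        field_simp
        ring
      have h5 : coneIntegral (m + 2) (Real.cos ε / Real.sin ε) =
          (Real.cos ε ^ (m + 1) / Real.sin ε ^ (m + 2) -
            (m + 1) * coneIntegral m (Real.cos ε / Real.sin ε)) / (m + 2) := by
        rw [eq_div_iff hm.ne', ← h4, ← h3, mul_comm]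
      rw [h5]
      ring
    · have h3 : Even m := by simpa [parity_simps] using h
      rw [he h3, mul_zero, zero_add, show (m + 2) / 2 = m / 2 + 1 by omega, pow_succ]
      rw [h4]
      ring
    · have h3 : Odd m := by simpa [parity_simps] using h
      rw [hv h3, hw h, mul_zero, zero_add,
        show (m + 2 + 1) / 2 = (m + 1) / 2 + 1 by omega, pow_succ]
      rw [h4]
      ring

end Expansion

/-! ### The volume coefficients -/

section Coefficients

open Set Filter MeasureTheory

variable {n k : ℕ}

/-- The area of the unit sphere of `ℝᵐ`. -/
def sphereArea (m : ℕ) : ℝ :=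
  (volume : Measure (EuclideanSpace ℝ (Fin m))).toSphere.real univ

lemma sphereArea_eq {m : ℕ} (hm : 1 ≤ m) :
    sphereArea m = 2 * Real.pi ^ ((m : ℝ) / 2) / Real.Gamma ((m : ℝ) / 2) := by
  have : Nonempty (Fin m) := ⟨⟨0, hm⟩⟩
  have hm0 : (0 : ℝ) < m := by exact_mod_cast hm
  have hΓ : 0 < Real.Gamma ((m : ℝ) / 2) := Real.Gamma_pos_of_pos (by positivity)
  have h1 : √Real.pi ^ m = Real.pi ^ ((m : ℝ) / 2) := by
    rw [Real.sqrt_eq_rpow, ← Real.rpow_natCast, ← Real.rpow_mul Real.pi_pos.le]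
    congr 1
    ring
  rw [sphereArea, Measure.toSphere_real_apply_univ, finrank_euclideanSpace_fin, measureReal_def,
    EuclideanSpace.volume_ball, ENNReal.ofReal_one, one_pow, one_mul, Fintype.card_fin,
    Real.Gamma_add_one (by positivity), h1, ENNReal.toReal_ofReal (by positivity)]
  field_simp

lemma toReal_volumeBeyond_eq (hk : 1 ≤ k) {ε : ℝ} (hε : ε ∈ Ioo 0 (Real.pi / 2)) :
    (volumeBeyond (equatorialFactor n k) ε).toReal =
      sphereArea (n + 1) * sphereArea k * coneIntegral n (Real.cos ε / Real.sin ε) := by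
  have hsin : 0 < Real.sin ε :=
    Real.sin_pos_of_pos_of_lt_pi hε.1 (by linarith [Real.pi_pos, hε.2])
  have hc : 0 < Real.cos ε := Real.cos_pos_of_mem_Ioo ⟨by linarith [hε.1, Real.pi_pos], hε.2⟩
  rw [volumeBeyond_eq hk hε.1 hε.2, ENNReal.toReal_mul, ENNReal.toReal_mul,
    ENNReal.toReal_ofReal (coneIntegral_nonneg n (div_pos hc hsin).le)]
  rfl

lemma exists_hasVolumeExpansion (hk : 1 ≤ k) :
    ∃ c E V, HasVolumeExpansion (equatorialFactor n k) c E V ∧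
      (Even n → E = sphereArea (n + 1) * sphereArea k * ((-1) ^ (n / 2) * gammaRatio n)) ∧
      (Odd n → V = sphereArea (n + 1) * sphereArea k *
        ((-1) ^ ((n + 1) / 2) * (Real.pi / 2 * gammaRatio n))) := by
  obtain ⟨c, e, v, h, he, hv⟩ := exists_hasExpansion_coneIntegral n
  refine ⟨_, _, _, ⟨fun ε hε => volumeBeyond_ne_top hk hε,
    (h.linear h (sphereArea (n + 1) * sphereArea k) 0).congr ?_⟩, fun hn => ?_, fun hn => ?_⟩
  · filter_upwards [eventually_Ioo_pi_div_two] with ε hε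
    rw [toReal_volumeBeyond_eq hk hε, zero_mul, add_zero]
  · rw [he hn, zero_mul, add_zero]
  · rw [hv hn, zero_mul, add_zero]

lemma sphereArea_mul_gammaRatio (n : ℕ) (hk : 1 ≤ k) :
    sphereArea (n + 1) * sphereArea k * gammaRatio n =
      4 * Real.pi ^ (((n : ℝ) + k) / 2) /
        (Real.Gamma ((n : ℝ) / 2 + 1) * Real.Gamma ((k : ℝ) / 2)) := by
  have hk0 : (0 : ℝ) < k := by exact_mod_cast hk
  have h1 : 0 < Real.Gamma ((n : ℝ) / 2 + 1) := Real.Gamma_pos_of_pos (by positivity)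
  have h2 : 0 < Real.Gamma (((n : ℝ) + 1) / 2) := Real.Gamma_pos_of_pos (by positivity)
  have h3 : 0 < Real.Gamma ((k : ℝ) / 2) := Real.Gamma_pos_of_pos (by positivity)
  have h4 : 0 < √Real.pi := Real.sqrt_pos.mpr Real.pi_pos
  have h5 : Real.pi ^ (((n : ℝ) + 1) / 2) * Real.pi ^ ((k : ℝ) / 2) =
      √Real.pi * Real.pi ^ (((n : ℝ) + k) / 2) := by
    rw [Real.sqrt_eq_rpow, ← Real.rpow_add Real.pi_pos, ← Real.rpow_add Real.pi_pos]
    congr 1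
    ring
  rw [sphereArea_eq (Nat.le_add_left 1 n), sphereArea_eq hk, gammaRatio]
  push_cast
  field_simp
  linear_combination 4 * h5

lemma HasVolumeExpansion.coeff_log_eq (hk : 1 ≤ k) (hn : Even n) {c : ℕ → ℝ} {E V : ℝ}
    (h : HasVolumeExpansion (equatorialFactor n k) c E V) :
    E = (-1) ^ (n / 2) * (4 * Real.pi ^ (((n : ℝ) + k) / 2)) /
      ((Nat.factorial (n / 2) : ℝ) * Real.Gamma ((k : ℝ) / 2)) := by
  obtain ⟨c', E', V', h', hE, -⟩ := exists_hasVolumeExpansion (n := n) hk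
  have hΓ : Real.Gamma ((n : ℝ) / 2 + 1) = Nat.factorial (n / 2) := by
    rw [← Real.Gamma_nat_eq_factorial, Nat.cast_div hn.two_dvd two_ne_zero, Nat.cast_two]
  have h1 := sphereArea_mul_gammaRatio n hk
  rw [hΓ] at h1
  rw [(HasExpansion.unique h.2 h'.2).1, hE hn, mul_left_comm, h1]
  ring

lemma HasVolumeExpansion.coeff_const_eq (hk : 1 ≤ k) (hn : Odd n) {c : ℕ → ℝ} {E V : ℝ}
    (h : HasVolumeExpansion (equatorialFactor n k) c E V) :
    V = (-1) ^ ((n + 1) / 2) * (2 * Real.pi ^ (1 + ((n : ℝ) + k) / 2)) /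
      (Real.Gamma (((n : ℝ) + 2) / 2) * Real.Gamma ((k : ℝ) / 2)) := by
  obtain ⟨c', E', V', h', -, hV⟩ := exists_hasVolumeExpansion (n := n) hk
  have h1 := sphereArea_mul_gammaRatio n hk
  rw [(HasExpansion.unique h.2 h'.2).2, hV hn, Real.rpow_add Real.pi_pos, Real.rpow_one,
    show ((n : ℝ) + 2) / 2 = (n : ℝ) / 2 + 1 by ring, mul_left_comm, mul_left_comm _ (Real.pi / 2),
    h1]
  ring

end Coefficients

end EquatorialYamabe

end

theorem mainTheorem8 (n k : ℕ) (hn : 1 ≤ n) (hk : 1 ≤ k) :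
    EquatorialYamabe.IsSingularYamabe (EquatorialYamabe.equatorialFactor n k) ∧
    (k < n + 2 → ∀ u : EquatorialYamabe.RoundSphere n k → ℝ,
      EquatorialYamabe.IsSingularYamabe u → u = EquatorialYamabe.equatorialFactor n k) ∧
    EquatorialYamabe.IsometricToHyperbolicTimesSphere
      (EquatorialYamabe.equatorialFactor n k) ∧
    (∃ (c : ℕ → ℝ) (E V : ℝ),
      EquatorialYamabe.HasVolumeExpansion (EquatorialYamabe.equatorialFactor n k) c E V) ∧
    (∀ (c : ℕ → ℝ) (E V : ℝ),
      EquatorialYamabe.HasVolumeExpansion (EquatorialYamabe.equatorialFactor n k) c E V →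
      (Even n →
        E = (-1) ^ (n / 2) * (4 * Real.pi ^ (((n : ℝ) + k) / 2)) /
          ((Nat.factorial (n / 2) : ℝ) * Real.Gamma ((k : ℝ) / 2))) ∧
      (Odd n →
        V = (-1) ^ ((n + 1) / 2) * (2 * Real.pi ^ (1 + ((n : ℝ) + k) / 2)) /
          (Real.Gamma (((n : ℝ) + 2) / 2) * Real.Gamma ((k : ℝ) / 2))) ∧
      (n = 2 → k = 2 → E = -4 * Real.pi ^ 2) ∧
      (n = 1 → k = 2 → V = -4 * Real.pi ^ 2)) := by
  refine ⟨EquatorialYamabe.isSingularYamabe_equatorialFactor,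
    fun hkn u hu => hu.eq_equatorialFactor hn hk hkn,
    EquatorialYamabe.isometricToHyperbolicTimesSphere,
    ?_, fun c E V h => ⟨h.coeff_log_eq hk, h.coeff_const_eq hk, ?_, ?_⟩⟩
  · obtain ⟨c, E, V, h, -⟩ := EquatorialYamabe.exists_hasVolumeExpansion (n := n) hk
    exact ⟨c, E, V, h⟩
  · rintro rfl rfl
    rw [h.coeff_log_eq hk even_two]
    norm_num
  · rintro rfl rfl
    have h1 : Real.Gamma (3 / 2 : ℝ) = 1 / 2 * √Real.pi := by
      rw [show (3 / 2 : ℝ) = 1 / 2 + 1 by norm_num, Real.Gamma_add_one (by norm_num),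
        Real.Gamma_one_half_eq]
    have h2 : Real.pi ^ (1 + (1 + 2) / 2 : ℝ) = Real.pi ^ 2 * √Real.pi := by
      rw [show (1 + (1 + 2) / 2 : ℝ) = 2 + 1 / 2 by norm_num, Real.rpow_add Real.pi_pos,
        Real.rpow_two, Real.sqrt_eq_rpow]
    have h3 : 0 < √Real.pi := Real.sqrt_pos.mpr Real.pi_pos
    rw [h.coeff_const_eq hk odd_one]
    simp only [Nat.cast_one, Nat.cast_ofNat, show ((1 : ℝ) + 2) / 2 = 3 / 2 by norm_num,
      div_self (two_ne_zero (α := ℝ)), Real.Gamma_one, h1]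
    rw [show (1 + 3 / 2 : ℝ) = 1 + (1 + 2) / 2 by norm_num, h2]
    field_simp
    norm_num
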